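/- **Setting: the calculus.** Fix a signature of base types $\Delta_T;\cdot\vdash T\ \mathrm{type}$ and base terms $\Delta_c;x:B_c\vdash c:A_c$ (possibly none). ILDTT with $I$- and $\otimes$-types over the signature is intuitionistic linear dependent type theory. It has contexts $\Delta;\Xi$ with an intuitionistic region $\Delta$ and a linear region $\Xi$ of types depending on $\Delta$, and the six forms of judgement $\vdash\Delta;\Xi\ \mathrm{ctxt}$, $\Delta;\cdot\vdash A\ \mathrm{type}$, $\Delta;\Xi\vdash a:A$, $\vdash\Delta;\Xi\equiv\Delta';\Xi'\ \mathrm{ctxt}$, $\Delta;\cdot\vdash A\equiv A'\ \mathrm{type}$, $\Delta;\Xi\vdash a\equiv a':A$. Its rules are: context formation; intuitionistic and linear variables; equality is an equivalence relation, with conversion and congruence; intuitionistic weakening; intuitionistic and linear exchange; intuitionistic and linear substitution; formation, introduction, elimination, computation and uniqueness rules for $I$ and $\otimes$; the commuting conversions $C[\mathrm{let}\ t\ \mathrm{be}\ p\ \mathrm{in}\ c]\equiv\mathrm{let}\ t\ \mathrm{be}\ p\ \mathrm{in}\ C[c]$ for linear program contexts $C[-]$ that bind no free variable of $t$; and the rules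 that introduce the base types and base terms with arbitrary well-typed arguments. **Setting: the models.** A strict indexed symmetric monoidal category with comprehension consists of a category $\mathcal C$ with a terminal object, a functor $\mathcal L:\mathcal C^{op}\to\mathrm{SMCat}$ into symmetric monoidal categories and symmetric strong monoidal functors (write $-\{f\}=\mathcal L(f)$), and, for all $\Delta\in\mathcal C$ and $A\in\mathcal L(\Delta)$, a representation of $x\mapsto\mathcal L(\mathrm{dom}\,x)(I,A\{x\}):(\mathcal C/\Delta)^{op}\to\mathrm{Set}$, with representing object $\mathbf p_{\Delta,A}:\Delta.A\to\Delta$, universal element $\mathbf v_{\Delta,A}\in\mathcal L(\Delta.A)(I,A\{\mathbf p_{\Delta,A}\})$, and $\langle f,a\rangle:\Delta'\to\Delta.A$ the morphism corresponding to $f:\Delta'\to\Delta$ and $a\in\mathcal L(\Delta')(I,A\{f\})$. **Interpretation.** Let each base type $T$ denote an object of $\mathcal L(\llbracket\Delta_T\rrbracket)$ and each base term $c$ a morphism $\llbracket B_c\rrbracket\to\llbracket A_c\rrbracket$ of $\mathcal L(\llbracket\Delta_c\rrbracket)$. Contexts $\Delta;\Xi$ are interpreted by pairs of objects $\llbracket\Delta\rrbracket\in\mathcal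 C$, $\llbracket\Xi\rrbracket\in\mathcal L(\llbracket\Delta\rrbracket)$, types in context $\Delta$ by objects $\llbracket A\rrbracket\in\mathcal L(\llbracket\Delta\rrbracket)$, and terms by morphisms $\llbracket a\rrbracket:\llbracket\Xi\rrbracket\to\llbracket A\rrbracket$ of $\mathcal L(\llbracket\Delta\rrbracket)$, as follows. * $\llbracket\cdot\rrbracket$ is the terminal object, $\llbracket\Delta,x:A\rrbracket=\llbracket\Delta\rrbracket.\llbracket A\rrbracket$, the variable $x$ is interpreted by $\mathbf v$ and the variables of $\Delta$ are reindexed along $\mathbf p$. * In the linear region, $\llbracket\cdot\rrbracket=I$ and $\llbracket\Xi,x:A\rrbracket=\llbracket\Xi\rrbracket\otimes\llbracket A\rrbracket$. * $I$, $\otimes$, their terms, linear variables and linear exchange are interpreted by the symmetric monoidal structure of $\mathcal L(\llbracket\Delta\rrbracket)$. * $T(\vec a)$ and $c(\vec a;b)$ are interpreted by reindexing the denotations of $T$ and $c$ along the morphism $\langle\vec a\rangle$ of $\mathcal C$ determined by the arguments (and composing with $\llbracket b\rrbracket$). **Theorem (Soundness).** For every signature, every strict indexed symmetric monoidal category with comprehension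 and all such denotations of the base types and base terms, the following hold. 1. The contexts, types and terms in every derivable judgement have exactly one interpretation. In every derivable equality judgement the two sides have equal interpretations. 2. Weakening $\Delta,\Delta'\rightsquigarrow\Delta,x:A,\Delta'$ of types and terms is interpreted by $\mathcal L(w)$, where $w$ is the extension of $\mathbf p:\llbracket\Delta\rrbracket.\llbracket A\rrbracket\to\llbracket\Delta\rrbracket$ along $\Delta'$. 3. Substitution of $\Delta;\cdot\vdash a:A$ for $x$ in types and terms over $\Delta,x:A,\Delta'$ is interpreted by $\mathcal L(w)$, where $w$ is the extension of $\langle\mathrm{id},\llbracket a\rrbracket\rangle:\llbracket\Delta\rrbracket\to\llbracket\Delta\rrbracket.\llbracket A\rrbracket$ along $\Delta'$. 4. Linear substitution is interpreted by composition: for $\Delta;\Xi,x:A\vdash b:B$ and $\Delta;\Xi'\vdash a:A$, $\llbracket b[a/x]\rrbracket$ is $\llbracket\Xi,\Xi'\rrbracket\cong\llbracket\Xi\rrbracket\otimes\llbracket\Xi'\rrbracket\xrightarrow{\mathrm{id}\otimes\llbracket a\rrbracket}\llbracket\Xi\rrbracket\otimes\llbracket A\rrbracket\xrightarrow{\llbracket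 b\rrbracket}\llbracket B\rrbracket$. Here the extension of $f:D'\to D$ by one type is $\langle f\circ\mathbf p,\mathbf v\rangle:D'.A\{f\}\to D.A$. Reindexing along $f$ in 2, 3 and in the interpretation of variables, base types and base terms is understood up to the canonical isomorphisms $I\cong I\{f\}$ and $A\{f\}\otimes B\{f\}\cong(A\otimes B)\{f\}$. -/

import Mathlib

open CategoryTheory MonoidalCategory Opposite

universe w v₁ u₁ v u

namespace ILDTT

/-! ## Raw expressions

Intuitionistic variables are represented by their position in the intuitionistic context, counted
from the left and starting with 0. Nothing in the `I`, `⊗`-fragment binds them, so a variable keeps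
its number when the context is extended on the right. Linear variables are de Bruijn indices: index
0 is the most recently declared linear variable. -/

/-- The symbols of a signature: base types and base terms, each with a number of intuitionistic
parameters. -/
structure Symbols where
  TyC : Type w
  TmC : Type w
  tyAr : TyC → ℕ
  tmAr : TmC → ℕ

/-- Raw terms. -/
inductive Tm (𝔽 : Symbols.{w}) : Type w
  /-- an intuitionistic variable -/
  | ivar (i : ℕ)
  /-- a linear variable -/
  | lvar (j : ℕ)
  /-- `c(us; b)`: a base term with intuitionistic arguments `us` and a linear argument `b` -/
  | con (c : 𝔽.TmC) (us : Fin (𝔽.tmAr c) → Tm 𝔽) (b : Tm 𝔽)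
  /-- `*` -/
  | star
  /-- `let t be * in a` -/
  | letU (t a : Tm 𝔽)
  /-- `a ⊗ b` -/
  | tens (a b : Tm 𝔽)
  /-- `let t be x ⊗ y in c`; in `c`, the index of `x` is 1 and that of `y` is 0 -/
  | letT (t c : Tm 𝔽)

/-- Raw types. -/
inductive Ty (𝔽 : Symbols.{w}) : Type w
  /-- `T(us)`: a base type with intuitionistic arguments `us` -/
  | con (T : 𝔽.TyC) (us : Fin (𝔽.tyAr T) → Tm 𝔽)
  | unit
  | tensor (A B : Ty 𝔽)

variable {𝔽 : Symbols.{w}}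

namespace Tm

/-- Simultaneous substitution for the intuitionistic variables. The terms substituted have no free
linear variables, so there is nothing to be shifted under the linear binders. -/
def isub (σ : ℕ → Tm 𝔽) : Tm 𝔽 → Tm 𝔽
  | ivar i => σ i
  | lvar j => lvar j
  | con c us b => con c (fun i => (us i).isub σ) (b.isub σ)
  | star => star
  | letU t a => letU (t.isub σ) (a.isub σ)
  | tens a b => tens (a.isub σ) (b.isub σ)
  | letT t c => letT (t.isub σ) (c.isub σ)

/-- A renaming of linear variables, under two more binders. -/
def lift₂ (r : ℕ → ℕ) : ℕ → ℕ
  | 0 => 0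
  | 1 => 1
  | j + 2 => r j + 2

/-- Renaming of linear variables. The intuitionistic arguments of a base term have no linear
variables. -/
def lren (r : ℕ → ℕ) : Tm 𝔽 → Tm 𝔽
  | ivar i => ivar i
  | lvar j => lvar (r j)
  | con c us b => con c us (b.lren r)
  | star => star
  | letU t a => letU (t.lren r) (a.lren r)
  | tens a b => tens (a.lren r) (b.lren r)
  | letT t c => letT (t.lren r) (c.lren (lift₂ r))

/-- The term `a` after the declaration of `m` more linear variables. -/
def lshift (m : ℕ) (a : Tm 𝔽) : Tm 𝔽 := a.lren (fun j => j + m)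

/-- A substitution for linear variables, under two more binders. -/
def liftSub₂ (τ : ℕ → Tm 𝔽) : ℕ → Tm 𝔽
  | 0 => lvar 0
  | 1 => lvar 1
  | j + 2 => (τ j).lshift 2

/-- Simultaneous (capture avoiding) substitution for the linear variables. -/
def lsub (τ : ℕ → Tm 𝔽) : Tm 𝔽 → Tm 𝔽
  | ivar i => ivar i
  | lvar j => τ j
  | con c us b => con c us (b.lsub τ)
  | star => star
  | letU t a => letU (t.lsub τ) (a.lsub τ)
  | tens a b => tens (a.lsub τ) (b.lsub τ)
  | letT t c => letT (t.lsub τ) (c.lsub (liftSub₂ τ))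

end Tm

/-- Simultaneous substitution for the intuitionistic variables of a type. -/
def Ty.isub (σ : ℕ → Tm 𝔽) : Ty 𝔽 → Ty 𝔽
  | .con T us => .con T (fun i => (us i).isub σ)
  | .unit => .unit
  | .tensor A B => .tensor (A.isub σ) (B.isub σ)

/-- Weakening by a new intuitionistic variable at position `k`. -/
def wkAt (k : ℕ) : ℕ → Tm 𝔽 := fun i => if i < k then .ivar i else .ivar (i + 1)

/-- The transposition of `k` and `k + 1`. -/
def swapAt (k : ℕ) : ℕ → ℕ := fun i => if i = k then k + 1 else if i = k + 1 then k else i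

/-- Exchange of the intuitionistic variables at positions `k` and `k + 1`. -/
def exAt (k : ℕ) : ℕ → Tm 𝔽 := fun i => .ivar (swapAt k i)

/-- Substitution `[a/x]`, where `x` is the intuitionistic variable at position `k`. -/
def subAt (k : ℕ) (a : Tm 𝔽) : ℕ → Tm 𝔽 :=
  fun i => if i < k then .ivar i else if i = k then a else .ivar (i - 1)

/-- Substitution of `us` for all the variables of an intuitionistic context of length `n`. -/
def inst {n : ℕ} (us : Fin n → Tm 𝔽) : ℕ → Tm 𝔽 :=
  fun i => if h : i < n then us ⟨i, h⟩ else .ivar i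

/-- Linear substitution `[a/x]`, where `x` is the last variable of `Ξ, x : A` and `a` lives in a
linear context `Ξ'` of length `m`; the result lives in `Ξ, Ξ'`. -/
def linSub (m : ℕ) (a : Tm 𝔽) : ℕ → Tm 𝔽
  | 0 => a
  | j + 1 => .lvar (j + m)

/-- Linear substitution `[a/x, b/y]` for the last two variables of `Ξ, x : A, y : B`. -/
def linSub₂ (a b : Tm 𝔽) : ℕ → Tm 𝔽
  | 0 => b
  | 1 => a
  | j + 2 => .lvar j

/-- Linear program contexts `C[-]`: terms with one hole, in a linear position. -/
inductive PCtx (𝔽 : Symbols.{w}) : Type w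
  | hole
  | con (c : 𝔽.TmC) (us : Fin (𝔽.tmAr c) → Tm 𝔽) (C : PCtx 𝔽)
  | letU₁ (C : PCtx 𝔽) (a : Tm 𝔽)
  | letU₂ (t : Tm 𝔽) (C : PCtx 𝔽)
  | tens₁ (C : PCtx 𝔽) (b : Tm 𝔽)
  | tens₂ (a : Tm 𝔽) (C : PCtx 𝔽)
  | letT₁ (C : PCtx 𝔽) (c : Tm 𝔽)
  | letT₂ (t : Tm 𝔽) (C : PCtx 𝔽)

namespace PCtx

/-- `C[e]`; the free variables of `e` may be bound by `C`. -/
def plug (e : Tm 𝔽) : PCtx 𝔽 → Tm 𝔽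
  | hole => e
  | con c us C => .con c us (C.plug e)
  | letU₁ C a => .letU (C.plug e) a
  | letU₂ t C => .letU t (C.plug e)
  | tens₁ C b => .tens (C.plug e) b
  | tens₂ a C => .tens a (C.plug e)
  | letT₁ C c => .letT (C.plug e) c
  | letT₂ t C => .letT t (C.plug e)

/-- The number of linear variables that `C` binds at its hole. -/
def depth : PCtx 𝔽 → ℕ
  | hole => 0
  | con _ _ C => C.depth
  | letU₁ C _ => C.depth
  | letU₂ _ C => C.depth
  | tens₁ C _ => C.depth
  | tens₂ _ C => C.depth
  | letT₁ C _ => C.depth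
  | letT₂ _ C => C.depth + 2

/-- Renaming of the free linear variables of `C`. -/
def lren (r : ℕ → ℕ) : PCtx 𝔽 → PCtx 𝔽
  | hole => hole
  | con c us C => con c us (C.lren r)
  | letU₁ C a => letU₁ (C.lren r) (a.lren r)
  | letU₂ t C => letU₂ (t.lren r) (C.lren r)
  | tens₁ C b => tens₁ (C.lren r) (b.lren r)
  | tens₂ a C => tens₂ (a.lren r) (C.lren r)
  | letT₁ C c => letT₁ (C.lren r) (c.lren (Tm.lift₂ r))
  | letT₂ t C => letT₂ (t.lren r) (C.lren (Tm.lift₂ r))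

end PCtx

/-- Moves the two innermost linear variables outside the next `d` ones. -/
def moveOut (d : ℕ) : ℕ → ℕ :=
  fun j => if j < 2 then j + d else if j < d + 2 then j - 2 else j

/-! ## Signatures and judgements -/

/-- A signature of base types `Δ_T; · ⊢ T type` and base terms `Δ_c; B_c ⊢ c : A_c`. -/
structure Signature extends Symbols.{w} where
  tyCtx : (T : TyC) → Fin (tyAr T) → Ty toSymbols
  tmCtx : (c : TmC) → Fin (tmAr c) → Ty toSymbols
  tmArg : (c : TmC) → Ty toSymbols
  tmRes : (c : TmC) → Ty toSymbols

/-- The six forms of judgement. An intuitionistic context is listed from left to right. A linear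
context is listed with its most recent declaration first (so that the index of a linear variable is
its position in the list); hence `Ξ, x : A` is `A :: Ξ` and `Ξ, Ξ'` is `Ξ' ++ Ξ`. -/
inductive Judgement (𝔽 : Symbols.{w}) : Type w
  /-- `⊢ Δ; Ξ ctxt` -/
  | ctx (Δ Ξ : List (Ty 𝔽))
  /-- `Δ; · ⊢ A type` -/
  | ty (Δ : List (Ty 𝔽)) (A : Ty 𝔽)
  /-- `Δ; Ξ ⊢ a : A` -/
  | tm (Δ Ξ : List (Ty 𝔽)) (a : Tm 𝔽) (A : Ty 𝔽)
  /-- `⊢ Δ; Ξ ≡ Δ'; Ξ' ctxt` -/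
  | ctxEq (Δ Ξ Δ' Ξ' : List (Ty 𝔽))
  /-- `Δ; · ⊢ A ≡ A' type` -/
  | tyEq (Δ : List (Ty 𝔽)) (A A' : Ty 𝔽)
  /-- `Δ; Ξ ⊢ a ≡ a' : A` -/
  | tmEq (Δ Ξ : List (Ty 𝔽)) (a a' : Tm 𝔽) (A : Ty 𝔽)

/-- The context `Δ, x : A, Δ'` obtained from `Δ, Δ'`. -/
def wkCtx (Δ : List (Ty 𝔽)) (A : Ty 𝔽) (Δ' : List (Ty 𝔽)) : List (Ty 𝔽) :=
  Δ ++ A :: Δ'.map (Ty.isub (wkAt Δ.length))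

/-- The context `Δ, Δ'[a/x]` obtained from `Δ, x : A, Δ'`. -/
def subCtx (Δ : List (Ty 𝔽)) (a : Tm 𝔽) (Δ' : List (Ty 𝔽)) : List (Ty 𝔽) :=
  Δ ++ Δ'.map (Ty.isub (subAt Δ.length a))

/-- The context `Δ, x' : A', x : A, Δ'` obtained from `Δ, x : A, x' : A', Δ'`. -/
def exCtx (Δ : List (Ty 𝔽)) (A A' : Ty 𝔽) (Δ' : List (Ty 𝔽)) : List (Ty 𝔽) :=
  Δ ++ A' :: A :: Δ'.map (Ty.isub (exAt Δ.length))

open Judgement in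
/-- The derivable judgements of ILDTT with `I`- and `⊗`-types over a signature. -/
inductive Der (𝕊 : Signature.{w}) : Judgement 𝕊.toSymbols → Prop
  -- context formation
  | c_emp : Der 𝕊 (ctx [] [])
  | int_c_ext {Δ Ξ A} : Der 𝕊 (ctx Δ Ξ) → Der 𝕊 (ty Δ A) → Der 𝕊 (ctx (Δ ++ [A]) Ξ)
  | int_c_ext_eq {Δ Ξ Δ' Ξ' A B} : Der 𝕊 (ctxEq Δ Ξ Δ' Ξ') → Der 𝕊 (tyEq Δ A B) →
      Der 𝕊 (ctxEq (Δ ++ [A]) Ξ (Δ' ++ [B]) Ξ')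
  | lin_c_ext {Δ Ξ A} : Der 𝕊 (ctx Δ Ξ) → Der 𝕊 (ty Δ A) → Der 𝕊 (ctx Δ (A :: Ξ))
  | lin_c_ext_eq {Δ Ξ Δ' Ξ' A B} : Der 𝕊 (ctxEq Δ Ξ Δ' Ξ') → Der 𝕊 (tyEq Δ A B) →
      Der 𝕊 (ctxEq Δ (A :: Ξ) Δ' (B :: Ξ'))
  -- variables
  | int_var {Δ A Δ'} : Der 𝕊 (ctx (Δ ++ A :: Δ') []) →
      Der 𝕊 (tm (Δ ++ A :: Δ') [] (.ivar Δ.length) A)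
  | lin_var {Δ A} : Der 𝕊 (ctx Δ [A]) → Der 𝕊 (tm Δ [A] (.lvar 0) A)
  -- judgemental equality is an equivalence relation
  | c_eq_r {Δ Ξ} : Der 𝕊 (ctx Δ Ξ) → Der 𝕊 (ctxEq Δ Ξ Δ Ξ)
  | c_eq_s {Δ Ξ Δ' Ξ'} : Der 𝕊 (ctxEq Δ Ξ Δ' Ξ') → Der 𝕊 (ctxEq Δ' Ξ' Δ Ξ)
  | c_eq_t {Δ Ξ Δ' Ξ' Δ'' Ξ''} : Der 𝕊 (ctxEq Δ Ξ Δ' Ξ') → Der 𝕊 (ctxEq Δ' Ξ' Δ'' Ξ'') →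
      Der 𝕊 (ctxEq Δ Ξ Δ'' Ξ'')
  | ty_eq_r {Δ A} : Der 𝕊 (ty Δ A) → Der 𝕊 (tyEq Δ A A)
  | ty_eq_s {Δ A A'} : Der 𝕊 (tyEq Δ A A') → Der 𝕊 (tyEq Δ A' A)
  | ty_eq_t {Δ A A' A''} : Der 𝕊 (tyEq Δ A A') → Der 𝕊 (tyEq Δ A' A'') → Der 𝕊 (tyEq Δ A A'')
  | tm_eq_r {Δ Ξ a A} : Der 𝕊 (tm Δ Ξ a A) → Der 𝕊 (tmEq Δ Ξ a a A)
  | tm_eq_s {Δ Ξ a a' A} : Der 𝕊 (tmEq Δ Ξ a a' A) → Der 𝕊 (tmEq Δ Ξ a' a A)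
  | tm_eq_t {Δ Ξ a a' a'' A} : Der 𝕊 (tmEq Δ Ξ a a' A) → Der 𝕊 (tmEq Δ Ξ a' a'' A) →
      Der 𝕊 (tmEq Δ Ξ a a'' A)
  -- conversion
  | tm_conv {Δ Ξ Δ' Ξ' a A A'} : Der 𝕊 (tm Δ Ξ a A) → Der 𝕊 (ctxEq Δ Ξ Δ' Ξ') →
      Der 𝕊 (tyEq Δ A A') → Der 𝕊 (tm Δ' Ξ' a A')
  | ty_conv {Δ Δ' A} : Der 𝕊 (ty Δ A) → Der 𝕊 (ctxEq Δ [] Δ' []) → Der 𝕊 (ty Δ' A)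
  | tm_eq_conv {Δ Ξ Δ' Ξ' a a' A A'} : Der 𝕊 (tmEq Δ Ξ a a' A) → Der 𝕊 (ctxEq Δ Ξ Δ' Ξ') →
      Der 𝕊 (tyEq Δ A A') → Der 𝕊 (tmEq Δ' Ξ' a a' A')
  | ty_eq_conv {Δ Δ' A A'} : Der 𝕊 (tyEq Δ A A') → Der 𝕊 (ctxEq Δ [] Δ' []) →
      Der 𝕊 (tyEq Δ' A A')
  -- intuitionistic weakening
  | int_weak_ty {Δ Δ' A B} : Der 𝕊 (ty (Δ ++ Δ') B) → Der 𝕊 (ty Δ A) →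
      Der 𝕊 (ty (wkCtx Δ A Δ') (B.isub (wkAt Δ.length)))
  | int_weak_ty_eq {Δ Δ' A B B'} : Der 𝕊 (tyEq (Δ ++ Δ') B B') → Der 𝕊 (ty Δ A) →
      Der 𝕊 (tyEq (wkCtx Δ A Δ') (B.isub (wkAt Δ.length)) (B'.isub (wkAt Δ.length)))
  | int_weak_tm {Δ Δ' Ξ A b B} : Der 𝕊 (tm (Δ ++ Δ') Ξ b B) → Der 𝕊 (ty Δ A) →
      Der 𝕊 (tm (wkCtx Δ A Δ') (Ξ.map (Ty.isub (wkAt Δ.length))) (b.isub (wkAt Δ.length))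
        (B.isub (wkAt Δ.length)))
  | int_weak_tm_eq {Δ Δ' Ξ A b b' B} : Der 𝕊 (tmEq (Δ ++ Δ') Ξ b b' B) → Der 𝕊 (ty Δ A) →
      Der 𝕊 (tmEq (wkCtx Δ A Δ') (Ξ.map (Ty.isub (wkAt Δ.length))) (b.isub (wkAt Δ.length))
        (b'.isub (wkAt Δ.length)) (B.isub (wkAt Δ.length)))
  -- intuitionistic exchange of `x : A` and `x' : A'`, where `A'` is a type already in context `Δ`
  -- (so that `x` is not free in it)
  | int_exch_ty {Δ Δ' A A' B} : Der 𝕊 (ty (Δ ++ A :: A' :: Δ') B) → Der 𝕊 (ty Δ A') →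
      Der 𝕊 (ty (exCtx Δ A A' Δ') (B.isub (exAt Δ.length)))
  | int_exch_ty_eq {Δ Δ' A A' B B'} : Der 𝕊 (tyEq (Δ ++ A :: A' :: Δ') B B') →
      Der 𝕊 (ty Δ A') →
      Der 𝕊 (tyEq (exCtx Δ A A' Δ') (B.isub (exAt Δ.length)) (B'.isub (exAt Δ.length)))
  | int_exch_tm {Δ Δ' Ξ A A' b B} : Der 𝕊 (tm (Δ ++ A :: A' :: Δ') Ξ b B) → Der 𝕊 (ty Δ A') →
      Der 𝕊 (tm (exCtx Δ A A' Δ') (Ξ.map (Ty.isub (exAt Δ.length))) (b.isub (exAt Δ.length))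
        (B.isub (exAt Δ.length)))
  | int_exch_tm_eq {Δ Δ' Ξ A A' b b' B} : Der 𝕊 (tmEq (Δ ++ A :: A' :: Δ') Ξ b b' B) →
      Der 𝕊 (ty Δ A') →
      Der 𝕊 (tmEq (exCtx Δ A A' Δ') (Ξ.map (Ty.isub (exAt Δ.length))) (b.isub (exAt Δ.length))
        (b'.isub (exAt Δ.length)) (B.isub (exAt Δ.length)))
  -- linear exchange
  | lin_exch_tm {Δ Ξ Ξ' A A' b B} : Der 𝕊 (tm Δ (Ξ' ++ A' :: A :: Ξ) b B) →
      Der 𝕊 (tm Δ (Ξ' ++ A :: A' :: Ξ) (b.lren (swapAt Ξ'.length)) B)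
  | lin_exch_tm_eq {Δ Ξ Ξ' A A' b b' B} : Der 𝕊 (tmEq Δ (Ξ' ++ A' :: A :: Ξ) b b' B) →
      Der 𝕊 (tmEq Δ (Ξ' ++ A :: A' :: Ξ) (b.lren (swapAt Ξ'.length))
        (b'.lren (swapAt Ξ'.length)) B)
  -- intuitionistic substitution
  | int_ty_subst {Δ Δ' A a B} : Der 𝕊 (ty (Δ ++ A :: Δ') B) → Der 𝕊 (tm Δ [] a A) →
      Der 𝕊 (ty (subCtx Δ a Δ') (B.isub (subAt Δ.length a)))
  | int_ty_subst_eq {Δ Δ' A a B B'} : Der 𝕊 (tyEq (Δ ++ A :: Δ') B B') →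
      Der 𝕊 (tm Δ [] a A) →
      Der 𝕊 (tyEq (subCtx Δ a Δ') (B.isub (subAt Δ.length a)) (B'.isub (subAt Δ.length a)))
  | int_tm_subst {Δ Δ' Ξ A a b B} : Der 𝕊 (tm (Δ ++ A :: Δ') Ξ b B) → Der 𝕊 (tm Δ [] a A) →
      Der 𝕊 (tm (subCtx Δ a Δ') (Ξ.map (Ty.isub (subAt Δ.length a)))
        (b.isub (subAt Δ.length a)) (B.isub (subAt Δ.length a)))
  | int_tm_subst_eq {Δ Δ' Ξ A a b b' B} : Der 𝕊 (tmEq (Δ ++ A :: Δ') Ξ b b' B) →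
      Der 𝕊 (tm Δ [] a A) →
      Der 𝕊 (tmEq (subCtx Δ a Δ') (Ξ.map (Ty.isub (subAt Δ.length a)))
        (b.isub (subAt Δ.length a)) (b'.isub (subAt Δ.length a)) (B.isub (subAt Δ.length a)))
  -- linear substitution
  | lin_tm_subst {Δ Ξ Ξ' A a b B} : Der 𝕊 (tm Δ (A :: Ξ) b B) → Der 𝕊 (tm Δ Ξ' a A) →
      Der 𝕊 (tm Δ (Ξ' ++ Ξ) (b.lsub (linSub Ξ'.length a)) B)
  | lin_tm_subst_eq {Δ Ξ Ξ' A a b b' B} : Der 𝕊 (tmEq Δ (A :: Ξ) b b' B) →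
      Der 𝕊 (tm Δ Ξ' a A) →
      Der 𝕊 (tmEq Δ (Ξ' ++ Ξ) (b.lsub (linSub Ξ'.length a)) (b'.lsub (linSub Ξ'.length a)) B)
  -- base types and base terms
  | con_ty {Δ} (T : 𝕊.TyC) {us : Fin (𝕊.tyAr T) → Tm 𝕊.toSymbols} : Der 𝕊 (ctx Δ []) →
      Der 𝕊 (ctx (List.ofFn (𝕊.tyCtx T)) []) →
      (∀ i, Der 𝕊 (tm Δ [] (us i) ((𝕊.tyCtx T i).isub (inst us)))) →
      Der 𝕊 (ty Δ (.con T us))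
  | con_ty_eq {Δ} (T : 𝕊.TyC) {us us' : Fin (𝕊.tyAr T) → Tm 𝕊.toSymbols} :
      Der 𝕊 (ctx Δ []) → Der 𝕊 (ctx (List.ofFn (𝕊.tyCtx T)) []) →
      (∀ i, Der 𝕊 (tmEq Δ [] (us i) (us' i) ((𝕊.tyCtx T i).isub (inst us)))) →
      Der 𝕊 (tyEq Δ (.con T us) (.con T us'))
  | con_tm {Δ Ξ} (c : 𝕊.TmC) {us : Fin (𝕊.tmAr c) → Tm 𝕊.toSymbols} {b} :
      Der 𝕊 (ty (List.ofFn (𝕊.tmCtx c)) (𝕊.tmArg c)) →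
      Der 𝕊 (ty (List.ofFn (𝕊.tmCtx c)) (𝕊.tmRes c)) →
      (∀ i, Der 𝕊 (tm Δ [] (us i) ((𝕊.tmCtx c i).isub (inst us)))) →
      Der 𝕊 (tm Δ Ξ b ((𝕊.tmArg c).isub (inst us))) →
      Der 𝕊 (tm Δ Ξ (.con c us b) ((𝕊.tmRes c).isub (inst us)))
  | con_tm_eq {Δ Ξ} (c : 𝕊.TmC) {us us' : Fin (𝕊.tmAr c) → Tm 𝕊.toSymbols} {b b'} :
      Der 𝕊 (ty (List.ofFn (𝕊.tmCtx c)) (𝕊.tmArg c)) →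
      Der 𝕊 (ty (List.ofFn (𝕊.tmCtx c)) (𝕊.tmRes c)) →
      (∀ i, Der 𝕊 (tmEq Δ [] (us i) (us' i) ((𝕊.tmCtx c i).isub (inst us)))) →
      Der 𝕊 (tmEq Δ Ξ b b' ((𝕊.tmArg c).isub (inst us))) →
      Der 𝕊 (tmEq Δ Ξ (.con c us b) (.con c us' b') ((𝕊.tmRes c).isub (inst us)))
  -- the type `I`
  | I_F {Δ} : Der 𝕊 (ctx Δ []) → Der 𝕊 (ty Δ .unit)
  | I_I {Δ} : Der 𝕊 (ctx Δ []) → Der 𝕊 (tm Δ [] .star .unit)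
  | I_E {Δ Ξ Ξ' t a A} : Der 𝕊 (tm Δ Ξ' t .unit) → Der 𝕊 (tm Δ Ξ a A) →
      Der 𝕊 (tm Δ (Ξ' ++ Ξ) (.letU t (a.lshift Ξ'.length)) A)
  | I_E_eq {Δ Ξ Ξ' t t' a a' A} : Der 𝕊 (tmEq Δ Ξ' t t' .unit) → Der 𝕊 (tmEq Δ Ξ a a' A) →
      Der 𝕊 (tmEq Δ (Ξ' ++ Ξ) (.letU t (a.lshift Ξ'.length)) (.letU t' (a'.lshift Ξ'.length)) A)
  | I_C {Δ Ξ a A} : Der 𝕊 (tm Δ Ξ (.letU .star a) A) → Der 𝕊 (tmEq Δ Ξ (.letU .star a) a A)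
  | I_U {Δ Ξ t} : Der 𝕊 (tm Δ Ξ (.letU t .star) .unit) →
      Der 𝕊 (tmEq Δ Ξ (.letU t .star) t .unit)
  -- the types `A ⊗ B`
  | T_F {Δ A B} : Der 𝕊 (ty Δ A) → Der 𝕊 (ty Δ B) → Der 𝕊 (ty Δ (.tensor A B))
  | T_F_eq {Δ A A' B B'} : Der 𝕊 (tyEq Δ A A') → Der 𝕊 (tyEq Δ B B') →
      Der 𝕊 (tyEq Δ (.tensor A B) (.tensor A' B'))
  | T_I {Δ Ξ Ξ' a b A B} : Der 𝕊 (tm Δ Ξ a A) → Der 𝕊 (tm Δ Ξ' b B) →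
      Der 𝕊 (tm Δ (Ξ' ++ Ξ) (.tens (a.lshift Ξ'.length) b) (.tensor A B))
  | T_I_eq {Δ Ξ Ξ' a a' b b' A B} : Der 𝕊 (tmEq Δ Ξ a a' A) → Der 𝕊 (tmEq Δ Ξ' b b' B) →
      Der 𝕊 (tmEq Δ (Ξ' ++ Ξ) (.tens (a.lshift Ξ'.length) b) (.tens (a'.lshift Ξ'.length) b')
        (.tensor A B))
  | T_E {Δ Ξ Ξ' t c A B C} : Der 𝕊 (tm Δ Ξ t (.tensor A B)) →
      Der 𝕊 (tm Δ (B :: A :: Ξ') c C) →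
      Der 𝕊 (tm Δ (Ξ' ++ Ξ) (.letT (t.lshift Ξ'.length) c) C)
  | T_E_eq {Δ Ξ Ξ' t t' c c' A B C} : Der 𝕊 (tmEq Δ Ξ t t' (.tensor A B)) →
      Der 𝕊 (tmEq Δ (B :: A :: Ξ') c c' C) →
      Der 𝕊 (tmEq Δ (Ξ' ++ Ξ) (.letT (t.lshift Ξ'.length) c) (.letT (t'.lshift Ξ'.length) c') C)
  | T_C {Δ Ξ a b c C} : Der 𝕊 (tm Δ Ξ (.letT (.tens a b) c) C) →
      Der 𝕊 (tmEq Δ Ξ (.letT (.tens a b) c) (c.lsub (linSub₂ a b)) C)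
  | T_U {Δ Ξ t A B} :
      Der 𝕊 (tm Δ Ξ (.letT t (.tens (.lvar 1) (.lvar 0))) (.tensor A B)) →
      Der 𝕊 (tmEq Δ Ξ (.letT t (.tens (.lvar 1) (.lvar 0))) t (.tensor A B))
  -- commuting conversions; `C` does not bind free variables of `t`
  | comm_I {Δ Ξ D t c} (C : PCtx 𝕊.toSymbols) :
      Der 𝕊 (tm Δ Ξ (C.plug (.letU (t.lshift C.depth) c)) D) →
      Der 𝕊 (tmEq Δ Ξ (C.plug (.letU (t.lshift C.depth) c)) (.letU t (C.plug c)) D)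
  | comm_T {Δ Ξ D t c} (C : PCtx 𝕊.toSymbols) :
      Der 𝕊 (tm Δ Ξ (C.plug (.letT (t.lshift C.depth) c)) D) →
      Der 𝕊 (tmEq Δ Ξ (C.plug (.letT (t.lshift C.depth) c))
        (.letT t ((C.lren (fun j => j + 2)).plug (c.lren (moveOut C.depth)))) D)

/-! ## Models -/

/-- Symmetric monoidal categories. -/
structure SMCat where
  carrier : Type u
  [cat : Category.{v} carrier]
  [mon : MonoidalCategory carrier]
  [symm : SymmetricCategory carrier]

attribute [instance] SMCat.cat SMCat.mon SMCat.symm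

/-- Symmetric strong monoidal functors. -/
structure SMHom (A B : SMCat.{v, u}) where
  functor : A.carrier ⥤ B.carrier
  [braided : functor.Braided]

attribute [instance] SMHom.braided

open Functor.LaxMonoidal in
theorem SMHom.ext_of {A B : SMCat.{v, u}} {F G : A.carrier ⥤ B.carrier} (hF : F.Braided)
    (hG : G.Braided) (h : F = G)
    (hε : ε F ≫ eqToHom (by rw [h]) = ε G)
    (hμ : ∀ X Y, μ F X Y ≫ eqToHom (by rw [h]) = eqToHom (by rw [h]) ≫ μ G X Y) :
    (⟨F⟩ : SMHom A B) = ⟨G⟩ := by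
  subst h
  obtain ⟨b₁⟩ := hF
  obtain ⟨b₂⟩ := hG
  rename_i hM₁ hM₂
  have : hM₁ = hM₂ := by
    apply Functor.Monoidal.toLaxMonoidal_injective
    apply Functor.LaxMonoidal.ext
    · simpa using hε
    · ext X Y
      simpa using hμ X Y
  subst this
  rfl

open Functor.LaxMonoidal in
instance : Category SMCat.{v, u} where
  Hom := SMHom
  id A := ⟨𝟭 A.carrier⟩
  comp F G := ⟨F.functor ⋙ G.functor⟩
  id_comp F := SMHom.ext_of _ _ rfl (by simp) (by simp)
  comp_id F := SMHom.ext_of _ _ rfl (by simp) (by simp)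
  assoc F G H := SMHom.ext_of _ _ rfl (by simp) (by simp)


/-- The fibre `L(Δ)`. -/
abbrev Fib {𝒞 : Type u₁} [Category.{v₁} 𝒞] (L : 𝒞ᵒᵖ ⥤ SMCat.{v, u}) (Δ : 𝒞) : Type u :=
  (L.obj (op Δ)).carrier

/-- The functor `-{f}`, that is `L(f) : L(Δ) ⥤ L(Δ')` for `f : Δ' ⟶ Δ`. -/
abbrev reFun {𝒞 : Type u₁} [Category.{v₁} 𝒞] (L : 𝒞ᵒᵖ ⥤ SMCat.{v, u}) {Δ' Δ : 𝒞}
    (f : Δ' ⟶ Δ) : Fib L Δ ⥤ Fib L Δ' :=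
  (L.map f.op).functor

open Functor.LaxMonoidal in
/-- The image of `s : I ⟶ X` under a monoidal functor, as a morphism `I ⟶ F X`. -/
def SMHom.pull {A B : SMCat.{v, u}} (F : SMHom A B) {X : A.carrier}
    (s : 𝟙_ A.carrier ⟶ X) : 𝟙_ B.carrier ⟶ F.functor.obj X :=
  ε F.functor ≫ F.functor.map s

theorem SMHom.pull_congr {A B : SMCat.{v, u}} {F G : SMHom A B} (h : F = G) {X : A.carrier}
    (s : 𝟙_ A.carrier ⟶ X) : F.pull s ≫ eqToHom (by rw [h]) = G.pull s := by
  subst h; simp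

theorem SMHom.pull_id {A : SMCat.{v, u}} {X : A.carrier} (s : 𝟙_ A.carrier ⟶ X) :
    SMHom.pull (𝟙 A) s = s := by
  change 𝟙 _ ≫ s = s
  simp

theorem SMHom.pull_comp {A B C : SMCat.{v, u}} (F : A ⟶ B) (G : B ⟶ C) {X : A.carrier}
    (s : 𝟙_ A.carrier ⟶ X) : SMHom.pull (F ≫ G) s = SMHom.pull G (SMHom.pull F s) := by
  simp [SMHom.pull, CategoryStruct.comp]

theorem SMHom.pull_eqToHom {A B : SMCat.{v, u}} (F : A ⟶ B) {X Y : A.carrier} (h : X = Y)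
    (s : 𝟙_ A.carrier ⟶ X) :
    SMHom.pull F (s ≫ eqToHom h) = SMHom.pull F s ≫ eqToHom (by rw [h]) := by
  subst h; simp

section
variable {𝒞 : Type u₁} [Category.{v₁} 𝒞] (L : 𝒞ᵒᵖ ⥤ SMCat.{v, u})

theorem re_id_obj {Δ : 𝒞} (A : Fib L Δ) : (reFun L (𝟙 Δ)).obj A = A := by
  change (L.map (𝟙 (op Δ))).functor.obj A = A
  rw [L.map_id]; rfl

theorem re_comp_obj {Δ'' Δ' Δ : 𝒞} (g : Δ'' ⟶ Δ') (f : Δ' ⟶ Δ) (A : Fib L Δ) :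
    (reFun L (g ≫ f)).obj A = (reFun L g).obj ((reFun L f).obj A) := by
  change (L.map (f.op ≫ g.op)).functor.obj A = _
  rw [L.map_comp]; rfl

/-- The functor `x ↦ L(dom x)(I, A{x}) : (𝒞/Δ)ᵒᵖ ⥤ Type`. -/
def sections {Δ : 𝒞} (A : Fib L Δ) : (Over Δ)ᵒᵖ ⥤ Type v where
  obj x := 𝟙_ (Fib L x.unop.left) ⟶ (reFun L x.unop.hom).obj A
  map {x y} h := ↾fun s => (L.map h.unop.left.op).pull s ≫
    eqToHom (by rw [← re_comp_obj, Over.w])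
  map_id x := by
    ext s
    have h : L.map (Over.Hom.left (𝟙 x : x ⟶ x).unop).op = 𝟙 _ := L.map_id _
    have := SMHom.pull_congr h s
    rw [SMHom.pull_id] at this
    exact this
  map_comp {x y z} h k := by
    ext s
    have e : L.map (Over.Hom.left (h ≫ k).unop).op =
        L.map h.unop.left.op ≫ L.map k.unop.left.op := by
      rw [← L.map_comp]; rfl
    have := SMHom.pull_congr e s
    rw [SMHom.pull_comp] at this
    change SMHom.pull _ s ≫ eqToHom _ = SMHom.pull _ (SMHom.pull _ s ≫ eqToHom _) ≫ eqToHom _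
    erw [SMHom.pull_eqToHom]
    rw [← this]
    simp
end

/-- Strict indexed symmetric monoidal categories with comprehension. -/
structure Model where
  /-- the base category -/
  𝒞 : Type u₁
  [cat : Category.{v₁} 𝒞]
  /-- the terminal object `·` of the base category -/
  top : 𝒞
  isTerminal : Limits.IsTerminal top
  /-- the indexed symmetric monoidal category -/
  L : 𝒞ᵒᵖ ⥤ SMCat.{v, u}
  /-- the object `p : Δ.A ⟶ Δ` of the slice category over `Δ` -/
  compr : {Δ : 𝒞} → Fib L Δ → Over Δ
  /-- the comprehension schema -/
  rep : {Δ : 𝒞} → (A : Fib L Δ) → (sections L A).RepresentableBy (compr A)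

attribute [instance] Model.cat

namespace Model
variable (M : Model.{v₁, u₁, v, u})

/-- The fibre over `Δ`. -/
abbrev fib (Δ : M.𝒞) : Type u := Fib M.L Δ

variable {M}

/-- The functor `-{f}`. -/
abbrev re {Δ' Δ : M.𝒞} (f : Δ' ⟶ Δ) : M.fib Δ ⥤ M.fib Δ' := reFun M.L f

/-- The object `Δ.A`. -/
def ext (Δ : M.𝒞) (A : M.fib Δ) : M.𝒞 := (M.compr A).left

/-- The projection `p : Δ.A ⟶ Δ`. -/
def p (Δ : M.𝒞) (A : M.fib Δ) : ext Δ A ⟶ Δ := (M.compr A).hom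

/-- The universal element `v ∈ L(Δ.A)(I, A{p})`. -/
def gen (Δ : M.𝒞) (A : M.fib Δ) : 𝟙_ (M.fib (ext Δ A)) ⟶ (re (p Δ A)).obj A :=
  (M.rep A).homEquiv (𝟙 _)

/-- The morphism `⟨f, a⟩ : Δ' ⟶ Δ.A` for `f : Δ' ⟶ Δ` and `a ∈ L(Δ')(I, A{f})`. -/
def pair {Δ' Δ : M.𝒞} (f : Δ' ⟶ Δ) {A : M.fib Δ}
    (a : 𝟙_ (M.fib Δ') ⟶ (re f).obj A) : Δ' ⟶ ext Δ A :=
  ((M.rep A).homEquiv.symm (show (sections M.L A).obj (op (Over.mk f)) from a)).left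

/-- `a{f} ∈ L(Δ')(I, A{f})` for `a ∈ L(Δ)(I, A)`. -/
def reSec {Δ' Δ : M.𝒞} (f : Δ' ⟶ Δ) {A : M.fib Δ} (a : 𝟙_ (M.fib Δ) ⟶ A) :
    𝟙_ (M.fib Δ') ⟶ (re f).obj A :=
  SMHom.pull (M.L.map f.op) a

end Model

/-! ## The interpretation

As the functors `L(f)` preserve `I` and `⊗` up to coherent isomorphism only, the interpretation of
`A[a/x]` is the reindexing of that of `A` up to a canonical isomorphism. In order to have this
isomorphism at hand, the interpretation of a type records how its object is built from objects of
the fibre by `I` and `⊗`. -/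

open Model

variable {M : Model.{v₁, u₁, v, u}}

/-- Semantic types over `D`: formal expressions in objects of `L(D)`, `I` and `⊗`. -/
inductive STy (D : M.𝒞) : Type u
  | base (X : M.fib D)
  | unit
  | tensor (S T : STy D)

namespace STy

/-- The object of the fibre that a semantic type stands for. -/
def el {D : M.𝒞} : STy D → M.fib D
  | base X => X
  | unit => 𝟙_ _
  | tensor S T => S.el ⊗ T.el

/-- Reindexing of semantic types. -/
def re {D' D : M.𝒞} (f : D' ⟶ D) : STy D → STy D'
  | base X => base ((Model.re f).obj X)
  | unit => unit
  | tensor S T => tensor (S.re f) (T.re f)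

open Functor.Monoidal in
/-- The canonical isomorphism between the object of `S{f}` and the reindexed object of `S`. -/
def reIso {D' D : M.𝒞} (f : D' ⟶ D) : (S : STy D) → ((S.re f).el ≅ (Model.re f).obj S.el)
  | base _ => Iso.refl _
  | unit => εIso (Model.re f)
  | tensor S T => (S.reIso f ⊗ᵢ T.reIso f) ≪≫ μIso (Model.re f) S.el T.el

end STy

/-- The object `⟦Ξ⟧` for a linear context `Ξ` (most recent declaration first):
`⟦·⟧ = I` and `⟦Ξ, x : A⟧ = ⟦Ξ⟧ ⊗ ⟦A⟧`. -/
def linObj {D : M.𝒞} : List (STy D) → M.fib D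
  | [] => 𝟙_ _
  | S :: X => linObj X ⊗ S.el

/-- The canonical isomorphism `⟦Ξ, Ξ'⟧ ≅ ⟦Ξ⟧ ⊗ ⟦Ξ'⟧`. -/
def split {D : M.𝒞} (X : List (STy D)) :
    (X' : List (STy D)) → (linObj (X' ++ X) ≅ linObj X ⊗ linObj X')
  | [] => (ρ_ _).symm
  | S :: X' => whiskerRightIso (split X X') S.el ≪≫ α_ _ _ _

/-- The morphism `⟦Ξ, x' : A', x : A, Ξ'⟧ ⟶ ⟦Ξ, x : A, x' : A', Ξ'⟧` given by the symmetry. -/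
def exMor {D : M.𝒞} (X : List (STy D)) (S S' : STy D) : (X' : List (STy D)) →
    (linObj (X' ++ S :: S' :: X) ⟶ linObj (X' ++ S' :: S :: X))
  | [] => (α_ _ _ _).hom ≫ linObj X ◁ (β_ S'.el S.el).hom ≫ (α_ _ _ _).inv
  | T :: X' => exMor X S S' X' ▷ T.el

/-- The canonical isomorphism between `⟦Ξ{f}⟧` and the reindexed object of `Ξ`. -/
def linReIso {D' D : M.𝒞} (f : D' ⟶ D) :
    (X : List (STy D)) → (linObj (X.map (STy.re f)) ≅ (re f).obj (linObj X))
  | [] => Functor.Monoidal.εIso (re f)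
  | S :: X => (linReIso f X ⊗ᵢ S.reIso f) ≪≫ Functor.Monoidal.μIso (re f) (linObj X) S.el

/-- The action of `L(f)` on (interpretations of) terms. -/
def reTm {D' D : M.𝒞} (f : D' ⟶ D) {X : List (STy D)} {S : STy D} (g : linObj X ⟶ S.el) :
    linObj (X.map (STy.re f)) ⟶ (S.re f).el :=
  (linReIso f X).hom ≫ (re f).map g ≫ (S.reIso f).inv

/-- A section over `D`: a semantic type `S` with a morphism from `I` to its object. -/
def Sec (D : M.𝒞) : Type max u v := Σ S : STy D, (𝟙_ (M.fib D) ⟶ S.el)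

/-- Reindexing of sections. -/
def Sec.re {D' D : M.𝒞} (f : D' ⟶ D) (s : Sec D) : Sec D' :=
  ⟨s.1.re f, reSec f s.2 ≫ (s.1.reIso f).inv⟩

/-- A semantic intuitionistic context: an object of the base category together with, for each
variable (from left to right), the section over this object that interprets the variable. -/
structure SCtx (M : Model.{v₁, u₁, v, u}) where
  D : M.𝒞
  vars : List (Sec D)

/-- The empty context. -/
def SCtx.empty (M : Model.{v₁, u₁, v, u}) : SCtx M := ⟨M.top, []⟩

/-- Context extension: the object of `Δ, x : A` is `Δ.A`, the old variables are reindexed along `p`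
and the new variable is interpreted by the universal element `v`. -/
def SCtx.ext (Z : SCtx M) (S : STy Z.D) : SCtx M where
  D := Model.ext Z.D S.el
  vars := Z.vars.map (Sec.re (p Z.D S.el)) ++
    [⟨S.re (p Z.D S.el), gen Z.D S.el ≫ (S.reIso (p Z.D S.el)).inv⟩]

/-- Denotations for the symbols of a signature: for each base type, a context and an object of the
fibre over it; for each base term, a context, two types and a morphism in the fibre over it. -/
structure Denot (𝔽 : Symbols.{w}) (M : Model.{v₁, u₁, v, u}) where
  tyCtx : 𝔽.TyC → SCtx M
  tyObj : (T : 𝔽.TyC) → M.fib (tyCtx T).D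
  tmCtx : 𝔽.TmC → SCtx M
  tmArg : (c : 𝔽.TmC) → STy (tmCtx c).D
  tmRes : (c : 𝔽.TmC) → STy (tmCtx c).D
  tmMor : (c : 𝔽.TmC) → ((tmArg c).el ⟶ (tmRes c).el)

/-- `ITm 𝔡 ρ X a S f`: over `D`, with the intuitionistic variables interpreted by the sections `ρ`,
the term `a` in a linear context with interpretation `X` denotes `f : ⟦Ξ⟧ ⟶ ⟦A⟧`, where `S`
interprets `A`. -/
inductive ITm (𝔡 : Denot 𝔽 M) {D : M.𝒞} (ρ : List (Sec D)) :
    (X : List (STy D)) → Tm 𝔽 → (S : STy D) → (linObj X ⟶ S.el) → Prop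
  | ivar {i : ℕ} {s : Sec D} : ρ[i]? = some s → ITm 𝔡 ρ [] (.ivar i) s.1 s.2
  | lvar {S : STy D} : ITm 𝔡 ρ [S] (.lvar 0) S (λ_ S.el).hom
  /-- `h` is the context morphism `⟨us⟩` from `D` to the context of `c`: the morphism along which
  the variables of that context are reindexed to the arguments -/
  | con (c : 𝔽.TmC) {us : Fin (𝔽.tmAr c) → Tm 𝔽} {s : Fin (𝔽.tmAr c) → Sec D}
      {X : List (STy D)} {b : Tm 𝔽} {h : D ⟶ (𝔡.tmCtx c).D}
      {g : linObj X ⟶ ((𝔡.tmArg c).re h).el} :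
      (∀ i, ITm 𝔡 ρ [] (us i) (s i).1 (s i).2) →
      (𝔡.tmCtx c).vars.map (Sec.re h) = List.ofFn s →
      ITm 𝔡 ρ X b ((𝔡.tmArg c).re h) g →
      ITm 𝔡 ρ X (.con c us b) ((𝔡.tmRes c).re h)
        (g ≫ ((𝔡.tmArg c).reIso h).hom ≫ (re h).map (𝔡.tmMor c) ≫ ((𝔡.tmRes c).reIso h).inv)
  | star : ITm 𝔡 ρ [] .star .unit (𝟙 _)
  | letU {X X' : List (STy D)} {t a : Tm 𝔽} {S : STy D} {f : linObj X' ⟶ 𝟙_ _}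
      {g : linObj X ⟶ S.el} : ITm 𝔡 ρ X' t .unit f → ITm 𝔡 ρ X a S g →
      ITm 𝔡 ρ (X' ++ X) (.letU t (a.lshift X'.length)) S
        ((split X X').hom ≫ (g ⊗ₘ f) ≫ (ρ_ S.el).hom)
  | tens {X X' : List (STy D)} {a b : Tm 𝔽} {S T : STy D} {f : linObj X ⟶ S.el}
      {g : linObj X' ⟶ T.el} : ITm 𝔡 ρ X a S f → ITm 𝔡 ρ X' b T g →
      ITm 𝔡 ρ (X' ++ X) (.tens (a.lshift X'.length) b) (.tensor S T)
        ((split X X').hom ≫ (f ⊗ₘ g))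
  | letT {X X' : List (STy D)} {t c : Tm 𝔽} {S T R : STy D} {f : linObj X ⟶ S.el ⊗ T.el}
      {g : linObj (T :: S :: X') ⟶ R.el} : ITm 𝔡 ρ X t (.tensor S T) f →
      ITm 𝔡 ρ (T :: S :: X') c R g →
      ITm 𝔡 ρ (X' ++ X) (.letT (t.lshift X'.length) c) R
        ((split X X').hom ≫ (β_ (linObj X) (linObj X')).hom ≫ linObj X' ◁ f ≫
          (α_ (linObj X') S.el T.el).inv ≫ g)
  | exch {X X' : List (STy D)} {S S' R : STy D} {a : Tm 𝔽}
      {f : linObj (X' ++ S' :: S :: X) ⟶ R.el} : ITm 𝔡 ρ (X' ++ S' :: S :: X) a R f →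
      ITm 𝔡 ρ (X' ++ S :: S' :: X) (a.lren (swapAt X'.length)) R (exMor X S S' X' ≫ f)

/-- `ITy 𝔡 ρ A S`: over `D`, with the variables interpreted by `ρ`, the type `A` denotes `S`. -/
inductive ITy (𝔡 : Denot 𝔽 M) {D : M.𝒞} (ρ : List (Sec D)) : Ty 𝔽 → STy D → Prop
  | con (T : 𝔽.TyC) {us : Fin (𝔽.tyAr T) → Tm 𝔽} {s : Fin (𝔽.tyAr T) → Sec D}
      {h : D ⟶ (𝔡.tyCtx T).D} :
      (∀ i, ITm 𝔡 ρ [] (us i) (s i).1 (s i).2) →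
      (𝔡.tyCtx T).vars.map (Sec.re h) = List.ofFn s →
      ITy 𝔡 ρ (.con T us) (.base ((re h).obj (𝔡.tyObj T)))
  | unit : ITy 𝔡 ρ .unit .unit
  | tensor {A B : Ty 𝔽} {S T : STy D} : ITy 𝔡 ρ A S → ITy 𝔡 ρ B T →
      ITy 𝔡 ρ (.tensor A B) (.tensor S T)

/-- `ICtx 𝔡 Δ Z`: the intuitionistic context `Δ` denotes `Z`. -/
inductive ICtx (𝔡 : Denot 𝔽 M) : List (Ty 𝔽) → SCtx M → Prop
  | empty : ICtx 𝔡 [] (SCtx.empty M)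
  | ext {Δ : List (Ty 𝔽)} {A : Ty 𝔽} {Z : SCtx M} {S : STy Z.D} : ICtx 𝔡 Δ Z →
      ITy 𝔡 Z.vars A S → ICtx 𝔡 (Δ ++ [A]) (Z.ext S)

/-- `ILin 𝔡 ρ Ξ X`: the types of the linear context `Ξ` denote `X`. -/
def ILin (𝔡 : Denot 𝔽 M) {D : M.𝒞} (ρ : List (Sec D)) (Ξ : List (Ty 𝔽)) (X : List (STy D)) :
    Prop :=
  List.Forall₂ (ITy 𝔡 ρ) Ξ X

/-- The denotations of the symbols have the types that the signature declares. -/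
structure Denot.IsStructure (𝕊 : Signature.{w}) (𝔡 : Denot 𝕊.toSymbols M) : Prop where
  tyCtx (T : 𝕊.TyC) : ICtx 𝔡 (List.ofFn (𝕊.tyCtx T)) (𝔡.tyCtx T)
  tmCtx (c : 𝕊.TmC) : ICtx 𝔡 (List.ofFn (𝕊.tmCtx c)) (𝔡.tmCtx c)
  tmArg (c : 𝕊.TmC) : ITy 𝔡 (𝔡.tmCtx c).vars (𝕊.tmArg c) (𝔡.tmArg c)
  tmRes (c : 𝕊.TmC) : ITy 𝔡 (𝔡.tmCtx c).vars (𝕊.tmRes c) (𝔡.tmRes c)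

/-! ## Validity of judgements -/

section
variable (𝔡 : Denot 𝔽 M)

/-- `Δ; Ξ` has a well-defined interpretation. -/
def CtxDef (Δ Ξ : List (Ty 𝔽)) : Prop :=
  (∃! Z, ICtx 𝔡 Δ Z) ∧ ∀ Z, ICtx 𝔡 Δ Z → ∃! X, ILin 𝔡 Z.vars Ξ X

/-- `A` has a well-defined interpretation in context `Δ`. -/
def TyDef (Δ : List (Ty 𝔽)) (A : Ty 𝔽) : Prop :=
  (∃! Z, ICtx 𝔡 Δ Z) ∧ ∀ Z, ICtx 𝔡 Δ Z → ∃! S, ITy 𝔡 Z.vars A S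

/-- `a` has a well-defined interpretation `⟦Ξ⟧ ⟶ ⟦A⟧` in context `Δ; Ξ`. -/
def TmDef (Δ Ξ : List (Ty 𝔽)) (a : Tm 𝔽) (A : Ty 𝔽) : Prop :=
  CtxDef 𝔡 Δ Ξ ∧ TyDef 𝔡 Δ A ∧ ∀ Z X S, ICtx 𝔡 Δ Z → ILin 𝔡 Z.vars Ξ X → ITy 𝔡 Z.vars A S →
    ∃! f, ITm 𝔡 Z.vars X a S f

/-- A judgement is valid if its parts have well-defined interpretations, which are equal in the case
of an equality judgement. -/
def Valid : Judgement 𝔽 → Prop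
  | .ctx Δ Ξ => CtxDef 𝔡 Δ Ξ
  | .ty Δ A => TyDef 𝔡 Δ A
  | .tm Δ Ξ a A => TmDef 𝔡 Δ Ξ a A
  | .ctxEq Δ Ξ Δ' Ξ' => CtxDef 𝔡 Δ Ξ ∧ CtxDef 𝔡 Δ' Ξ' ∧
      ∀ Z X, ICtx 𝔡 Δ Z → ILin 𝔡 Z.vars Ξ X → ICtx 𝔡 Δ' Z ∧ ILin 𝔡 Z.vars Ξ' X
  | .tyEq Δ A A' => TyDef 𝔡 Δ A ∧ TyDef 𝔡 Δ A' ∧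
      ∀ Z S, ICtx 𝔡 Δ Z → ITy 𝔡 Z.vars A S → ITy 𝔡 Z.vars A' S
  | .tmEq Δ Ξ a a' A => TmDef 𝔡 Δ Ξ a A ∧ TmDef 𝔡 Δ Ξ a' A ∧
      ∀ Z X S f, ICtx 𝔡 Δ Z → ILin 𝔡 Z.vars Ξ X → ITy 𝔡 Z.vars A S →
        ITm 𝔡 Z.vars X a S f → ITm 𝔡 Z.vars X a' S f

/-- The morphism `q = ⟨f ∘ p, v⟩ : D'.A{f} ⟶ D.A` for `f : D' ⟶ D`. -/
def qMor {D' D : M.𝒞} (f : D' ⟶ D) (S : STy D) : Model.ext D' (S.re f).el ⟶ Model.ext D S.el :=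
  pair (p D' (S.re f).el ≫ f)
    (gen D' (S.re f).el ≫ (re (p D' (S.re f).el)).map (S.reIso f).hom ≫
      eqToHom (re_comp_obj M.L _ _ _).symm)

/-- The morphism `⟨id, a⟩ : D ⟶ D.A` for `a ∈ L(D)(I, A)`. -/
def secMor {D : M.𝒞} (S : STy D) (a : 𝟙_ (M.fib D) ⟶ S.el) : D ⟶ Model.ext D S.el :=
  pair (𝟙 D) (a ≫ eqToHom (re_id_obj M.L _).symm)

/-- `QExt f n W Z g`: the morphism `g : W ⟶ Z` arises from `f : W₀ ⟶ Z₀` by extension with `n`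
types on the right, `Z₀, Δ'` and `W₀, Δ'{f}` being the extended contexts. -/
inductive QExt {W₀ Z₀ : SCtx M} (f : W₀.D ⟶ Z₀.D) :
    ℕ → (W Z : SCtx M) → (W.D ⟶ Z.D) → Prop
  | zero : QExt f 0 W₀ Z₀ f
  | succ {n : ℕ} {W Z : SCtx M} {g : W.D ⟶ Z.D} (S : STy Z.D) : QExt f n W Z g →
      QExt f (n + 1) (W.ext (S.re g)) (Z.ext S) (qMor g S)

end

end ILDTT

/-! The main obstacle is that `ITm` is only a relation: exchange may be applied anywhere in a
derivation, so a term might denote several morphisms. They agree by coherence for symmetric monoidal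
categories: a canonical morphism between tensor products of entries with distinct labels is
determined by its source and target (`Coh.unique`). Flattening all brackets turns associators and
unitors into identities and leaves composites of adjacent transpositions. Two such composites are
compared by pulling the same entry through both (`Reord.pull`, `Reord.unique`), which needs only
that the symmetry is involutive, natural and satisfies the Yang–Baxter equation.

Terms are then interpreted a second time by `Den`, which is syntax-directed because every node
carries a canonical morphism that absorbs exchange and rebracketing; the two interpretations are
equivalent (`itm_iff_den`). By linearity the variables of a subterm are known from the term
(`Den.mem_iff`), so two splittings of a context for the same term differ by a tensor product of
canonical morphisms (`Coh.exists_tensor`), and `Den.unique` follows by induction. For base symbols,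
comprehension is used as well: a morphism into the object of a context is determined by the sections
to which it reindexes the variables (`ICtx.hom_ext`), and well-typed arguments define such a
morphism (`Denot.IsStructure.exists_hom`).

For intuitionistic substitution, the strict functoriality of `L` makes reindexing of semantic types
and sections strictly functorial (`STy.re_comp`, `Sec.re_comp`), and symmetric monoidal functors
preserve canonical morphisms (`Coh.re`). Hence a morphism `w` that reindexes every variable to the
interpretation of the term substituted for it interprets the whole substitution (`Den.isub`).
Projections, the morphisms `⟨id, a⟩` and exchanges are of this kind, and remain so when extended
along further types (`CtxMor.extend`). Linear substitution is composition, because a substitution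
can be pushed through canonical morphisms and split along the blocks of a context (`SubM.comp`,
`Den.lsub`).

Finally, induction on derivations produces a common interpretation of the two sides of each equality
(`Denot.IsStructure.interprets`); uniqueness turns existence into validity. The `β`-rule for `⊗` is
an instance of linear substitution. The other computation and uniqueness rules and the commuting
conversions rearrange canonical morphisms; the essential case is a `let` moved out of a binder
(`Coh.exists_bind`). -/

namespace ILDTT

/-! ## Permutations of linear contexts -/

section SymmetricMonoidal
variable {C : Type u} [Category.{v} C] [MonoidalCategory C] [SymmetricCategory C]

/-- The symmetry that exchanges the last two factors. -/
def swapLast (A B B' : C) : (A ⊗ B) ⊗ B' ⟶ (A ⊗ B') ⊗ B :=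
  (α_ _ _ _).hom ≫ A ◁ (β_ B B').hom ≫ (α_ _ _ _).inv

theorem swapLast_swapLast (A B B' : C) : swapLast A B B' ≫ swapLast A B' B = 𝟙 _ := by
  simp [swapLast, ← MonoidalCategory.whiskerLeft_comp_assoc]

theorem swapLast_natural {A A' : C} (m : A ⟶ A') (B B' : C) :
    m ▷ B ▷ B' ≫ swapLast A' B B' = swapLast A B B' ≫ m ▷ B' ▷ B := by
  simp only [swapLast, Category.assoc]
  rw [← associator_inv_naturality_left, whisker_exchange_assoc, associator_naturality_left_assoc]

/-- The Yang–Baxter equation for the three last factors, whiskered by `A`, with the associators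
absorbed. -/
theorem swapLast_swapLast_swapLast (A B₁ B₂ B₃ : C) :
    swapLast A B₁ B₂ ▷ B₃ ≫ swapLast (A ⊗ B₂) B₁ B₃ ≫ swapLast A B₂ B₃ ▷ B₁ =
      swapLast (A ⊗ B₁) B₂ B₃ ≫ swapLast A B₁ B₃ ▷ B₂ ≫ swapLast (A ⊗ B₃) B₁ B₂ := by
  have h := BraidedCategory.yang_baxter B₁ B₂ B₃
  simp only [swapLast]
  calc _ = 𝟙 _ ⊗≫ A ◁ ((α_ B₁ B₂ B₃).inv ≫ (β_ B₁ B₂).hom ▷ B₃ ≫ (α_ B₂ B₁ B₃).hom ≫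
      B₂ ◁ (β_ B₁ B₃).hom ≫ (α_ B₂ B₃ B₁).inv ≫ (β_ B₂ B₃).hom ▷ B₁ ≫
        (α_ B₃ B₂ B₁).hom) ⊗≫ 𝟙 _ := by monoidal
    _ = _ := by rw [h]; monoidal

theorem comp_whiskerRight_swapLast_of_eq {A A' A₀ A₁ B B' : C} {e : A ⟶ A'} {m : A' ⟶ A₀ ⊗ B}
    {m' : A ⟶ A₁ ⊗ B} {q : A₁ ⟶ A₀} (h : e ≫ m = m' ≫ q ▷ B) :
    e ▷ B' ≫ m ▷ B' ≫ swapLast A₀ B B' = (m' ▷ B' ≫ swapLast A₁ B B') ≫ q ▷ B' ▷ B := by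
  rw [← comp_whiskerRight_assoc, h, comp_whiskerRight_assoc, Category.assoc, swapLast_natural]

/-- Used when an entry below both exchanged entries is pulled to the end: the transposition survives
among the remaining entries. This is Yang–Baxter after naturality in `m`. -/
theorem swapLast_comp_swapLast_whisker {A A₀ B B₁ B₂ : C} (m : A ⟶ A₀ ⊗ B) :
    swapLast A B₂ B₁ ≫ (m ▷ B₁ ≫ swapLast A₀ B B₁) ▷ B₂ ≫ swapLast (A₀ ⊗ B₁) B B₂ =
      ((m ▷ B₂ ≫ swapLast A₀ B B₂) ▷ B₁ ≫ swapLast (A₀ ⊗ B₂) B B₁) ≫ swapLast A₀ B₂ B₁ ▷ B := by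
  simp only [comp_whiskerRight, Category.assoc]
  rw [← reassoc_of% @swapLast_natural, ← swapLast_swapLast_swapLast]

end SymmetricMonoidal

open Model
variable {M : Model.{v₁, u₁, v, u}} {D : M.𝒞}

/-- `Pull i S l X l₀ X₀ m`: the entry of `X` with label `i` is `S`, removing it leaves `X₀`, and `m`
is the morphism that moves it to the end. -/
inductive Pull (i : ℕ) (S : STy D) :
    (l : List ℕ) → (X : List (STy D)) → (l₀ : List ℕ) → (X₀ : List (STy D)) →
      (linObj X ⟶ linObj X₀ ⊗ S.el) → Prop
  | here (l X) : Pull i S (i :: l) (S :: X) l X (𝟙 _)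
  | there {l X l₀ X₀ m} (j : ℕ) (T : STy D) : Pull i S l X l₀ X₀ m →
      Pull i S (j :: l) (T :: X) (j :: l₀) (T :: X₀) (m ▷ T.el ≫ swapLast (linObj X₀) S.el T.el)

theorem Pull.mem {i : ℕ} {S : STy D} {l X l₀ X₀ m} (h : Pull i S l X l₀ X₀ m) : i ∈ l := by
  induction h with
  | here => simp
  | there _ _ _ ih => simp [ih]

/-- Distinct labels leave only one position from which the entry can be taken. -/
theorem Pull.unique {i : ℕ} {S : STy D} {l X l₀ X₀ m l₁ X₁ m'} (h : Pull i S l X l₀ X₀ m)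
    (h' : Pull i S l X l₁ X₁ m') (hl : l.Nodup) :
    (⟨l₀, X₀, m⟩ : Σ' (_ : List ℕ) (Y : List (STy D)), (linObj X ⟶ linObj Y ⊗ S.el)) =
      ⟨l₁, X₁, m'⟩ := by
  induction h generalizing l₁ X₁ with
  | here l X =>
    cases h' with
    | here => rfl
    | there _ _ h' => exact absurd h'.mem (List.nodup_cons.1 hl).1
  | there j T h ih =>
    cases h' with
    | here => exact absurd h.mem (List.nodup_cons.1 hl).1
    | there _ _ h' =>
      cases ih h' (List.nodup_cons.1 hl).2
      rfl

/-- The morphisms between linear contexts composed of symmetries; the entries carry labels. -/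
inductive Reord : (l : List ℕ) → (X : List (STy D)) → (l' : List ℕ) → (X' : List (STy D)) →
    (linObj X ⟶ linObj X') → Prop
  | refl {l X} : l.length = X.length → Reord l X l X (𝟙 _)
  | step {i j l X S S' l'' X''} (l' : List ℕ) (X' : List (STy D))
      {q : linObj (X' ++ S' :: S :: X) ⟶ linObj X''} : l'.length = X'.length →
      Reord (l' ++ j :: i :: l) (X' ++ S' :: S :: X) l'' X'' q →
      Reord (l' ++ i :: j :: l) (X' ++ S :: S' :: X) l'' X'' (exMor X S S' X' ≫ q)

namespace Reord
variable {l l' l'' : List ℕ} {X X' X'' : List (STy D)}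

theorem trans {p : linObj X ⟶ linObj X'} {q : linObj X' ⟶ linObj X''} (h : Reord l X l' X' p)
    (h' : Reord l' X' l'' X'' q) : Reord l X l'' X'' (p ≫ q) := by
  induction h with
  | refl => simpa using h'
  | step l₁ X₁ e _ ih => simpa using .step l₁ X₁ e (ih h')

theorem cons (i : ℕ) (S : STy D) {p : linObj X ⟶ linObj X'} (h : Reord l X l' X' p) :
    Reord (i :: l) (S :: X) (i :: l') (S :: X') (p ▷ S.el) := by
  induction h with
  | refl e => rw [id_whiskerRight]; exact .refl (by simpa using e)
  | step l₁ X₁ e _ ih => rw [comp_whiskerRight]; exact .step (i :: l₁) (S :: X₁) (by simpa using e) ih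

theorem swap (i j : ℕ) (S S' : STy D) (h : l.length = X.length) :
    Reord (i :: j :: l) (S :: S' :: X) (j :: i :: l) (S' :: S :: X)
      (swapLast (linObj X) S'.el S.el) := by
  rw [← Category.comp_id (swapLast _ _ _)]
  exact .step [] [] rfl (.refl (by simpa using h))

theorem length {p : linObj X ⟶ linObj X'} (h : Reord l X l' X' p) :
    l.length = X.length ∧ l'.length = X'.length := by
  induction h with
  | refl e => exact ⟨e, e⟩
  | step l₁ X₁ e _ ih => simp only [List.length_append, List.length_cons] at ih ⊢; omega

theorem perm {p : linObj X ⟶ linObj X'} (h : Reord l X l' X' p) : l.Perm l' := by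
  induction h with
  | refl e => rfl
  | step l₁ X₁ e _ ih => exact (List.Perm.append_left _ (List.Perm.swap _ _ _)).trans ih

/-- Pulling out an entry commutes with an adjacent transposition. If the entry is one of the two
exchanged, the transposition is absorbed into `m'` and `q` is the identity; otherwise `q` is the
same transposition of the remaining entries. The cases use the definition of `Pull`, involutivity,
Yang–Baxter and naturality. -/
theorem pull_step {i j k : ℕ} {S S' T : STy D} (l₁ : List ℕ) (X₁ : List (STy D))
    (e : l₁.length = X₁.length) (hl : l.length = X.length) {l₀ X₀ m}
    (h : Pull k T (l₁ ++ j :: i :: l) (X₁ ++ S' :: S :: X) l₀ X₀ m) :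
    ∃ l₀' X₀' m' q, Pull k T (l₁ ++ i :: j :: l) (X₁ ++ S :: S' :: X) l₀' X₀' m' ∧
      Reord l₀' X₀' l₀ X₀ q ∧ exMor X S S' X₁ ≫ m = m' ≫ q ▷ T.el := by
  have len : ∀ {l X l₀ X₀ m}, Pull k T l X l₀ X₀ m → l.length = X.length →
      l₀.length = X₀.length := by
    intro l X l₀ X₀ m h
    induction h with
    | here => simp
    | there _ _ _ ih => simpa using ih
  induction X₁ generalizing l₁ l₀ X₀ with
  | nil =>
    obtain rfl : l₁ = [] := by simpa using e
    change Pull k T (j :: i :: l) (S' :: S :: X) l₀ X₀ m at h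
    change ∃ l₀' X₀' m' q, Pull k T (i :: j :: l) (S :: S' :: X) l₀' X₀' m' ∧
      Reord l₀' X₀' l₀ X₀ q ∧ swapLast (linObj X) S'.el S.el ≫ m = m' ≫ q ▷ T.el
    cases h with
    | here =>
      refine ⟨_, _, _, _, .there _ _ (.here _ _), .refl (by simpa using hl), ?_⟩
      -- The identity is stated for arbitrary objects because the objects at hand are tensor
      -- products only after `linObj` is unfolded. The same device recurs below.
      have key {C : Type u} [Category.{v} C] [MonoidalCategory C] [SymmetricCategory C]
        (A B B' : C) : swapLast A B B' ≫ 𝟙 _ = (𝟙 _ ▷ B' ≫ swapLast A B B') ≫ 𝟙 _ ▷ B := by simp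
      exact key _ _ _
    | there _ _ h =>
      cases h with
      | here =>
        refine ⟨_, _, _, _, .here _ _, .refl (by simpa using hl), ?_⟩
        have key {C : Type u} [Category.{v} C] [MonoidalCategory C] [SymmetricCategory C]
          (A B B' : C) : swapLast A B B' ≫ 𝟙 _ ▷ B ≫ swapLast A B' B = 𝟙 _ ≫ 𝟙 _ ▷ B' := by
          simp [swapLast_swapLast]
        exact key _ _ _
      | there _ _ h =>
        refine ⟨_, _, _, _, .there _ _ (.there _ _ h), .swap _ _ _ _ (len h hl), ?_⟩
        exact swapLast_comp_swapLast_whisker _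
  | cons U X₁ ih =>
    obtain _ | ⟨a, l₁⟩ := l₁
    · simp at e
    replace e : l₁.length = X₁.length := by simpa using e
    change Pull k T (a :: (l₁ ++ j :: i :: l)) (U :: (X₁ ++ S' :: S :: X)) l₀ X₀ m at h
    change ∃ l₀' X₀' m' q, Pull k T (a :: (l₁ ++ i :: j :: l)) (U :: (X₁ ++ S :: S' :: X)) l₀' X₀' m' ∧
      Reord l₀' X₀' l₀ X₀ q ∧ exMor X S S' X₁ ▷ U.el ≫ m = m' ≫ q ▷ T.el
    cases h with
    | here =>
      refine ⟨_, _, _, _, .here _ _, ?_, (Category.comp_id _).trans (Category.id_comp _).symm⟩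
      rw [← Category.comp_id (exMor X S S' X₁)]
      exact .step _ _ e (.refl (by simp [e, hl]))
    | there _ _ h =>
      obtain ⟨l₀', X₀', m', q, h', hq, eq⟩ := ih l₁ e h
      refine ⟨_, _, _, _, .there _ _ h', .cons _ _ hq, ?_⟩
      exact comp_whiskerRight_swapLast_of_eq eq

theorem pull {k : ℕ} {T : STy D} {p : linObj X ⟶ linObj X'} (h : Reord l X l' X' p) {l₀ X₀ m}
    (hm : Pull k T l' X' l₀ X₀ m) :
    ∃ l₀' X₀' m' q, Pull k T l X l₀' X₀' m' ∧ Reord l₀' X₀' l₀ X₀ q ∧ p ≫ m = m' ≫ q ▷ T.el := by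
  induction h with
  | @refl l X e =>
    refine ⟨_, _, _, _, hm, .refl ?_, by simp⟩
    induction hm with
    | here => simpa using e
    | there _ _ _ ih => simpa using ih (by simpa using e)
  | step l₁ X₁ e h ih =>
    obtain ⟨l₀', X₀', m', q, h₁, hq, eq⟩ := ih hm
    obtain ⟨l₀'', X₀'', m'', q', h₂, hq', eq'⟩ := pull_step l₁ X₁ e (by
      have := h.length.1
      simp only [List.length_append, List.length_cons] at this
      omega) h₁
    refine ⟨_, _, _, _, h₂, hq'.trans hq, ?_⟩
    rw [Category.assoc, eq, reassoc_of% eq', comp_whiskerRight]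

/-- Induction on the target. Its last entry is pulled back through both morphisms; the two pulls
agree because the labels are distinct, and what is left are two reorderings with a shorter target.
-/
theorem unique {p q : linObj X ⟶ linObj X'} (hp : Reord l X l' X' p) (hq : Reord l X l' X' q)
    (hl : l.Nodup) : p = q := by
  induction X' generalizing l X l' with
  | nil =>
    obtain rfl : l' = [] := by simpa using hp.length.2
    obtain rfl : l = [] := by simpa using hp.perm
    obtain rfl : X = [] := List.length_eq_zero_iff.1 hp.length.1.symm
    -- No transposition fits in an empty context, so only `refl` remains. The indices are variables
    -- here, with `eqToHom` bridging the equations, so that case analysis is possible.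
    have key : ∀ {l X l' X'} {p : linObj X ⟶ linObj X'}, Reord (D := D) l X l' X' p → (e : X = []) →
        (e' : X' = []) → p = eqToHom (by rw [e, e']) := by
      intro l X l' X' p h e e'
      cases h with
      | refl => simp
      | step => simp at e
    exact (key hp rfl rfl).trans (key hq rfl rfl).symm
  | cons S X' ih =>
    obtain _ | ⟨i, l'⟩ := l'
    · simpa using hp.length.2
    obtain ⟨l₁, X₁, m₁, p', h₁, hp', e₁⟩ := hp.pull (.here l' X')
    obtain ⟨l₂, X₂, m₂, q', h₂, hq', e₂⟩ := hq.pull (.here l' X')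
    cases h₁.unique h₂ hl
    have : (i :: l₁).Nodup := by
      refine List.Perm.nodup ?_ hl
      exact hp.perm.trans (hp'.perm.cons i).symm
    obtain rfl := ih hp' hq' (List.nodup_cons.1 this).2
    -- Pulling the head of the target is the identity, so `e₁` and `e₂` factor `p` and `q`
    -- themselves through the common pull.
    exact (Category.comp_id p).symm.trans (e₁.trans (e₂.symm.trans (Category.comp_id q)))

end Reord

end ILDTT

namespace ILDTT
open Model
variable {M : Model.{v₁, u₁, v, u}} {D : M.𝒞}

theorem Reord.of_eq {l l' : List ℕ} {X X' : List (STy D)} {p q : linObj X ⟶ linObj X'}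
    (h : Reord l X l' X' p) (e : q = p) : Reord l X l' X' q := e ▸ h

/-! ## Coherence for bracketed linear contexts -/

/-- Bracketed linear contexts. -/
inductive Tree (D : M.𝒞) : Type u
  | lst (X : List (STy D))
  | leaf (S : STy D)
  | node (A B : Tree D)

namespace Tree

/-- The object that a bracketed context denotes. -/
def obj : Tree D → M.fib D
  | lst X => linObj X
  | leaf S => S.el
  | node A B => A.obj ⊗ B.obj

/-- The entries, most recent first. -/
def leaves : Tree D → List (STy D)
  | lst X => X
  | leaf S => [S]
  | node A B => B.leaves ++ A.leaves

/-- The entries, followed by `acc`. -/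
def flatten : Tree D → List (STy D) → List (STy D)
  | lst X, acc => X ++ acc
  | leaf S, acc => S :: acc
  | node A B, acc => B.flatten (A.flatten acc)

theorem length_flatten (X : Tree D) (acc : List (STy D)) :
    (X.flatten acc).length = X.leaves.length + acc.length := by
  induction X generalizing acc with
  | lst X => simp [flatten, leaves]
  | leaf S => simp [flatten, leaves]; omega
  | node A B hA hB => simp [flatten, leaves, hA, hB]; omega

/-- The rebracketing isomorphism. -/
def flattenIso : (X : Tree D) → (acc : List (STy D)) →
    (linObj acc ⊗ X.obj ≅ linObj (X.flatten acc))
  | lst X, acc => (split acc X).symm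
  | leaf _, _ => Iso.refl _
  | node A B, acc => (α_ _ _ _).symm ≪≫ whiskerRightIso (A.flattenIso acc) B.obj ≪≫
      B.flattenIso (A.flatten acc)

end Tree

section
variable {C : Type u} [Category.{v} C] [MonoidalCategory C]

/-- This and the following identities compute the generators of `Coh` after conjugation by the
flattening isomorphisms. -/
theorem conj_comp_whiskerLeft {A B₁ B₂ B₃ F₁ F₂ F₃ : C} (e₁ : A ⊗ B₁ ≅ F₁) (e₂ : A ⊗ B₂ ≅ F₂)
    (e₃ : A ⊗ B₃ ≅ F₃) (p : B₁ ⟶ B₂) (q : B₂ ⟶ B₃) :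
    e₁.inv ≫ A ◁ (p ≫ q) ≫ e₃.hom =
      (e₁.inv ≫ A ◁ p ≫ e₂.hom) ≫ e₂.inv ≫ A ◁ q ≫ e₃.hom := by simp

theorem conj_whiskerRight_cons {A A' X Y Y' S : C} (r : A ⟶ A') (e : A ⊗ X ≅ Y)
    (e' : A' ⊗ X ≅ Y') :
    (whiskerRightIso e.symm S ≪≫ α_ _ _ _).hom ≫ r ▷ (X ⊗ S) ≫
        (whiskerRightIso e'.symm S ≪≫ α_ _ _ _).inv = (e.inv ≫ r ▷ X ≫ e'.hom) ▷ S := by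
  simp

theorem conj_whiskerRight_node {P P' A B F F' G G' : C} (r : P ⟶ P') (e₁ : P ⊗ A ≅ F)
    (e₂ : F ⊗ B ≅ G) (e₁' : P' ⊗ A ≅ F') (e₂' : F' ⊗ B ≅ G') :
    ((α_ _ _ _).symm ≪≫ whiskerRightIso e₁ B ≪≫ e₂).inv ≫ r ▷ (A ⊗ B) ≫
        ((α_ _ _ _).symm ≪≫ whiskerRightIso e₁' B ≪≫ e₂').hom =
      e₂.inv ≫ (e₁.inv ≫ r ▷ A ≫ e₁'.hom) ▷ B ≫ e₂'.hom := by simp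

theorem conj_whiskerLeft_whiskerRight {P A A' B F F' G G' : C} (r : A ⟶ A') (e₁ : P ⊗ A ≅ F)
    (e₂ : F ⊗ B ≅ G) (e₁' : P ⊗ A' ≅ F') (e₂' : F' ⊗ B ≅ G') :
    ((α_ _ _ _).symm ≪≫ whiskerRightIso e₁ B ≪≫ e₂).inv ≫ P ◁ (r ▷ B) ≫
        ((α_ _ _ _).symm ≪≫ whiskerRightIso e₁' B ≪≫ e₂').hom =
      e₂.inv ≫ (e₁.inv ≫ P ◁ r ≫ e₁'.hom) ▷ B ≫ e₂'.hom := by simp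

/-- By interchange, `r` commutes with the flattening of `A`; the accumulator in front of `r` thereby
grows from `P` to `F`. -/
theorem conj_whiskerLeft_whiskerLeft {P A B B' F G G' : C} (r : B ⟶ B') (e₁ : P ⊗ A ≅ F)
    (e₂ : F ⊗ B ≅ G) (e₂' : F ⊗ B' ≅ G') :
    ((α_ _ _ _).symm ≪≫ whiskerRightIso e₁ B ≪≫ e₂).inv ≫ P ◁ (A ◁ r) ≫
        ((α_ _ _ _).symm ≪≫ whiskerRightIso e₁ B' ≪≫ e₂').hom =
      e₂.inv ≫ F ◁ r ≫ e₂'.hom := by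
  simp only [Iso.trans_inv, Iso.symm_inv, whiskerRightIso_inv, Iso.trans_hom, Iso.symm_hom,
    whiskerRightIso_hom, Category.assoc, Iso.cancel_iso_inv_left]
  rw [associator_inv_naturality_right_assoc, whisker_exchange_assoc]
  simp

/-- Both bracketings flatten to the same list through the same steps, so the associator becomes the
identity. -/
theorem conj_associator {P A₁ A₂ A₃ F₁ F₂ F₃ : C} (e₁ : P ⊗ A₁ ≅ F₁) (e₂ : F₁ ⊗ A₂ ≅ F₂)
    (e₃ : F₂ ⊗ A₃ ≅ F₃) :
    ((α_ _ _ _).symm ≪≫ whiskerRightIso ((α_ _ _ _).symm ≪≫ whiskerRightIso e₁ A₂ ≪≫ e₂) A₃ ≪≫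
      e₃).inv ≫ P ◁ (α_ A₁ A₂ A₃).hom ≫
    ((α_ _ _ _).symm ≪≫ whiskerRightIso e₁ (A₂ ⊗ A₃) ≪≫ (α_ _ _ _).symm ≪≫
      whiskerRightIso e₂ A₃ ≪≫ e₃).hom = 𝟙 _ := by
  simp

end

/-- `Coh l X l' X' p`: `p` is a canonical morphism of symmetric monoidal categories from `X` to
`X'`, which takes the entries labelled by `l` to those labelled by `l'`. -/
inductive Coh : (l : List ℕ) → (X : Tree D) → (l' : List ℕ) → (X' : Tree D) →
    (X.obj ⟶ X'.obj) → Prop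
  | refl {l : List ℕ} {X : Tree D} : l.length = X.leaves.length → Coh l X l X (𝟙 _)
  | trans {l l' l'' X X' X''} {p : X.obj ⟶ X'.obj} {q : X'.obj ⟶ X''.obj} : Coh l X l' X' p →
      Coh l' X' l'' X'' q → Coh l X l'' X'' (p ≫ q)
  | whiskerRight {l l' A A'} {l₂ : List ℕ} {B : Tree D} {p : A.obj ⟶ A'.obj} : Coh l A l' A' p →
      l₂.length = B.leaves.length → Coh (l₂ ++ l) (.node A B) (l₂ ++ l') (.node A' B) (p ▷ B.obj)
  | whiskerLeft {l l' B B'} {l₁ : List ℕ} {A : Tree D} {p : B.obj ⟶ B'.obj} :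
      l₁.length = A.leaves.length → Coh l B l' B' p →
      Coh (l ++ l₁) (.node A B) (l' ++ l₁) (.node A B') (A.obj ◁ p)
  | assoc {l : List ℕ} {A₁ A₂ A₃ : Tree D} :
      l.length = A₃.leaves.length + A₂.leaves.length + A₁.leaves.length →
      Coh l (.node (.node A₁ A₂) A₃) l (.node A₁ (.node A₂ A₃)) (α_ A₁.obj A₂.obj A₃.obj).hom
  | assocInv {l : List ℕ} {A₁ A₂ A₃ : Tree D} :
      l.length = A₃.leaves.length + A₂.leaves.length + A₁.leaves.length →
      Coh l (.node A₁ (.node A₂ A₃)) l (.node (.node A₁ A₂) A₃) (α_ A₁.obj A₂.obj A₃.obj).inv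
  | leftUnitor {l : List ℕ} {A : Tree D} : l.length = A.leaves.length →
      Coh l (.node (.lst []) A) l A (λ_ A.obj).hom
  | leftUnitorInv {l : List ℕ} {A : Tree D} : l.length = A.leaves.length →
      Coh l A l (.node (.lst []) A) (λ_ A.obj).inv
  | rightUnitor {l : List ℕ} {A : Tree D} : l.length = A.leaves.length →
      Coh l (.node A (.lst [])) l A (ρ_ A.obj).hom
  | rightUnitorInv {l : List ℕ} {A : Tree D} : l.length = A.leaves.length →
      Coh l A l (.node A (.lst [])) (ρ_ A.obj).inv
  | swap (i j : ℕ) (S T : STy D) :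
      Coh [j, i] (.node (.leaf S) (.leaf T)) [i, j] (.node (.leaf T) (.leaf S)) (β_ S.el T.el).hom
  | cons {l : List ℕ} {S : STy D} {X : List (STy D)} : l.length = X.length + 1 →
      Coh l (.lst (S :: X)) l (.node (.lst X) (.leaf S)) (𝟙 (linObj (S :: X)))
  | uncons {l : List ℕ} {S : STy D} {X : List (STy D)} : l.length = X.length + 1 →
      Coh l (.node (.lst X) (.leaf S)) l (.lst (S :: X)) (𝟙 (linObj (S :: X)))

/-- The entries of `B` lie on top of the accumulator and stay where they are; each of them is added
by `Reord.cons`. -/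
theorem Reord.flatten {l m m' : List ℕ} {acc acc' : List (STy D)} (B : Tree D)
    {r : linObj acc ⟶ linObj acc'} (h : Reord m acc m' acc' r)
    (hl : l.length = B.leaves.length) :
    Reord (l ++ m) (B.flatten acc) (l ++ m') (B.flatten acc')
      ((B.flattenIso acc).inv ≫ r ▷ B.obj ≫ (B.flattenIso acc').hom) := by
  induction B generalizing l m m' acc acc' with
  | lst X =>
    induction X generalizing l with
    | nil =>
      obtain rfl : l = [] := List.length_eq_zero_iff.1 hl
      refine .of_eq h ?_
      have key {C : Type u} [Category.{v} C] [MonoidalCategory C] {A A' : C} (r : A ⟶ A') :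
        (ρ_ A).inv ≫ r ▷ 𝟙_ C ≫ (ρ_ A').hom = r := by simp
      exact key r
    | cons S X ih =>
      obtain _ | ⟨i, l⟩ := l
      · simp [Tree.leaves] at hl
      exact .of_eq ((ih (l := l) (by simpa [Tree.leaves] using hl)).cons i S)
        (conj_whiskerRight_cons r (split acc X).symm (split acc' X).symm)
  | leaf S =>
    obtain ⟨i, rfl⟩ := List.length_eq_one_iff.1 hl
    exact .of_eq (h.cons i S) ((Category.id_comp _).trans (Category.comp_id _))
  | node A B hA hB =>
    simp only [Tree.leaves, List.length_append] at hl
    rw [← l.take_append_drop B.leaves.length, List.append_assoc, List.append_assoc]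
    exact .of_eq (hB (hA h (l := l.drop _) (by simp; omega)) (by simp; omega))
      (conj_whiskerRight_node _ _ _ _ _)

namespace Coh
variable {l l' l'' : List ℕ} {X X' X'' : Tree D}

theorem of_eq {p q : X.obj ⟶ X'.obj}
    (h : Coh l X l' X' p) (e : q = p) : Coh l X l' X' q := e ▸ h

theorem length {p : X.obj ⟶ X'.obj} (h : Coh l X l' X' p) :
    l.length = X.leaves.length ∧ l'.length = X'.leaves.length := by
  induction h with
  | trans _ _ h h' => exact ⟨h.1, h'.2⟩
  | _ => simp_all [Tree.leaves, Nat.add_assoc]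

/-- After flattening, associators, unitors and the steps between a list and its last entry become
identities, and `swap` becomes one transposition. The accumulator must be arbitrary: for
`whiskerLeft` it is enlarged by the entries of the left factor. -/
theorem reord {p : X.obj ⟶ X'.obj} (h : Coh l X l' X' p) {m : List ℕ} {acc : List (STy D)}
    (hm : m.length = acc.length) :
    Reord (l ++ m) (X.flatten acc) (l' ++ m) (X'.flatten acc)
      ((X.flattenIso acc).inv ≫ linObj acc ◁ p ≫ (X'.flattenIso acc).hom) := by
  induction h generalizing m acc with
  | refl e => exact .of_eq (.refl (by simp [Tree.length_flatten, e, hm])) (by simp)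
  | trans _ _ h h' => exact .of_eq ((h hm).trans (h' hm)) (conj_comp_whiskerLeft _ _ _ _ _)
  | @whiskerRight _ _ A A' _ B p _ e h =>
    rw [List.append_assoc, List.append_assoc]
    exact .of_eq ((h hm).flatten B e) (conj_whiskerLeft_whiskerRight _ _ _ _ _)
  | whiskerLeft e _ h =>
    rw [List.append_assoc, List.append_assoc]
    exact .of_eq (h (by simp [Tree.length_flatten, e, hm])) (conj_whiskerLeft_whiskerLeft _ _ _ _)
  | assoc e =>
    exact .of_eq (.refl (by simp [Tree.length_flatten, Tree.leaves, e, hm]; omega)) (conj_associator _ _ _)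
  | assocInv e =>
    refine .of_eq (.refl (by simp [Tree.length_flatten, Tree.leaves, e, hm]; omega)) ?_
    have key {C : Type u} [Category.{v} C] [MonoidalCategory C] {A B B' F : C} (f : B ≅ B')
      {e : A ⊗ B ≅ F} {e' : A ⊗ B' ≅ F} (h : e.inv ≫ A ◁ f.hom ≫ e'.hom = 𝟙 _) :
      e'.inv ≫ A ◁ f.inv ≫ e.hom = 𝟙 _ := by
      rw [Iso.inv_comp_eq, Category.comp_id] at h ⊢
      rw [← h]; simp
    exact key _ (conj_associator _ _ _)
  | @leftUnitor _ A e =>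
    refine .of_eq (.refl (by simp [Tree.length_flatten, Tree.leaves, e, hm])) ?_
    -- The double `symm` is what the flattening of the empty list unfolds to.
    have key {C : Type u} [Category.{v} C] [MonoidalCategory C] {P A F : C} (e : P ⊗ A ≅ F) :
      ((α_ _ _ _).symm ≪≫ whiskerRightIso (ρ_ P).symm.symm A ≪≫ e).inv ≫ P ◁ (λ_ A).hom ≫ e.hom
        = 𝟙 _ := by simp
    exact key _
  | leftUnitorInv e =>
    refine .of_eq (.refl (by simp [Tree.length_flatten, e, hm])) ?_
    have key {C : Type u} [Category.{v} C] [MonoidalCategory C] {P A F : C} (e : P ⊗ A ≅ F) :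
      e.inv ≫ P ◁ (λ_ A).inv ≫ ((α_ _ _ _).symm ≪≫ whiskerRightIso (ρ_ P).symm.symm A ≪≫ e).hom
        = 𝟙 _ := by simp
    exact key _
  | rightUnitor e =>
    refine .of_eq (.refl (by simp [Tree.length_flatten, Tree.leaves, e, hm])) ?_
    have key {C : Type u} [Category.{v} C] [MonoidalCategory C] {P A F : C} (e : P ⊗ A ≅ F) :
      ((α_ _ _ _).symm ≪≫ whiskerRightIso e (𝟙_ C) ≪≫ (ρ_ F).symm.symm).inv ≫ P ◁ (ρ_ A).hom ≫
        e.hom = 𝟙 _ := by simp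
    exact key _
  | rightUnitorInv e =>
    refine .of_eq (.refl (by simp [Tree.length_flatten, e, hm])) ?_
    have key {C : Type u} [Category.{v} C] [MonoidalCategory C] {P A F : C} (e : P ⊗ A ≅ F) :
      e.inv ≫ P ◁ (ρ_ A).inv ≫
        ((α_ _ _ _).symm ≪≫ whiskerRightIso e (𝟙_ C) ≪≫ (ρ_ F).symm.symm).hom = 𝟙 _ := by simp
    exact key _
  | swap i j S T =>
    refine .of_eq (.swap j i T S hm) ?_
    have key {C : Type u} [Category.{v} C] [MonoidalCategory C] [SymmetricCategory C] {P A B : C} :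
      ((α_ P A B).symm ≪≫ whiskerRightIso (Iso.refl _) B ≪≫ Iso.refl _).inv ≫ P ◁ (β_ A B).hom ≫
        ((α_ P B A).symm ≪≫ whiskerRightIso (Iso.refl _) A ≪≫ Iso.refl _).hom = swapLast P A B := by
      simp [swapLast]
    exact key
  | @cons _ S X e =>
    refine .of_eq (.refl (by simp [Tree.flatten, e, hm]; omega)) ?_
    have key {C : Type u} [Category.{v} C] [MonoidalCategory C] {P X S F : C} (e : F ≅ P ⊗ X) :
      (whiskerRightIso e S ≪≫ α_ _ _ _).symm.inv ≫ P ◁ (𝟙 (X ⊗ S)) ≫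
        ((α_ _ _ _).symm ≪≫ whiskerRightIso e.symm S ≪≫ Iso.refl _).hom = 𝟙 _ := by simp
    exact key _
  | uncons e =>
    refine .of_eq (.refl (by simp [Tree.flatten, e, hm]; omega)) ?_
    have key {C : Type u} [Category.{v} C] [MonoidalCategory C] {P X S F : C} (e : F ≅ P ⊗ X) :
      ((α_ _ _ _).symm ≪≫ whiskerRightIso e.symm S ≪≫ Iso.refl _).inv ≫ P ◁ (𝟙 (X ⊗ S)) ≫
        (whiskerRightIso e S ≪≫ α_ _ _ _).symm.hom = 𝟙 _ := by simp
    exact key _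

/-- Coherence: the flattened morphisms agree by `Reord.unique`, and flattening with an empty
accumulator loses nothing, since tensoring with the unit is faithful. -/
theorem unique {p q : X.obj ⟶ X'.obj} (hp : Coh l X l' X' p) (hq : Coh l X l' X' q)
    (hl : l.Nodup) : p = q := by
  have h := (hp.reord (m := []) (acc := []) rfl).unique (hq.reord rfl) (by simpa using hl)
  have key {C : Type u} [Category.{v} C] [MonoidalCategory C] {A B F F' : C} {p q : A ⟶ B}
    (e : 𝟙_ C ⊗ A ≅ F) (e' : 𝟙_ C ⊗ B ≅ F') (h : e.inv ≫ 𝟙_ C ◁ p ≫ e'.hom =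
      e.inv ≫ 𝟙_ C ◁ q ≫ e'.hom) : p = q := by simpa using h
  exact key _ _ h

end Coh

end ILDTT

namespace ILDTT
open Model
variable {M : Model.{v₁, u₁, v, u}} {D : M.𝒞}

/-! ### Existence of canonical morphisms with prescribed labels -/

namespace Coh
variable {l l' l'' : List ℕ} {X X' X'' : Tree D}

theorem tensor {l₁ l₁' l₂ l₂' : List ℕ} {A A' B B' : Tree D} {p : A.obj ⟶ A'.obj}
    {q : B.obj ⟶ B'.obj} (hp : Coh l₁ A l₁' A' p) (hq : Coh l₂ B l₂' B' q) :
    Coh (l₂ ++ l₁) (.node A B) (l₂' ++ l₁') (.node A' B') (p ⊗ₘ q) :=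
  .of_eq (.trans (.whiskerRight hp hq.length.1) (.whiskerLeft hp.length.2 hq))
    (MonoidalCategory.tensorHom_def p q)

theorem exists_inv {p : X.obj ⟶ X'.obj} (h : Coh l X l' X' p) :
    ∃ q, Coh l' X' l X q ∧ p ≫ q = 𝟙 _ ∧ q ≫ p = 𝟙 _ := by
  induction h with
  | refl e => exact ⟨_, .refl e, by simp, by simp⟩
  | trans _ _ h h' =>
    obtain ⟨q, hq, e₁, e₂⟩ := h
    obtain ⟨q', hq', e₁', e₂'⟩ := h'
    exact ⟨_, .trans hq' hq, by rw [Category.assoc, reassoc_of% e₁', e₁],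
      by rw [Category.assoc, reassoc_of% e₂, e₂']⟩
  | @whiskerRight _ _ A A' _ B p _ e h =>
    obtain ⟨q, hq, e₁, e₂⟩ := h
    refine ⟨_, .whiskerRight hq e, ?_, ?_⟩
    · exact ((comp_whiskerRight _ _ _).symm.trans (by rw [e₁])).trans (id_whiskerRight _ _)
    · exact ((comp_whiskerRight _ _ _).symm.trans (by rw [e₂])).trans (id_whiskerRight _ _)
  | whiskerLeft e _ h =>
    obtain ⟨q, hq, e₁, e₂⟩ := h
    refine ⟨_, .whiskerLeft e hq, ?_, ?_⟩
    · exact ((MonoidalCategory.whiskerLeft_comp _ _ _).symm.trans (by rw [e₁])).trans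
        (MonoidalCategory.whiskerLeft_id _ _)
    · exact ((MonoidalCategory.whiskerLeft_comp _ _ _).symm.trans (by rw [e₂])).trans
        (MonoidalCategory.whiskerLeft_id _ _)
  | assoc e => exact ⟨_, .assocInv e, Iso.hom_inv_id _, Iso.inv_hom_id _⟩
  | assocInv e => exact ⟨_, .assoc e, Iso.inv_hom_id _, Iso.hom_inv_id _⟩
  | leftUnitor e => exact ⟨_, .leftUnitorInv e, Iso.hom_inv_id _, Iso.inv_hom_id _⟩
  | leftUnitorInv e => exact ⟨_, .leftUnitor e, Iso.inv_hom_id _, Iso.hom_inv_id _⟩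
  | rightUnitor e => exact ⟨_, .rightUnitorInv e, Iso.hom_inv_id _, Iso.inv_hom_id _⟩
  | rightUnitorInv e => exact ⟨_, .rightUnitor e, Iso.inv_hom_id _, Iso.hom_inv_id _⟩
  | swap i j S T =>
    exact ⟨_, .swap j i T S, SymmetricCategory.symmetry _ _, SymmetricCategory.symmetry _ _⟩
  | cons e => exact ⟨_, .uncons e, Category.id_comp _, Category.id_comp _⟩
  | uncons e => exact ⟨_, .cons e, Category.id_comp _, Category.id_comp _⟩

theorem map (r : ℕ → ℕ) {p : X.obj ⟶ X'.obj} (h : Coh l X l' X' p) :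
    Coh (l.map r) X (l'.map r) X' p := by
  induction h with
  | refl e => exact .refl (by simpa using e)
  | trans _ _ h h' => exact .trans h h'
  | whiskerRight _ e h => simpa using .whiskerRight h (by simpa using e)
  | whiskerLeft e _ h => simpa using .whiskerLeft (by simpa using e) h
  | assoc e => exact .assoc (by simpa using e)
  | assocInv e => exact .assocInv (by simpa using e)
  | leftUnitor e => exact .leftUnitor (by simpa using e)
  | leftUnitorInv e => exact .leftUnitorInv (by simpa using e)
  | rightUnitor e => exact .rightUnitor (by simpa using e)
  | rightUnitorInv e => exact .rightUnitorInv (by simpa using e)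
  | swap i j S T => exact .swap _ _ _ _
  | cons e => exact .cons (by simpa using e)
  | uncons e => exact .uncons (by simpa using e)

/-- Every generator moves an entry together with its label. `exists_of_perm` is the converse; the
two reduce questions about canonical morphisms to permutations of lists. -/
theorem perm_zip {p : X.obj ⟶ X'.obj} (h : Coh l X l' X' p) :
    (l.zip X.leaves).Perm (l'.zip X'.leaves) := by
  induction h with
  | trans _ _ h h' => exact h.trans h'
  | whiskerRight hp e h =>
    simp only [Tree.leaves]
    rw [List.zip_append e, List.zip_append e]
    exact h.append_left _
  | whiskerLeft e hp h =>
    simp only [Tree.leaves]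
    rw [List.zip_append hp.length.1, List.zip_append hp.length.2]
    exact h.append_right _
  | swap => exact List.Perm.swap _ _ _
  | _ => simp [Tree.leaves]

theorem perm {p : X.obj ⟶ X'.obj} (h : Coh l X l' X' p) : l.Perm l' := by
  have := h.perm_zip.map Prod.fst
  rwa [List.map_fst_zip h.length.1.le, List.map_fst_zip h.length.2.le] at this

theorem swapCons (i j : ℕ) (S T : STy D) (X : List (STy D)) (h : l.length = X.length) :
    Coh (j :: i :: l) (.lst (T :: S :: X)) (i :: j :: l) (.lst (S :: T :: X))
      (swapLast (linObj X) S.el T.el) := by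
  have h₁ (j i : ℕ) (T S : STy D) : Coh (j :: i :: l) (.lst (T :: S :: X)) (j :: i :: l)
      (.node (.node (.lst X) (.leaf S)) (.leaf T)) (𝟙 _ ≫ 𝟙 _ ▷ T.el) := by
    have h₁ : Coh (i :: l) (.lst (S :: X)) (i :: l) (.node (.lst X) (.leaf S)) _ :=
      .cons (by simp [h])
    have h₂ : Coh (j :: i :: l) (.lst (T :: S :: X)) (j :: i :: l)
      (.node (.lst (S :: X)) (.leaf T)) _ := .cons (by simp [h])
    exact h₂.trans (h₁.whiskerRight (l₂ := [j]) (B := .leaf T) rfl)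
  have h₂ (i j : ℕ) (S T : STy D) : Coh (i :: j :: l) (.node (.node (.lst X) (.leaf T)) (.leaf S))
      (i :: j :: l) (.lst (S :: T :: X)) (𝟙 _ ▷ S.el ≫ 𝟙 _) := by
    have h₁ : Coh (j :: l) (.node (.lst X) (.leaf T)) (j :: l) (.lst (T :: X)) _ :=
      .uncons (by simp [h])
    have h₂ : Coh (i :: j :: l) (.node (.lst (T :: X)) (.leaf S)) (i :: j :: l)
      (.lst (S :: T :: X)) _ := .uncons (by simp [h])
    exact (h₁.whiskerRight (l₂ := [i]) (B := .leaf S) rfl).trans h₂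
  have h₃ : Coh (j :: i :: l) (.node (.node (.lst X) (.leaf S)) (.leaf T)) (i :: j :: l)
      (.node (.node (.lst X) (.leaf T)) (.leaf S)) (swapLast (linObj X) S.el T.el) :=
    .trans (.assoc (by simp [Tree.leaves, h]; omega))
      (.trans (.whiskerLeft h (.swap i j S T)) (.assocInv (by simp [Tree.leaves, h]; omega)))
  refine ((h₁ j i T S).trans (h₃.trans (h₂ i j S T))).of_eq ?_
  have key {C : Type u} [Category.{v} C] [MonoidalCategory C] [SymmetricCategory C] {P A B : C} :
    swapLast P A B = (𝟙 _ ≫ 𝟙 _ ▷ B) ≫ swapLast P A B ≫ 𝟙 _ ▷ A ≫ 𝟙 _ := by simp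
  exact key

theorem consCongr {i : ℕ} {S : STy D} {X X' : List (STy D)} {p : linObj X ⟶ linObj X'}
    (h : Coh l (.lst X) l' (.lst X') p) :
    Coh (i :: l) (.lst (S :: X)) (i :: l') (.lst (S :: X')) (p ▷ S.el) := by
  have e : l.length = X.length := h.length.1
  have e' : l'.length = X'.length := h.length.2
  refine (Coh.trans (.cons (l := i :: l) (by simp [e])) (.trans (.whiskerRight (l₂ := [i]) h rfl)
    (.uncons (l := i :: l') (by simp [e'])))).of_eq ?_
  exact ((Category.id_comp _).trans (Category.comp_id _)).symm

theorem exMor (i j : ℕ) (S T : STy D) {X : List (STy D)} (l₁ : List ℕ) (X₁ : List (STy D))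
    (h : l.length = X.length) (h₁ : l₁.length = X₁.length) :
    Coh (l₁ ++ j :: i :: l) (.lst (X₁ ++ T :: S :: X)) (l₁ ++ i :: j :: l)
      (.lst (X₁ ++ S :: T :: X)) (exMor X T S X₁) := by
  induction X₁ generalizing l₁ with
  | nil =>
    obtain rfl : l₁ = [] := List.length_eq_zero_iff.1 h₁
    exact swapCons i j S T X h
  | cons U X₁ ih =>
    obtain _ | ⟨k, l₁⟩ := l₁
    · simp at h₁
    exact (ih l₁ (by simpa using h₁)).consCongr

theorem split {l₂ : List ℕ} {X X₂ : List (STy D)} (h : l.length = X.length)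
    (h₂ : l₂.length = X₂.length) :
    Coh (l₂ ++ l) (.lst (X₂ ++ X)) (l₂ ++ l) (.node (.lst X) (.lst X₂)) (split X X₂).hom := by
  induction X₂ generalizing l₂ with
  | nil =>
    obtain rfl : l₂ = [] := List.length_eq_zero_iff.1 h₂
    exact .rightUnitorInv h
  | cons U X₂ ih =>
    obtain _ | ⟨k, l₂⟩ := l₂
    · simp at h₂
    replace h₂ : l₂.length = X₂.length := by simpa using h₂
    have h₁ : Coh (k :: (l₂ ++ l)) (.lst (U :: (X₂ ++ X))) (k :: (l₂ ++ l))
      (.node (.lst (X₂ ++ X)) (.leaf U)) (𝟙 _) := .cons (by simp [h, h₂])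
    refine (h₁.trans (.trans (.whiskerRight (l₂ := [k]) (ih h₂) rfl) (.trans
      (.assoc (by simp [h, h₂, Tree.leaves]; omega)) (.whiskerLeft (l := k :: l₂) h
        (.uncons (by simp [h₂])))))).of_eq ?_
    have key {C : Type u} [Category.{v} C] [MonoidalCategory C] {F P A B : C} (e : F ≅ P ⊗ A) :
      (whiskerRightIso e B ≪≫ α_ _ _ _).hom = 𝟙 _ ≫ e.hom ▷ B ≫ (α_ P A B).hom ≫ P ◁ 𝟙 _ := by
      simp
    exact key _

theorem splitInv {l₂ : List ℕ} {X X₂ : List (STy D)} (h : l.length = X.length)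
    (h₂ : l₂.length = X₂.length) :
    Coh (l₂ ++ l) (.node (.lst X) (.lst X₂)) (l₂ ++ l) (.lst (X₂ ++ X))
      (ILDTT.split X X₂).inv := by
  obtain ⟨q, hq, e₁, e₂⟩ := (split h h₂).exists_inv
  refine hq.of_eq ?_
  rw [← Category.comp_id (ILDTT.split X X₂).inv]
  exact ((congrArg _ e₁.symm).trans (Iso.inv_hom_id_assoc _ _))

theorem exists_lst (X : Tree D) (h : l.length = X.leaves.length) :
    ∃ p, Coh l X l (.lst X.leaves) p := by
  induction X generalizing l with
  | lst X => exact ⟨_, .refl h⟩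
  | leaf S => exact ⟨_, .trans (.leftUnitorInv h) (.uncons h)⟩
  | node A B hA hB =>
    simp only [Tree.leaves, List.length_append] at h
    rw [← l.take_append_drop B.leaves.length]
    obtain ⟨p, hp⟩ := hA (l := l.drop B.leaves.length) (by simp; omega)
    obtain ⟨q, hq⟩ := hB (l := l.take B.leaves.length) (by simp; omega)
    exact ⟨_, (hp.tensor hq).trans (splitInv hp.length.2 hq.length.2)⟩

theorem exists_of_perm_list {L L' : List (ℕ × STy D)} (h : L.Perm L') :
    ∃ p, Coh (L.map Prod.fst) (.lst (L.map Prod.snd)) (L'.map Prod.fst)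
      (.lst (L'.map Prod.snd)) p := by
  induction h with
  | nil => exact ⟨_, .refl rfl⟩
  | cons a _ ih =>
    obtain ⟨p, hp⟩ := ih
    exact ⟨_, hp.consCongr⟩
  | swap a b L => exact ⟨_, swapCons _ _ _ _ _ (by simp)⟩
  | trans _ _ h h' =>
    obtain ⟨p, hp⟩ := h
    obtain ⟨q, hq⟩ := h'
    exact ⟨_, hp.trans hq⟩

/-- Both trees are canonically isomorphic to lists of entries, and a permutation of lists is
generated by adjacent transpositions. -/
theorem exists_of_perm (h : (l.zip X.leaves).Perm (l'.zip X'.leaves))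
    (e : l.length = X.leaves.length) (e' : l'.length = X'.leaves.length) :
    ∃ p, Coh l X l' X' p := by
  obtain ⟨p, hp⟩ : ∃ p, Coh l (.lst X.leaves) l' (.lst X'.leaves) p := by
    have := exists_of_perm_list h
    rwa [List.map_fst_zip e.le, List.map_fst_zip e'.le, List.map_snd_zip e.ge,
      List.map_snd_zip e'.ge] at this
  obtain ⟨q, hq⟩ := exists_lst X e
  obtain ⟨q', hq'⟩ := exists_lst X' e'
  obtain ⟨q'', hq'', -⟩ := hq'.exists_inv
  exact ⟨_, hq.trans (hp.trans hq'')⟩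

/-- `Coh.swap` exchanges only two single entries. The hexagon (`of_node`) extends this to any second
factor, and then, through the symmetry (`symm`), to any first factor. -/
theorem braid {l₁ l₂ : List ℕ} {A B : Tree D} (h₁ : l₁.length = A.leaves.length)
    (h₂ : l₂.length = B.leaves.length) :
    Coh (l₂ ++ l₁) (.node A B) (l₁ ++ l₂) (.node B A) (β_ A.obj B.obj).hom := by
  have of_unit {A : Tree D} {l : List ℕ} (h : l.length = A.leaves.length) :
      Coh l (.node A (.lst [])) l (.node (.lst []) A) (β_ A.obj (𝟙_ _)).hom :=
    (Coh.trans (.rightUnitor h) (.leftUnitorInv h)).of_eq (braiding_tensorUnit_right _)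
  have of_node {A B₁ B₂ : Tree D} {l₁ l₂ l₃ : List ℕ}
      (h₁ : l₁.length = A.leaves.length) (h₂ : l₂.length = B₁.leaves.length)
      (h₃ : l₃.length = B₂.leaves.length)
      (h : Coh (l₂ ++ l₁) (.node A B₁) (l₁ ++ l₂) (.node B₁ A) (β_ A.obj B₁.obj).hom)
      (h' : Coh (l₃ ++ l₁) (.node A B₂) (l₁ ++ l₃) (.node B₂ A) (β_ A.obj B₂.obj).hom) :
      Coh (l₃ ++ l₂ ++ l₁) (.node A (.node B₁ B₂)) (l₁ ++ (l₃ ++ l₂)) (.node (.node B₁ B₂) A)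
        (β_ A.obj (B₁.obj ⊗ B₂.obj)).hom := by
    have e₁ := h.whiskerRight h₃
    have e₂ := h'.whiskerLeft h₂
    rw [← List.append_assoc] at e₁
    rw [List.append_assoc, List.append_assoc l₁ l₃ l₂] at e₂
    exact (Coh.trans (.assocInv (by simp [h₁, h₂, h₃]; omega)) (e₁.trans (.trans
      (.assoc (by simp [h₁, h₂, h₃]; omega)) (e₂.trans
        (.assocInv (by simp [h₁, h₂, h₃]; omega)))))).of_eq
          (BraidedCategory.braiding_tensor_right_hom _ _ _)
  have symm {A B : Tree D} {l₁ l₂ : List ℕ}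
      (h : Coh (l₂ ++ l₁) (.node A B) (l₁ ++ l₂) (.node B A) (β_ A.obj B.obj).hom) :
      Coh (l₁ ++ l₂) (.node B A) (l₂ ++ l₁) (.node A B) (β_ B.obj A.obj).hom := by
    obtain ⟨q, hq, e₁, e₂⟩ := h.exists_inv
    refine hq.of_eq ?_
    have key {C : Type u} [Category.{v} C] [MonoidalCategory C] [SymmetricCategory C] {A B : C}
      {q : B ⊗ A ⟶ A ⊗ B} (h : (β_ A B).hom ≫ q = 𝟙 _) : (β_ B A).hom = q := by
      rw [← SymmetricCategory.symmetry_assoc B A q, h, Category.comp_id]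
    exact key e₁
  have of_leaf {S : STy D} {i : ℕ} {B : Tree D} {l₂ : List ℕ} (h₂ : l₂.length = B.leaves.length) :
      Coh (l₂ ++ [i]) (.node (.leaf S) B) ([i] ++ l₂) (.node B (.leaf S)) (β_ S.el B.obj).hom := by
    induction B generalizing l₂ with
    | lst X =>
      induction X generalizing l₂ with
      | nil =>
        obtain rfl : l₂ = [] := List.length_eq_zero_iff.1 h₂
        exact of_unit rfl
      | cons T X ih =>
        obtain _ | ⟨j, l₂⟩ := l₂
        · simp [Tree.leaves] at h₂
        have h₃ : l₂.length = X.length := by simpa [Tree.leaves] using h₂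
        refine (Coh.trans (.whiskerLeft (l₁ := [i]) (l := j :: l₂) rfl (.cons (by simp [h₃])))
          (.trans (of_node (l₃ := [j]) rfl h₃ rfl (ih h₃) (.swap _ _ _ _))
            (.whiskerRight (l₂ := [i]) (.uncons (by simp [h₃])) rfl))).of_eq ?_
        have key {C : Type u} [Category.{v} C] [MonoidalCategory C] [SymmetricCategory C]
          (A B : C) : (β_ A B).hom = A ◁ 𝟙 _ ≫ (β_ A B).hom ≫ 𝟙 _ ▷ A := by simp
        exact key _ _
    | leaf T =>
      obtain ⟨j, rfl⟩ := List.length_eq_one_iff.1 h₂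
      exact .swap _ _ _ _
    | node B₁ B₂ ih₁ ih₂ =>
      simp only [Tree.leaves, List.length_append] at h₂
      rw [← l₂.take_append_drop B₂.leaves.length]
      exact of_node rfl (by simp; omega) (by simp; omega) (ih₁ (by simp; omega))
        (ih₂ (by simp; omega))
  induction A generalizing l₁ with
  | lst X =>
    induction X generalizing l₁ with
    | nil =>
      obtain rfl : l₁ = [] := List.length_eq_zero_iff.1 h₁
      exact symm (l₁ := l₂) (l₂ := []) (by rw [List.append_nil]; exact of_unit h₂)
    | cons T X ih =>
      obtain _ | ⟨j, l₁⟩ := l₁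
      · simp [Tree.leaves] at h₁
      have h₃ : l₁.length = X.length := by simpa [Tree.leaves] using h₁
      refine (Coh.trans (.whiskerRight (l' := j :: l₁) (.cons (by simp [h₃])) h₂)
        (.trans (symm (of_node (l₃ := [j]) h₂ h₃ rfl (symm (ih h₃)) (symm (of_leaf h₂))))
          (.whiskerLeft (l' := j :: l₁) h₂ (.uncons (by simp [h₃]))))).of_eq ?_
      have key {C : Type u} [Category.{v} C] [MonoidalCategory C] [SymmetricCategory C]
        (A B : C) : (β_ A B).hom = 𝟙 _ ▷ B ≫ (β_ A B).hom ≫ B ◁ 𝟙 _ := by simp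
      exact key _ _
  | leaf T =>
    obtain ⟨j, rfl⟩ := List.length_eq_one_iff.1 h₁
    exact of_leaf h₂
  | node A₁ A₂ ih₁ ih₂ =>
    simp only [Tree.leaves, List.length_append] at h₁
    rw [← l₁.take_append_drop A₂.leaves.length]
    exact symm (of_node h₂ (by simp; omega) (by simp; omega) (symm (ih₁ (by simp; omega)))
      (symm (ih₂ (by simp; omega))))

/-- As the labels are distinct, a block is recovered from the concatenation by filtering for its set
of labels, and filtering respects permutations. -/
theorem perm_blocks {κ : Type*} {L₁ L₁' L₂ L₂' : List (ℕ × κ)} (h : (L₂ ++ L₁).Perm (L₂' ++ L₁'))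
    (hL : ((L₂ ++ L₁).map Prod.fst).Nodup)
    (e : ∀ i, i ∈ L₁.map Prod.fst ↔ i ∈ L₁'.map Prod.fst) : L₁.Perm L₁' ∧ L₂.Perm L₂' := by
  classical
  have key {L₁ L₂ : List (ℕ × κ)} (hL : ((L₂ ++ L₁).map Prod.fst).Nodup) :
      (L₂ ++ L₁).filter (fun a => a.1 ∈ L₁.map Prod.fst) = L₁ := by
    rw [List.map_append, List.nodup_append] at hL
    rw [List.filter_append, List.filter_eq_nil_iff.2, List.filter_eq_self.2, List.nil_append]
    · intro a ha
      simpa using ⟨a.2, ha⟩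
    · intro a ha ha'
      exact hL.2.2 _ (List.mem_map_of_mem ha) _ (of_decide_eq_true ha') rfl
  have h₁ : L₁.Perm L₁' := by
    have := h.filter (fun a => a.1 ∈ L₁.map Prod.fst)
    rw [key hL] at this
    simp only [e] at this
    rwa [key ((h.map _).nodup hL)] at this
  exact ⟨h₁, (List.perm_append_right_iff L₁).1 (h.trans (h₁.symm.append_left _))⟩

/-- The permutation restricts to each block, so canonical `p` and `q` exist, and `p ⊗ₘ q` equals `r`
by coherence. This makes interpretations comparable that split a context differently. -/
theorem exists_tensor {l₁ l₁' l₂ l₂' : List ℕ} {A A' B B' : Tree D} {r}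
    (h : Coh (l₂ ++ l₁) (.node A B) (l₂' ++ l₁') (.node A' B') r) (hl : (l₂ ++ l₁).Nodup)
    (e₁ : l₁.length = A.leaves.length) (e₁' : l₁'.length = A'.leaves.length)
    (e : ∀ i, i ∈ l₁ ↔ i ∈ l₁') :
    ∃ p q, Coh l₁ A l₁' A' p ∧ Coh l₂ B l₂' B' q ∧ r = p ⊗ₘ q := by
  have e₂ : l₂.length = B.leaves.length := by simpa [Tree.leaves, e₁] using h.length.1
  have e₂' : l₂'.length = B'.leaves.length := by simpa [Tree.leaves, e₁'] using h.length.2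
  have hz := h.perm_zip
  simp only [Tree.leaves] at hz
  rw [List.zip_append e₂, List.zip_append e₂'] at hz
  have hz' := perm_blocks hz (by
    rwa [List.map_append, List.map_fst_zip e₂.le, List.map_fst_zip e₁.le]) (by
    rwa [List.map_fst_zip e₁.le, List.map_fst_zip e₁'.le])
  obtain ⟨p, hp⟩ := exists_of_perm hz'.1 e₁ e₁'
  obtain ⟨q, hq⟩ := exists_of_perm hz'.2 e₂ e₂'
  exact ⟨p, q, hp, hq, h.unique (hp.tensor hq) hl⟩

end Coh

end ILDTT

namespace ILDTT
open Model

/-! ## Renaming of linear variables -/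

section
variable {𝔽 : Symbols.{w}}

theorem Tm.lift₂_comp (r r' : ℕ → ℕ) : lift₂ r' ∘ lift₂ r = lift₂ (r' ∘ r) := by
  funext j
  match j with
  | 0 => rfl
  | 1 => rfl
  | j + 2 => rfl

theorem Tm.lift₂_id : lift₂ id = id := by
  funext j
  match j with
  | 0 => rfl
  | 1 => rfl
  | j + 2 => rfl

theorem Tm.lren_lren (a : Tm 𝔽) (r r' : ℕ → ℕ) : (a.lren r).lren r' = a.lren (r' ∘ r) := by
  induction a generalizing r r' <;> simp_all [lren, lift₂_comp]

theorem Tm.lren_id (a : Tm 𝔽) : a.lren id = a := by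
  induction a <;> simp_all [lren, lift₂_id]

theorem swapAt_swapAt (k j : ℕ) : swapAt k (swapAt k j) = j := by
  unfold swapAt
  grind

end

/-! ## The interpretation of terms over bracketed linear contexts -/

variable {𝔽 : Symbols.{w}} {M : Model.{v₁, u₁, v, u}} {D : M.𝒞}

/-- `Den 𝔡 ρ a l X S f`: the term `a`, whose linear variables are the labels `l` of the entries of
`X`, denotes `f : X ⟶ S`. In contrast to `ITm`, there is exactly one rule for each form of term. -/
inductive Den (𝔡 : Denot 𝔽 M) (ρ : List (Sec D)) :
    Tm 𝔽 → (l : List ℕ) → (X : Tree D) → (S : STy D) → (X.obj ⟶ S.el) → Prop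
  | ivar {i l X} {s : Sec D} {p : X.obj ⟶ 𝟙_ _} : ρ[i]? = some s → Coh l X [] (.lst []) p →
      Den 𝔡 ρ (.ivar i) l X s.1 (p ≫ s.2)
  | lvar {j l X S} {p : X.obj ⟶ S.el} : Coh l X [j] (.leaf S) p → Den 𝔡 ρ (.lvar j) l X S p
  | con (c : 𝔽.TmC) {us : Fin (𝔽.tmAr c) → Tm 𝔽} {s : Fin (𝔽.tmAr c) → Sec D}
      {l X} {b : Tm 𝔽} {h : D ⟶ (𝔡.tmCtx c).D} {g : X.obj ⟶ ((𝔡.tmArg c).re h).el} :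
      (∀ i, Den 𝔡 ρ (us i) [] (.lst []) (s i).1 (s i).2) →
      (𝔡.tmCtx c).vars.map (Sec.re h) = List.ofFn s →
      Den 𝔡 ρ b l X ((𝔡.tmArg c).re h) g →
      Den 𝔡 ρ (.con c us b) l X ((𝔡.tmRes c).re h)
        (g ≫ ((𝔡.tmArg c).reIso h).hom ≫ (re h).map (𝔡.tmMor c) ≫ ((𝔡.tmRes c).reIso h).inv)
  | star {l X} {p : X.obj ⟶ 𝟙_ _} : Coh l X [] (.lst []) p → Den 𝔡 ρ .star l X .unit p
  | letU {l l₁ l₂ X X₁ X₂ t a S} {p : X.obj ⟶ X₁.obj ⊗ X₂.obj} {f : X₂.obj ⟶ 𝟙_ _}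
      {g : X₁.obj ⟶ S.el} : Coh l X (l₂ ++ l₁) (.node X₁ X₂) p → Den 𝔡 ρ t l₂ X₂ .unit f →
      Den 𝔡 ρ a l₁ X₁ S g → Den 𝔡 ρ (.letU t a) l X S (p ≫ (g ⊗ₘ f) ≫ (ρ_ S.el).hom)
  | tens {l l₁ l₂ X X₁ X₂ a b S T} {p : X.obj ⟶ X₁.obj ⊗ X₂.obj} {f : X₁.obj ⟶ S.el}
      {g : X₂.obj ⟶ T.el} : Coh l X (l₂ ++ l₁) (.node X₁ X₂) p → Den 𝔡 ρ a l₁ X₁ S f →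
      Den 𝔡 ρ b l₂ X₂ T g → Den 𝔡 ρ (.tens a b) l X (.tensor S T) (p ≫ (f ⊗ₘ g))
  | letT {l l₁ l₂ X X₁ X₂ t c S T R} {p : X.obj ⟶ X₁.obj ⊗ X₂.obj}
      {f : X₂.obj ⟶ S.el ⊗ T.el} {g : (X₁.obj ⊗ S.el) ⊗ T.el ⟶ R.el} :
      Coh l X (l₂ ++ l₁) (.node X₁ X₂) p → Den 𝔡 ρ t l₂ X₂ (.tensor S T) f →
      Den 𝔡 ρ c (0 :: 1 :: l₁.map (· + 2)) (.node (.node X₁ (.leaf S)) (.leaf T)) R g →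
      Den 𝔡 ρ (.letT t c) l X R (p ≫ X₁.obj ◁ f ≫ (α_ X₁.obj S.el T.el).inv ≫ g)

namespace Den
variable {𝔡 : Denot 𝔽 M} {ρ : List (Sec D)} {a : Tm 𝔽} {l l' : List ℕ} {X X' : Tree D}
  {S S' : STy D}

theorem of_eq {f g : X.obj ⟶ S.el} (h : Den 𝔡 ρ a l X S f) (e : g = f) : Den 𝔡 ρ a l X S g :=
  e ▸ h

theorem coh {f : X.obj ⟶ S.el} (h : Den 𝔡 ρ a l X S f) {p : X'.obj ⟶ X.obj}
    (hp : Coh l' X' l X p) : Den 𝔡 ρ a l' X' S (p ≫ f) := by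
  induction h generalizing l' X' with
  | ivar hs hq => exact of_eq (.ivar hs (hp.trans hq)) (Category.assoc _ _ _).symm
  | lvar hq => exact .lvar (hp.trans hq)
  | con c hs hv _ _ ih => exact of_eq (.con c hs hv (ih hp)) (Category.assoc _ _ _).symm
  | star hq => exact .star (hp.trans hq)
  | letU hq ht ha => exact of_eq (.letU (hp.trans hq) ht ha) (Category.assoc _ _ _).symm
  | tens hq ht ha => exact of_eq (.tens (hp.trans hq) ht ha) (Category.assoc _ _ _).symm
  | letT hq ht ha => exact of_eq (.letT (hp.trans hq) ht ha) (Category.assoc _ _ _).symm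

theorem lren {f : X.obj ⟶ S.el} (h : Den 𝔡 ρ a l X S f) (r : ℕ → ℕ) :
    Den 𝔡 ρ (a.lren r) (l.map r) X S f := by
  induction h generalizing r with
  | ivar hs hq => exact .ivar hs (hq.map r)
  | lvar hq => exact .lvar (hq.map r)
  | con c hs hv _ _ ih => exact .con c hs hv (ih r)
  | star hq => exact .star (hq.map r)
  | letU hq _ _ ht ha => exact .letU (by simpa using hq.map r) (ht r) (ha r)
  | tens hq _ _ ht ha => exact .tens (by simpa using hq.map r) (ht r) (ha r)
  | letT hq _ _ ht ha =>
    refine .letT (by simpa using hq.map r) (ht r) ?_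
    have := ha (Tm.lift₂ r)
    simpa [Tm.lift₂, Function.comp_def] using this

theorem length {f : X.obj ⟶ S.el} (h : Den 𝔡 ρ a l X S f) : l.length = X.leaves.length := by
  induction h with
  | con _ _ _ _ _ ih => exact ih
  | _ => exact Coh.length ‹_› |>.1

/-- By linearity the labels are exactly the free linear variables of the term. Thus two
interpretations of a `let` or a `⊗` distribute the same variables to the subterms. -/
theorem mem_iff {f : X.obj ⟶ S.el} {f' : X'.obj ⟶ S'.el} (h : Den 𝔡 ρ a l X S f)
    (h' : Den 𝔡 ρ a l' X' S' f') (i : ℕ) : i ∈ l ↔ i ∈ l' := by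
  induction h generalizing l' X' S' i with
  | ivar _ hq => cases h' with | ivar _ hq' => rw [hq.perm.mem_iff, hq'.perm.mem_iff]
  | lvar hq => cases h' with | lvar hq' => rw [hq.perm.mem_iff, hq'.perm.mem_iff]
  | star hq => cases h' with | star hq' => rw [hq.perm.mem_iff, hq'.perm.mem_iff]
  | con c _ _ _ _ ih => cases h' with | con _ _ _ h => exact ih h i
  | letU hq _ _ ht ha =>
    cases h' with
    | letU hq' ht' ha' =>
      rw [hq.perm.mem_iff, hq'.perm.mem_iff, List.mem_append, List.mem_append, ht ht' i, ha ha' i]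
  | tens hq _ _ ht ha =>
    cases h' with
    | tens hq' ht' ha' =>
      rw [hq.perm.mem_iff, hq'.perm.mem_iff, List.mem_append, List.mem_append, ht ht' i, ha ha' i]
  | letT hq _ _ ht ha =>
    cases h' with
    | letT hq' ht' ha' =>
      rw [hq.perm.mem_iff, hq'.perm.mem_iff, List.mem_append, List.mem_append, ht ht' i]
      simpa using or_congr_right (ha ha' (i + 2))

theorem lren_congr {f : X.obj ⟶ S.el} (h : Den 𝔡 ρ a l X S f) {r r' : ℕ → ℕ}
    (e : ∀ j ∈ l, r j = r' j) : a.lren r = a.lren r' := by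
  induction h generalizing r r' with
  | ivar | star => rfl
  | lvar hq => simp [Tm.lren, e _ (hq.perm.mem_iff.2 (List.mem_singleton_self _))]
  | con c hs hv _ _ ih => simp [Tm.lren, ih e]
  | letU hq _ _ ht ha | tens hq _ _ ha ht =>
    simp only [hq.perm.mem_iff, List.mem_append] at e
    simp [Tm.lren, ht fun j hj => e j (by simp [hj]), ha fun j hj => e j (by simp [hj])]
  | letT hq _ _ ht ha =>
    simp only [hq.perm.mem_iff, List.mem_append] at e
    simp only [Tm.lren, ht fun j hj => e j (by simp [hj])]
    rw [ha]
    intro j hj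
    match j with
    | 0 => rfl
    | 1 => rfl
    | j + 2 => simpa [Tm.lift₂] using e j (.inr (by simpa using hj))

/-- All labels are free variables of the renamed term, hence in the image of `r`, and a left inverse
of `r` removes the renaming. This is how a term shifted past binders is seen not to use the bound
variables. -/
theorem lren_inv {r : ℕ → ℕ} (hr : r.Injective) {f : X.obj ⟶ S.el}
    (h : Den 𝔡 ρ (a.lren r) l' X S f) : ∃ l, l' = l.map r ∧ Den 𝔡 ρ a l X S f := by
  have coh_inv {r : ℕ → ℕ} (hr : r.Injective) {l' m X X'} {p : X.obj ⟶ X'.obj}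
      (h : Coh (D := D) l' X (m.map r) X' p) : ∃ l, l' = l.map r ∧ Coh l X m X' p := by
    obtain ⟨g, hg⟩ := hr.hasLeftInverse
    refine ⟨l'.map g, ?_, by simpa [hg.comp_eq_id] using h.map g⟩
    rw [List.map_map]
    refine (List.map_id _).symm.trans (List.map_congr_left fun j hj => ?_)
    obtain ⟨k, -, rfl⟩ := List.mem_map.1 (h.perm.mem_iff.1 hj)
    simp [hg k]
  have lift_inj {r : ℕ → ℕ} (hr : r.Injective) : (Tm.lift₂ r).Injective := by
    intro i j e
    match i, j with
    | 0, 0 => rfl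
    | 1, 1 => rfl
    | 0, 1 | 1, 0 | 0, j + 2 | 1, j + 2 | j + 2, 0 | j + 2, 1 => simp [Tm.lift₂] at e
    | i + 2, j + 2 => simpa [Tm.lift₂, hr.eq_iff] using e
  -- Under two binders the labels begin with 0 and 1, which have only themselves as preimages; all
  -- others are at least 2, and so are their preimages.
  have map_lift₂ {r : ℕ → ℕ} {l' m : List ℕ} (e : 0 :: 1 :: l'.map (· + 2) = m.map (Tm.lift₂ r)) :
      ∃ l : List ℕ, m = 0 :: 1 :: l.map (· + 2) ∧ l' = l.map r := by
    obtain _ | ⟨_ | _ | i, _ | ⟨_ | _ | j, m⟩⟩ := m <;> simp [Tm.lift₂] at e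
    induction m generalizing l' with
    | nil => exact ⟨[], rfl, by simpa using e⟩
    | cons k m ih =>
      obtain _ | ⟨k', l'⟩ := l'
      · simp at e
      obtain _ | _ | k := k <;> simp [Tm.lift₂] at e
      obtain ⟨l, e', rfl⟩ := ih e.2
      exact ⟨k :: l, by simpa using e', by simp [e.1]⟩
  induction a generalizing r l' X S with
  | ivar i =>
    cases h with
    | ivar hs hq =>
      obtain ⟨l, rfl, hl⟩ := coh_inv hr (m := []) hq
      exact ⟨l, rfl, .ivar hs hl⟩
  | lvar j =>
    cases h with
    | lvar hq =>
      obtain ⟨l, rfl, hl⟩ := coh_inv hr (m := [j]) hq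
      exact ⟨l, rfl, .lvar hl⟩
  | con c us b _ ih =>
    cases h with
    | con _ hs hv hb =>
      obtain ⟨l, rfl, hl⟩ := ih hr hb
      exact ⟨l, rfl, .con c hs hv hl⟩
  | star =>
    cases h with
    | star hq =>
      obtain ⟨l, rfl, hl⟩ := coh_inv hr (m := []) hq
      exact ⟨l, rfl, .star hl⟩
  | letU t a iht iha =>
    cases h with
    | letU hq ht ha =>
      obtain ⟨l₂, rfl, h₂⟩ := iht hr ht
      obtain ⟨l₁, rfl, h₁⟩ := iha hr ha
      rw [← List.map_append] at hq
      obtain ⟨l, rfl, hl⟩ := coh_inv hr hq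
      exact ⟨l, rfl, .letU hl h₂ h₁⟩
  | tens t a iht iha =>
    cases h with
    | tens hq ht ha =>
      obtain ⟨l₂, rfl, h₂⟩ := iht hr ht
      obtain ⟨l₁, rfl, h₁⟩ := iha hr ha
      rw [← List.map_append] at hq
      obtain ⟨l, rfl, hl⟩ := coh_inv hr hq
      exact ⟨l, rfl, .tens hl h₂ h₁⟩
  | letT t c iht ihc =>
    cases h with
    | letT hq ht hc =>
      obtain ⟨l₂, rfl, h₂⟩ := iht hr ht
      obtain ⟨m, em, h₁⟩ := ihc (lift_inj hr) hc
      obtain ⟨l₁, rfl, rfl⟩ := map_lift₂ em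
      rw [← List.map_append] at hq
      obtain ⟨l, rfl, hl⟩ := coh_inv hr hq
      exact ⟨l, rfl, .letT hl h₂ h₁⟩

end Den

/-- A morphism to the context of a base term is determined by the terms it reindexes the variables
to. -/
def Denot.JointlyMonic (𝔡 : Denot 𝔽 M) : Prop :=
  ∀ (c : 𝔽.TmC) {D : M.𝒞} (h h' : D ⟶ (𝔡.tmCtx c).D),
    (𝔡.tmCtx c).vars.map (Sec.re h) = (𝔡.tmCtx c).vars.map (Sec.re h') → h = h'

theorem comp_eq_of_inv {C : Type u} [Category.{v} C] {X Y Z W : C} {q : X ⟶ Y} {q₀ : Y ⟶ X} (h : q ≫ q₀ = 𝟙 _) {p : X ⟶ Z}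
    {q' : Z ⟶ W} {x : Y ⟶ W} (e : q₀ ≫ p ≫ q' = x) : p ≫ q' = q ≫ x := by
  rw [← e, reassoc_of% h]

section
variable {C : Type u} [Category.{v} C] [MonoidalCategory C]

/-- A change of splitting by morphisms of the two blocks may be absorbed into the subterms. The
three congruences serve both uniqueness and linear substitution. -/
theorem letU_congr {X X' A A' B B' S : C} {p : X ⟶ A ⊗ B} {P : X ⟶ X'} {p' : X' ⟶ A' ⊗ B'}
    {r : A ⟶ A'} {q : B ⟶ B'} (e : P ≫ p' = p ≫ (r ⊗ₘ q)) (g : A' ⟶ S) (f : B' ⟶ 𝟙_ C) :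
    p ≫ (r ≫ g ⊗ₘ q ≫ f) ≫ (ρ_ S).hom = P ≫ p' ≫ (g ⊗ₘ f) ≫ (ρ_ S).hom := by
  rw [reassoc_of% e, MonoidalCategory.tensorHom_comp_tensorHom_assoc]

theorem tens_congr {X X' A A' B B' S T : C} {p : X ⟶ A ⊗ B} {P : X ⟶ X'} {p' : X' ⟶ A' ⊗ B'}
    {r : A ⟶ A'} {q : B ⟶ B'} (e : P ≫ p' = p ≫ (r ⊗ₘ q)) (g : A' ⟶ S) (f : B' ⟶ T) :
    p ≫ (r ≫ g ⊗ₘ q ≫ f) = P ≫ p' ≫ (g ⊗ₘ f) := by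
  rw [reassoc_of% e, MonoidalCategory.tensorHom_comp_tensorHom]

theorem letT_congr {X X' A A' B B' S T R : C} {p : X ⟶ A ⊗ B} {P : X ⟶ X'}
    {p' : X' ⟶ A' ⊗ B'} {r : A ⟶ A'} {q : B ⟶ B'} (e : P ≫ p' = p ≫ (r ⊗ₘ q)) (f : B' ⟶ S ⊗ T)
    (g : (A' ⊗ S) ⊗ T ⟶ R) :
    p ≫ A ◁ (q ≫ f) ≫ (α_ A S T).inv ≫ r ▷ S ▷ T ≫ g =
      P ≫ p' ≫ A' ◁ f ≫ (α_ A' S T).inv ≫ g := by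
  rw [reassoc_of% e, MonoidalCategory.tensorHom_def', Category.assoc,
    ← associator_inv_naturality_left_assoc, ← whisker_exchange_assoc,
    MonoidalCategory.whiskerLeft_comp_assoc]

end

/-- Induction on the first derivation. Variables and `*` are coherence; where the context is split,
`Den.mem_iff` and `Coh.exists_tensor` relate the two splittings. The types are part of the
conclusion because the term and the context determine them. -/
theorem Den.unique {𝔡 : Denot 𝔽 M} (h𝔡 : 𝔡.JointlyMonic) {ρ : List (Sec D)} {a : Tm 𝔽}
    {l l' : List ℕ} {X X' : Tree D} {S S' : STy D} {f : X.obj ⟶ S.el} {f' : X'.obj ⟶ S'.el}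
    (h : Den 𝔡 ρ a l X S f) (h' : Den 𝔡 ρ a l' X' S' f') {p : X.obj ⟶ X'.obj}
    (hp : Coh l X l' X' p) (hl : l.Nodup) :
    (⟨S, f⟩ : Σ S : STy D, (X.obj ⟶ S.el)) = ⟨S', p ≫ f'⟩ := by
  have blocks {l l₁ l₂ l' l₁' l₂' X X₁ X₂ X' X₁' X₂' p}
      {q : X.obj ⟶ X₁.obj ⊗ X₂.obj} {q' : X'.obj ⟶ X₁'.obj ⊗ X₂'.obj} (hp : Coh (D := D) l X l' X' p)
      (hl : l.Nodup) (hq : Coh l X (l₂ ++ l₁) (.node X₁ X₂) q)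
      (hq' : Coh l' X' (l₂' ++ l₁') (.node X₁' X₂') q') (e₁ : l₁.length = X₁.leaves.length)
      (e₁' : l₁'.length = X₁'.leaves.length) (e : ∀ i, i ∈ l₁ ↔ i ∈ l₁') :
      ∃ r s, Coh l₁ X₁ l₁' X₁' r ∧ Coh l₂ X₂ l₂' X₂' s ∧ p ≫ q' = q ≫ (r ⊗ₘ s) := by
    obtain ⟨q₀, hq₀, e₀, -⟩ := hq.exists_inv
    obtain ⟨r, s, hr, hs, e⟩ := (hq₀.trans (hp.trans hq')).exists_tensor
      (hq.perm.nodup hl) e₁ e₁' e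
    exact ⟨r, s, hr, hs, comp_eq_of_inv e₀ e⟩
  induction h generalizing l' X' S' with
  | ivar hs hq =>
    cases h' with
    | ivar hs' hq' =>
      cases hs.symm.trans hs'
      obtain rfl := hq.unique (hp.trans hq') hl
      exact congrArg (Sigma.mk _) (Category.assoc _ _ _)
  | lvar hq =>
    cases h' with
    | lvar hq' =>
      -- Entries travel with their labels, so the entry labelled `j` has the same type on both
      -- sides.
      have e := (hq.perm_zip.symm.trans (hp.trans hq').perm_zip)
      simp only [Tree.leaves, List.zip_cons_cons, List.zip_nil_left, List.perm_singleton,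
        List.cons.injEq, Prod.mk.injEq, and_true, true_and] at e
      subst e
      obtain rfl := hq.unique (hp.trans hq') hl
      rfl
  | con c hs hv _ ihs ih =>
    cases h' with
    | con _ hs' hv' hb' =>
      -- The arguments denote the same sections, so joint monicity identifies the two context
      -- morphisms and with them the types of the base term.
      have e := funext fun i => (ihs i (hs' i) (.refl rfl) List.nodup_nil).trans
        (congrArg (Sigma.mk _) (Category.id_comp _))
      obtain rfl := h𝔡 c _ _ (hv.trans ((congrArg List.ofFn e).trans hv'.symm))
      cases ih hb' hp hl
      exact congrArg (Sigma.mk _) (Category.assoc _ _ _)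
  | star hq =>
    cases h' with
    | star hq' => exact congrArg (Sigma.mk _) (hq.unique (hp.trans hq') hl)
  | letU hq ht ha iht iha =>
    cases h' with
    | letU hq' ht' ha' =>
      obtain ⟨r, s, hr, hs, e⟩ := blocks hp hl hq hq' ha.length ha'.length
        (ha.mem_iff ha')
      have hl' := List.nodup_append.1 (hq.perm.nodup hl)
      cases iha ha' hr hl'.2.1
      cases iht ht' hs hl'.1
      exact congrArg (Sigma.mk _) (letU_congr e _ _)
  | tens hq ha ht iha iht =>
    cases h' with
    | tens hq' ha' ht' =>
      obtain ⟨r, s, hr, hs, e⟩ := blocks hp hl hq hq' ha.length ha'.length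
        (ha.mem_iff ha')
      have hl' := List.nodup_append.1 (hq.perm.nodup hl)
      cases iha ha' hr hl'.2.1
      cases iht ht' hs hl'.1
      exact congrArg (Sigma.mk _) (tens_congr e _ _)
  | letT hq ht hc iht ihc =>
    cases h' with
    | letT hq' ht' hc' =>
      have e₁ := hc.length
      have e₁' := hc'.length
      simp only [List.length_cons, List.length_map, Tree.leaves, List.length_append,
        List.length_nil] at e₁ e₁'
      obtain ⟨r, s, hr, hs, e⟩ := blocks hp hl hq hq' (by omega) (by omega)
        (fun i => by simpa using hc.mem_iff hc' (i + 2))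
      have hl' := List.nodup_append.1 (hq.perm.nodup hl)
      cases iht ht' hs hl'.1
      cases ihc hc' (.whiskerRight (l₂ := [0]) (.whiskerRight (l₂ := [1]) (hr.map (· + 2)) rfl) rfl)
        (by simpa [List.nodup_map_iff (add_left_injective 2)] using hl'.2.1)
      exact congrArg (Sigma.mk _) (letT_congr e _ _)

end ILDTT

namespace ILDTT
open Model

/-! ### Comparison of the two interpretations of terms -/

variable {𝔽 : Symbols.{w}} {M : Model.{v₁, u₁, v, u}} {D : M.𝒞}

/-- With an empty accumulator, flattening a list is just the left unitor together with the equation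
`X ++ [] = X`. -/
theorem split_nil (X : List (STy D)) :
    (split [] X).hom ≫ (λ_ (linObj X)).hom = eqToHom (by rw [List.append_nil]) := by
  induction X with
  | nil => 
    have key {C : Type u} [Category.{v} C] [MonoidalCategory C] :
      (ρ_ (𝟙_ C)).symm.hom ≫ (λ_ (𝟙_ C)).hom = 𝟙 _ := by simp [unitors_equal]
    exact key
  | cons S X ih =>
    have key {C : Type u} [Category.{v} C] [MonoidalCategory C] {F P S : C} {e : F ≅ 𝟙_ C ⊗ P}
      {h : F = P} (ih : e.hom ≫ (λ_ P).hom = eqToHom h) :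
      (whiskerRightIso e S ≪≫ α_ _ _ _).hom ≫ (λ_ (P ⊗ S)).hom = eqToHom (by rw [h]) := by
      subst h
      simp only [eqToHom_refl] at ih ⊢
      simp only [Iso.trans_hom, whiskerRightIso_hom, leftUnitor_tensor_hom, Category.assoc,
        Iso.hom_inv_id_assoc]
      rw [← comp_whiskerRight, ih, id_whiskerRight]
    exact key ih

/-- A canonical morphism between lists is itself a composite of adjacent transpositions, which the
exchange rule of `ITm` can realise one at a time. -/
theorem Coh.reord_lst {l l' : List ℕ} {X X' : List (STy D)} {p : linObj X ⟶ linObj X'}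
    (h : Coh l (.lst X) l' (.lst X') p) : Reord l X l' X' p := by
  have cast {l l' : List ℕ} {X X' Y Y' : List (STy D)} {p : linObj X ⟶ linObj X'}
      (h : Reord l X l' X' p) (e : X = Y) (e' : X' = Y') :
      Reord l Y l' Y' (eqToHom (by rw [e]) ≫ p ≫ eqToHom (by rw [e'])) := by
    subst e e'
    simpa using h
  have := cast (h.reord (m := []) (acc := []) rfl) (List.append_nil X) (List.append_nil X')
  simp only [List.append_nil] at this
  refine this.of_eq ?_
  have key {C : Type u} [Category.{v} C] [MonoidalCategory C] {P P' F F' : C} {e : F ≅ 𝟙_ C ⊗ P}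
      {e' : F' ≅ 𝟙_ C ⊗ P'} {h : F = P} {h' : F' = P'} (ih : e.hom ≫ (λ_ P).hom = eqToHom h)
      (ih' : e'.hom ≫ (λ_ P').hom = eqToHom h') (p : P ⟶ P') :
      p = eqToHom h.symm ≫ (e.symm.inv ≫ 𝟙_ C ◁ p ≫ e'.symm.hom) ≫ eqToHom h' := by
    subst h h'
    simp only [eqToHom_refl] at ih ih' ⊢
    have i : e.hom = (λ_ F).inv := by
      rw [← Category.comp_id e.hom, ← (λ_ F).hom_inv_id, reassoc_of% ih]
    have i' : e'.inv = (λ_ F').hom := by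
      rw [← Category.comp_id e'.inv, ← ih', Iso.inv_hom_id_assoc]
    simp [i, i']
  exact key (split_nil X) (split_nil X') p

theorem Coh.exists_lst_iso {l : List ℕ} {X : Tree D} (h : l.length = X.leaves.length) :
    ∃ (Y : List (STy D)) (u : X.obj ⟶ linObj Y) (u' : linObj Y ⟶ X.obj),
      Coh l X l (.lst Y) u ∧ Coh l (.lst Y) l X u' ∧ u ≫ u' = 𝟙 _ ∧ l.length = Y.length := by
  obtain ⟨u, hu⟩ := Coh.exists_lst X h
  obtain ⟨u', hu', e, -⟩ := hu.exists_inv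
  exact ⟨_, u, u', hu, hu', e, h⟩

theorem map_range_of_append {l₁ l₂ : List ℕ} {r : ℕ → ℕ}
    (h : (l₂ ++ l₁).map r = List.range (l₂ ++ l₁).length) :
    l₂.map r = List.range l₂.length ∧ l₁.map r = (List.range l₁.length).map (l₂.length + ·) := by
  rw [List.map_append, List.length_append, List.range_add] at h
  exact List.append_inj h (by simp)

theorem range_succ_succ (n : ℕ) : List.range (n + 2) = 0 :: 1 :: (List.range n).map (· + 2) := by
  rw [List.range_succ_eq_map, List.range_succ_eq_map]
  simp [Function.comp_def]

section
variable {C : Type u} [Category.{v} C] [MonoidalCategory C]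

/-- The rules of `ITm` accept only lists as contexts, so each block is turned into a list (`u`,
`v`), which the subterms undo (`u'`, `v'`). -/
theorem letU_conj {Z X A B A' B' F S : C} {z : Z ⟶ X} {q : X ⟶ A ⊗ B}
    {u : A ⟶ A'} {u' : A' ⟶ A} {v : B ⟶ B'}
    {v' : B' ⟶ B} (hu : u ≫ u' = 𝟙 _) (hv : v ≫ v' = 𝟙 _) (e : F ≅ A' ⊗ B') (g : A ⟶ S)
    (f : B ⟶ 𝟙_ C) : z ≫ q ≫ (g ⊗ₘ f) ≫ (ρ_ S).hom =
      (z ≫ q ≫ (u ⊗ₘ v) ≫ e.inv) ≫ e.hom ≫ (u' ≫ g ⊗ₘ v' ≫ f) ≫ (ρ_ S).hom := by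
  simp [reassoc_of% hu, reassoc_of% hv]

theorem tens_conj {Z X A B A' B' F S T : C} {z : Z ⟶ X} {q : X ⟶ A ⊗ B} {u : A ⟶ A'} {u' : A' ⟶ A}
    {v : B ⟶ B'} {v' : B' ⟶ B} (hu : u ≫ u' = 𝟙 _) (hv : v ≫ v' = 𝟙 _) (e : F ≅ A' ⊗ B')
    (g : A ⟶ S) (f : B ⟶ T) : z ≫ q ≫ (g ⊗ₘ f) =
      (z ≫ q ≫ (u ⊗ₘ v) ≫ e.inv) ≫ e.hom ≫ (u' ≫ g ⊗ₘ v' ≫ f) := by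
  simp [reassoc_of% hu, reassoc_of% hv]

/-- The rule `ITm.letT` has the context of the scrutinee as its left factor, whereas `Den.letT` has
it as the right one; hence the braiding. -/
theorem letT_conj [SymmetricCategory C] {Z X A B A' B' F S T R : C} {z : Z ⟶ X} {q : X ⟶ A ⊗ B} {u : A ⟶ A'}
    {u' : A' ⟶ A} {v : B ⟶ B'} {v' : B' ⟶ B} (hu : u ≫ u' = 𝟙 _) (hv : v ≫ v' = 𝟙 _)
    (e : F ≅ B' ⊗ A') (f : B ⟶ S ⊗ T) (g : (A ⊗ S) ⊗ T ⟶ R) :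
    z ≫ q ≫ A ◁ f ≫ (α_ A S T).inv ≫ g =
      (z ≫ q ≫ (β_ A B).hom ≫ (v ⊗ₘ u) ≫ e.inv) ≫ e.hom ≫ (β_ B' A').hom ≫ A' ◁ (v' ≫ f) ≫
        (α_ A' S T).inv ≫ u' ▷ S ▷ T ≫ g := by
  simp only [Category.assoc, Iso.inv_hom_id_assoc, BraidedCategory.braiding_naturality_assoc,
    SymmetricCategory.symmetry_assoc, MonoidalCategory.whiskerLeft_comp_assoc]
  rw [MonoidalCategory.tensorHom_def_assoc, ← MonoidalCategory.whiskerLeft_comp_assoc, hv,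
    MonoidalCategory.whiskerLeft_id, Category.id_comp, ← whisker_exchange_assoc,
    associator_inv_naturality_left_assoc, ← comp_whiskerRight_assoc, ← comp_whiskerRight, hu]
  simp

end

theorem map_swapAt_range (k : ℕ) : (List.range k).map (swapAt k) = List.range k := by
  refine (List.map_congr_left fun j hj => ?_).trans (List.map_id _)
  have := List.mem_range.1 hj
  simp only [swapAt, id]
  grind

theorem map_swapAt_map_range (k n : ℕ) : (List.range n).map (fun j => swapAt k (k + (j + 2))) =
    (List.range n).map (fun j => k + (j + 2)) := by
  refine List.map_congr_left fun j hj => ?_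
  simp only [swapAt]
  grind

theorem swapAt_self (k : ℕ) : swapAt k k = k + 1 := by simp [swapAt]

theorem swapAt_succ (k : ℕ) : swapAt k (k + 1) = k := by simp [swapAt]

theorem range_add_succ_succ (k n : ℕ) : List.range (k + (n + 2)) =
    List.range k ++ k :: (k + 1) :: (List.range n).map (fun j => k + (j + 2)) := by
  simp [List.range_add, range_succ_succ, Function.comp_def]

variable {𝔡 : Denot 𝔽 M} {ρ : List (Sec D)}

/-- The rules for term formers are instances of those of `Den`, with `letT` corrected by a braiding.
Exchange is a renaming of the labels followed by a canonical morphism. -/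
theorem ITm.den {X : List (STy D)} {a : Tm 𝔽} {S : STy D} {f : linObj X ⟶ S.el}
    (h : ITm 𝔡 ρ X a S f) : Den 𝔡 ρ a (List.range X.length) (.lst X) S f := by
  have split_range (X X' : List (STy D)) : Coh (List.range (X' ++ X).length) (.lst (X' ++ X))
      (List.range X'.length ++ (List.range X.length).map (· + X'.length))
        (.node (.lst X) (.lst X')) (split X X').hom := by
    rw [List.length_append, List.range_add]
    simp only [Nat.add_comm X'.length]
    exact .split (by simp) (by simp)
  induction h with
  | ivar hs => exact .of_eq (.ivar hs (.refl rfl)) (Category.id_comp _).symm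
  | lvar =>
    exact .lvar ((Coh.trans (.cons rfl) (.leftUnitor rfl)).of_eq (Category.id_comp _).symm)
  | con c _ hv _ ihs ih => exact .con c ihs hv ih
  | star => exact .star (.refl rfl)
  | letU _ _ ht ha => exact .letU (split_range _ _) ht (ha.lren _)
  | tens _ _ ha hb => exact .tens (split_range _ _) (ha.lren _) hb
  | @letT X X' _ _ S T _ _ _ _ _ ht hc =>
    have h : Coh _ (.lst (X' ++ X)) (_ ++ _) _ _ :=
      (split_range X X').trans (.braid (by simp [Tree.leaves]) (by simp [Tree.leaves]))
    refine .of_eq (.letT h (ht.lren _) ?_) (Category.assoc _ _ _).symm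
    rw [← range_succ_succ]
    have h₁ : Coh (1 :: (List.range X'.length).map (· + 2)) (.node (.lst X') (.leaf S)) _
      (.lst (S :: X')) _ := .uncons (by simp)
    have h₂ : Coh (List.range (X'.length + 2)) (.node (.lst (S :: X')) (.leaf T)) _
      (.lst (T :: S :: X')) _ := .uncons (by simp)
    have h₃ := h₁.whiskerRight (l₂ := [0]) (B := .leaf T) rfl
    rw [List.singleton_append, ← range_succ_succ] at h₃
    refine .of_eq (hc.coh (h₃.trans h₂)) ?_
    have key {C : Type u} [Category.{v} C] [MonoidalCategory C] {A B S : C} (g : A ⊗ B ⟶ S) :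
      g = ((𝟙 A) ▷ B ≫ 𝟙 _) ≫ g := by simp
    exact key _
  | @exch X X' S S' _ _ _ _ h =>
    have := h.lren (swapAt X'.length)
    simp only [List.length_append, List.length_cons, range_add_succ_succ, List.map_append,
      List.map_cons, map_swapAt_range, List.map_map, Function.comp_def, map_swapAt_map_range,
      swapAt_self, swapAt_succ] at this ⊢
    exact this.coh (.exMor _ _ _ _ _ _ (by simp) (by simp))

theorem ITm.of_eq {a : Tm 𝔽} {X : List (STy D)} {S : STy D} {f g : linObj X ⟶ S.el}
    (h : ITm 𝔡 ρ X a S f) (e : g = f) : ITm 𝔡 ρ X a S g := e ▸ h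

/-- Here `r` sends labels to positions. The statement quantifies over `r` because each
transposition, realised by one exchange, replaces `r` by its composite with `swapAt`. -/
theorem ITm.of_coh {a : Tm 𝔽} {l l' : List ℕ} {X X' : List (STy D)} {S : STy D}
    {p : linObj X ⟶ linObj X'} (h : Coh l (.lst X) l' (.lst X') p) {f : linObj X' ⟶ S.el}
    (hf : ∀ r : ℕ → ℕ, l'.map r = List.range l'.length → ITm 𝔡 ρ X' (a.lren r) S f) (r : ℕ → ℕ)
    (hr : l.map r = List.range l.length) : ITm 𝔡 ρ X (a.lren r) S (p ≫ f) := by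
  replace h := h.reord_lst
  induction h generalizing r with
  | refl => rw [Category.id_comp]; exact hf r hr
  | @step i j l X S S' _ _ l₁ X₁ _ e _ ih =>
    have h : ITm 𝔡 ρ _ _ _ _ := .exch (ih hf (swapAt l₁.length ∘ r) ?_)
    · rw [Tm.lren_lren, ← e] at h
      rw [Category.assoc]
      convert h using 2
      funext j
      simp [swapAt_swapAt]
    · obtain ⟨h₁, h₂⟩ := map_range_of_append hr
      simp only [List.map_cons, List.length_cons, range_succ_succ, List.cons.injEq,
        List.map_map, Function.comp_def, Nat.add_zero] at h₂
      obtain ⟨hi, hj, h₂⟩ := h₂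
      simp only [List.length_append, List.length_cons, range_add_succ_succ, List.map_append,
        List.map_cons, ← List.map_map, h₁, h₂, map_swapAt_range]
      simp only [List.map_map, Function.comp_def, map_swapAt_map_range, hi, hj, swapAt_self,
        swapAt_succ]

theorem map_sub_of_map {l : List ℕ} {m : ℕ} {r : ℕ → ℕ}
    (h : l.map r = (List.range l.length).map (m + ·)) :
    l.map (fun j => r j - m) = List.range l.length := by
  have := congrArg (List.map (· - m)) h
  simpa [Function.comp_def] using this

/-- The older block of a split context occupies the positions from `m` on. On the free variables of
a term over it, `r` is thus a shift by `m` after a renaming into initial positions, as the rules of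
`ITm` require. -/
theorem Den.lren_eq_lshift {a : Tm 𝔽} {l : List ℕ} {X : Tree D} {S : STy D} {f : X.obj ⟶ S.el}
    (ha : Den 𝔡 ρ a l X S f) {m : ℕ} {r : ℕ → ℕ}
    (h : l.map r = (List.range l.length).map (m + ·)) {n : ℕ} (e : m = n) :
    a.lren r = (a.lren fun j => r j - m).lshift n := by
  subst e
  rw [Tm.lshift, Tm.lren_lren]
  refine ha.lren_congr fun j hj => ?_
  have := h ▸ List.mem_map_of_mem (f := r) hj
  obtain ⟨k, -, hk⟩ := List.mem_map.1 this
  simp only [Function.comp_apply]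
  omega

/-- The converse of `ITm.den`, with `r` translating labels into de Bruijn indices. At each splitting
the blocks are put into list form, the rule of `ITm` is applied, and the canonical morphism left
over is realised by `ITm.of_coh`. -/
theorem Den.itm {a : Tm 𝔽} {l : List ℕ} {X : Tree D} {S : STy D} {f : X.obj ⟶ S.el}
    (h : Den 𝔡 ρ a l X S f) {l₀ : List ℕ} {Y : List (STy D)} {q : linObj Y ⟶ X.obj}
    (hq : Coh l₀ (.lst Y) l X q) (r : ℕ → ℕ) (hr : l₀.map r = List.range l₀.length) :
    ITm 𝔡 ρ Y (a.lren r) S (q ≫ f) := by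
  induction h generalizing l₀ Y r with
  | ivar hs hp =>
    have := ITm.of_coh (hq.trans hp) (a := .ivar _) (𝔡 := 𝔡) (fun _ _ => .ivar hs) r hr
    exact this.of_eq (Category.assoc _ _ _).symm
  | @lvar j _ _ S p hp =>
    have h : Coh l₀ (.lst Y) [j] (.lst [S]) _ :=
      hq.trans (hp.trans (.trans (.leftUnitorInv rfl) (.uncons rfl)))
    have h' (r : ℕ → ℕ) (hr : [j].map r = List.range [j].length) :
        ITm 𝔡 ρ [S] ((Tm.lvar j).lren r) S (λ_ _).hom := by
      have e : (Tm.lvar j : Tm 𝔽).lren r = .lvar 0 := by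
        simpa [Tm.lren] using hr
      rw [e]
      exact .lvar
    have := ITm.of_coh h h' r hr
    convert this using 1
    have key {C : Type u} [Category.{v} C] [MonoidalCategory C] {A B S : C} (q : A ⟶ B)
      (p : B ⟶ S) : q ≫ p = (q ≫ p ≫ (λ_ S).inv ≫ 𝟙 (𝟙_ C ⊗ S)) ≫ (λ_ S).hom := by simp
    exact key _ _
  | con c hs hv _ ihs ih =>
    rw [← Category.assoc]
    refine .con c (fun i => ?_) hv (ih hq r hr)
    have := ihs i (l₀ := []) (.refl rfl) id rfl
    rw [Tm.lren_id] at this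
    exact this.of_eq (Category.id_comp _).symm
  | star hp =>
    have := ITm.of_coh (hq.trans hp) (a := .star) (S := .unit) (𝔡 := 𝔡) (ρ := ρ) (fun _ _ => .star) r hr
    exact this.of_eq (Category.comp_id _).symm
  | @letU l l₁ l₂ X X₁ X₂ t a S p f g hp ht ha iht iha =>
    obtain ⟨Y₁, u, u', hu, hu', e, k₁⟩ := Coh.exists_lst_iso ha.length
    obtain ⟨Y₂, v, v', hv, hv', e', k₂⟩ := Coh.exists_lst_iso ht.length
    have h := hq.trans (hp.trans ((hu.tensor hv).trans (.splitInv hu.length.2 hv.length.2)))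
    refine (ITm.of_coh h (f := (split Y₁ Y₂).hom ≫ (u' ≫ g ⊗ₘ v' ≫ f) ≫ (ρ_ S.el).hom)
      (fun r hr => ?_) r hr).of_eq ?_
    · obtain ⟨h₁, h₂⟩ := map_range_of_append hr
      have := ITm.letU (iht hv' r h₁) (iha hu' (fun j => r j - l₂.length) (map_sub_of_map h₂))
      rwa [← ha.lren_eq_lshift h₂ k₂] at this
    · exact letU_conj e e' (split Y₁ Y₂) g f
  | @tens l l₁ l₂ X X₁ X₂ a b S T p f g hp ha ht iha iht =>
    obtain ⟨Y₁, u, u', hu, hu', e, k₁⟩ := Coh.exists_lst_iso ha.length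
    obtain ⟨Y₂, v, v', hv, hv', e', k₂⟩ := Coh.exists_lst_iso ht.length
    have h := hq.trans (hp.trans ((hu.tensor hv).trans (.splitInv hu.length.2 hv.length.2)))
    refine (ITm.of_coh h (S := .tensor S T) (f := (split Y₁ Y₂).hom ≫ (u' ≫ f ⊗ₘ v' ≫ g))
      (fun r hr => ?_) r hr).of_eq ?_
    · obtain ⟨h₁, h₂⟩ := map_range_of_append hr
      have := ITm.tens (iha hu' (fun j => r j - l₂.length) (map_sub_of_map h₂)) (iht hv' r h₁)
      rwa [← ha.lren_eq_lshift h₂ k₂] at this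
    · exact tens_conj e e' (split Y₁ Y₂) f g
  | @letT l l₁ l₂ X X₁ X₂ t c S T R p f g hp ht hc iht ihc =>
    have hl : l₁.length = X₁.leaves.length := by
      have := hc.length
      simp only [List.length_cons, List.length_map, Tree.leaves, List.length_append,
        List.length_nil] at this
      omega
    obtain ⟨Y₁, u, u', hu, hu', e, k₁⟩ := Coh.exists_lst_iso hl
    obtain ⟨Y₂, v, v', hv, hv', e', k₂⟩ := Coh.exists_lst_iso ht.length
    have h := hq.trans (hp.trans ((Coh.braid hl ht.length).trans ((hv.tensor hu).trans
      (.splitInv hv.length.2 hu.length.2))))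
    refine (ITm.of_coh h (f := (split Y₂ Y₁).hom ≫ (β_ (linObj Y₂) (linObj Y₁)).hom ≫
      linObj Y₁ ◁ (v' ≫ f) ≫ (α_ (linObj Y₁) S.el T.el).inv ≫ u' ▷ S.el ▷ T.el ≫ g)
      (fun r hr => ?_) r hr).of_eq ?_
    · obtain ⟨h₁, h₂⟩ := map_range_of_append hr
      have hc' : Coh (0 :: 1 :: l₁.map (· + 2)) (.lst (T :: S :: Y₁)) (0 :: 1 :: l₁.map (· + 2))
          (.node (.node X₁ (.leaf S)) (.leaf T)) (u' ▷ S.el ▷ T.el) := by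
        have h₁ : Coh (1 :: l₁.map (· + 2)) (.lst (S :: Y₁)) _ (.node (.lst Y₁) (.leaf S)) _ :=
          .cons (by simpa using k₁)
        have h₂ : Coh (0 :: 1 :: l₁.map (· + 2)) (.lst (T :: S :: Y₁)) _
          (.node (.lst (S :: Y₁)) (.leaf T)) _ := .cons (by simpa using k₁)
        refine (h₂.trans (.trans (.whiskerRight (l₂ := [0]) h₁ rfl) (.whiskerRight (l₂ := [0])
          (.whiskerRight (l₂ := [1]) (hu'.map (· + 2)) rfl) rfl))).of_eq ?_
        have key {C : Type u} [Category.{v} C] [MonoidalCategory C] {A B S T : C} (u : A ⟶ B) :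
          u ▷ S ▷ T = 𝟙 _ ≫ 𝟙 _ ▷ T ≫ u ▷ S ▷ T := by simp
        exact key _
      have := ITm.letT (iht hv' (fun j => r j - l₁.length) (map_sub_of_map h₂))
        (ihc hc' (Tm.lift₂ r) (by simp [Tm.lift₂, range_succ_succ, ← h₁, Function.comp_def]))
      rwa [← ht.lren_eq_lshift h₂ k₁] at this
    · exact letT_conj e e' (split Y₂ Y₁) f g

end ILDTT

namespace ILDTT
open Model

/-! ## Reindexing -/

section
variable {C : Type*} [Category* C] {E : Type*} [Category* E] (F : C ⥤ E)

/-- Conjugation by chosen isomorphisms `B ≅ F.obj A` is functorial. The image of a composite of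
structural morphisms can therefore be computed factor by factor, which is the pattern of all the
identities below. -/
theorem map_conj_comp {A₁ A₂ A₃ : C} {B₁ B₂ B₃ : E} (a₁ : B₁ ≅ F.obj A₁) (a₂ : B₂ ≅ F.obj A₂)
    (a₃ : B₃ ≅ F.obj A₃) (p : A₁ ⟶ A₂) (q : A₂ ⟶ A₃) :
    a₁.hom ≫ F.map (p ≫ q) ≫ a₃.inv =
      (a₁.hom ≫ F.map p ≫ a₂.inv) ≫ a₂.hom ≫ F.map q ≫ a₃.inv := by simp

theorem map_conj_id {A : C} {B : E} (a : B ≅ F.obj A) : a.hom ≫ F.map (𝟙 A) ≫ a.inv = 𝟙 _ := by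
  simp

end

section
open Functor.LaxMonoidal Functor.OplaxMonoidal Functor.Monoidal
variable {C : Type*} [Category* C] [MonoidalCategory C] [SymmetricCategory C]
  {E : Type*} [Category* E] [MonoidalCategory E] [SymmetricCategory E] (F : C ⥤ E) [F.Braided]

theorem map_conj_tensor {A A' B B' : C} {A₁ A₁' B₁ B₁' : E} (a : A₁ ≅ F.obj A)
    (a' : A₁' ≅ F.obj A') (b : B₁ ≅ F.obj B) (b' : B₁' ≅ F.obj B') (p : A ⟶ A') (q : B ⟶ B') :
    ((a ⊗ᵢ b) ≪≫ μIso F A B).hom ≫ F.map (p ⊗ₘ q) ≫ ((a' ⊗ᵢ b') ≪≫ μIso F A' B').inv =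
      (a.hom ≫ F.map p ≫ a'.inv) ⊗ₘ (b.hom ≫ F.map q ≫ b'.inv) := by
  simp only [Iso.trans_hom, tensorIso_hom, μIso_hom, Iso.trans_inv, tensorIso_inv, μIso_inv,
    Category.assoc]
  rw [← Functor.LaxMonoidal.μ_natural_assoc, μ_δ_assoc,
    MonoidalCategory.tensorHom_comp_tensorHom_assoc, MonoidalCategory.tensorHom_comp_tensorHom]
  simp only [Category.assoc]

theorem map_conj_whiskerRight {A A' B : C} {A₁ A₁' B₁ : E} (a : A₁ ≅ F.obj A) (a' : A₁' ≅ F.obj A')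
    (b : B₁ ≅ F.obj B) (p : A ⟶ A') :
    ((a ⊗ᵢ b) ≪≫ μIso F A B).hom ≫ F.map (p ▷ B) ≫ ((a' ⊗ᵢ b) ≪≫ μIso F A' B).inv =
      (a.hom ≫ F.map p ≫ a'.inv) ▷ B₁ := by
  rw [← tensorHom_id, map_conj_tensor, map_conj_id, tensorHom_id]

theorem map_conj_whiskerLeft {A B B' : C} {A₁ B₁ B₁' : E} (a : A₁ ≅ F.obj A) (b : B₁ ≅ F.obj B)
    (b' : B₁' ≅ F.obj B') (p : B ⟶ B') :
    ((a ⊗ᵢ b) ≪≫ μIso F A B).hom ≫ F.map (A ◁ p) ≫ ((a ⊗ᵢ b') ≪≫ μIso F A B').inv =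
      A₁ ◁ (b.hom ≫ F.map p ≫ b'.inv) := by
  rw [← id_tensorHom, map_conj_tensor, map_conj_id, id_tensorHom]

theorem map_conj_associator {A₁ A₂ A₃ : C} {B₁ B₂ B₃ : E} (a₁ : B₁ ≅ F.obj A₁)
    (a₂ : B₂ ≅ F.obj A₂) (a₃ : B₃ ≅ F.obj A₃) :
    ((((a₁ ⊗ᵢ a₂) ≪≫ μIso F _ _) ⊗ᵢ a₃) ≪≫ μIso F _ _).hom ≫ F.map (α_ A₁ A₂ A₃).hom ≫
      ((a₁ ⊗ᵢ ((a₂ ⊗ᵢ a₃) ≪≫ μIso F _ _)) ≪≫ μIso F _ _).inv = (α_ B₁ B₂ B₃).hom := by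
  rw [← Category.assoc, Iso.comp_inv_eq]
  simp only [Iso.trans_hom, tensorIso_hom, μIso_hom, Category.assoc]
  have h := Functor.LaxMonoidal.associativity (F := F) A₁ A₂ A₃
  have h₁ : ((a₁.hom ⊗ₘ a₂.hom) ≫ μ F A₁ A₂) ⊗ₘ a₃.hom =
      ((a₁.hom ⊗ₘ a₂.hom) ⊗ₘ a₃.hom) ≫ μ F A₁ A₂ ▷ F.obj A₃ := by
    rw [← tensorHom_id, MonoidalCategory.tensorHom_comp_tensorHom, Category.comp_id]
  have h₂ : a₁.hom ⊗ₘ ((a₂.hom ⊗ₘ a₃.hom) ≫ μ F A₂ A₃) =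
      (a₁.hom ⊗ₘ (a₂.hom ⊗ₘ a₃.hom)) ≫ F.obj A₁ ◁ μ F A₂ A₃ := by
    rw [← id_tensorHom, MonoidalCategory.tensorHom_comp_tensorHom, Category.comp_id]
  rw [h₁, h₂, Category.assoc, Category.assoc, h, associator_naturality_assoc]

theorem map_conj_associator_inv {A₁ A₂ A₃ : C} {B₁ B₂ B₃ : E} (a₁ : B₁ ≅ F.obj A₁)
    (a₂ : B₂ ≅ F.obj A₂) (a₃ : B₃ ≅ F.obj A₃) :
    ((a₁ ⊗ᵢ ((a₂ ⊗ᵢ a₃) ≪≫ μIso F _ _)) ≪≫ μIso F _ _).hom ≫ F.map (α_ A₁ A₂ A₃).inv ≫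
      ((((a₁ ⊗ᵢ a₂) ≪≫ μIso F _ _) ⊗ᵢ a₃) ≪≫ μIso F _ _).inv = (α_ B₁ B₂ B₃).inv := by
  rw [← cancel_mono (α_ B₁ B₂ B₃).hom, Iso.inv_hom_id, ← map_conj_associator F a₁ a₂ a₃,
    ← map_conj_comp, Iso.inv_hom_id, map_conj_id]

theorem map_conj_leftUnitor {A : C} {B : E} (a : B ≅ F.obj A) :
    (((εIso F) ⊗ᵢ a) ≪≫ μIso F _ _).hom ≫ F.map (λ_ A).hom ≫ a.inv = (λ_ B).hom := by
  rw [← Category.assoc, Iso.comp_inv_eq]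
  simp only [Iso.trans_hom, tensorIso_hom, μIso_hom, εIso_hom, Category.assoc]
  rw [MonoidalCategory.tensorHom_def', Category.assoc, ← Functor.LaxMonoidal.left_unitality, leftUnitor_naturality]

theorem map_conj_rightUnitor {A : C} {B : E} (a : B ≅ F.obj A) :
    ((a ⊗ᵢ (εIso F)) ≪≫ μIso F _ _).hom ≫ F.map (ρ_ A).hom ≫ a.inv = (ρ_ B).hom := by
  rw [← Category.assoc, Iso.comp_inv_eq]
  simp only [Iso.trans_hom, tensorIso_hom, μIso_hom, εIso_hom, Category.assoc]
  rw [MonoidalCategory.tensorHom_def, Category.assoc, ← Functor.LaxMonoidal.right_unitality, rightUnitor_naturality]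

theorem map_conj_leftUnitor_inv {A : C} {B : E} (a : B ≅ F.obj A) :
    a.hom ≫ F.map (λ_ A).inv ≫ (((εIso F) ⊗ᵢ a) ≪≫ μIso F _ _).inv = (λ_ B).inv := by
  rw [← cancel_mono (λ_ B).hom, Iso.inv_hom_id, ← map_conj_leftUnitor F a, ← map_conj_comp,
    Iso.inv_hom_id, map_conj_id]

theorem map_conj_rightUnitor_inv {A : C} {B : E} (a : B ≅ F.obj A) :
    a.hom ≫ F.map (ρ_ A).inv ≫ ((a ⊗ᵢ (εIso F)) ≪≫ μIso F _ _).inv = (ρ_ B).inv := by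
  rw [← cancel_mono (ρ_ B).hom, Iso.inv_hom_id, ← map_conj_rightUnitor F a, ← map_conj_comp,
    Iso.inv_hom_id, map_conj_id]

theorem map_conj_braiding {A A' : C} {B B' : E} (a : B ≅ F.obj A) (a' : B' ≅ F.obj A') :
    ((a ⊗ᵢ a') ≪≫ μIso F _ _).hom ≫ F.map (β_ A A').hom ≫ ((a' ⊗ᵢ a) ≪≫ μIso F _ _).inv =
      (β_ B B').hom := by
  rw [← Category.assoc, Iso.comp_inv_eq]
  simp only [Iso.trans_hom, tensorIso_hom, μIso_hom, Category.assoc]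
  rw [Functor.LaxBraided.braided, BraidedCategory.braiding_naturality_assoc]

end

variable {M : Model.{v₁, u₁, v, u}} {D D' : M.𝒞}

def Tree.re (w : D' ⟶ D) : Tree D → Tree D'
  | lst X => lst (X.map (STy.re w))
  | leaf S => leaf (S.re w)
  | node A B => node (A.re w) (B.re w)

/-- The canonical isomorphism between the object of `X{w}` and the reindexed object of `X`. -/
def Tree.reIso (w : D' ⟶ D) : (X : Tree D) → ((X.re w).obj ≅ (Model.re w).obj X.obj)
  | lst X => linReIso w X
  | leaf S => S.reIso w
  | node A B => (A.reIso w ⊗ᵢ B.reIso w) ≪≫ Functor.Monoidal.μIso (Model.re w) A.obj B.obj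

theorem Tree.length_leaves_re (w : D' ⟶ D) (X : Tree D) :
    (X.re w).leaves.length = X.leaves.length := by
  induction X with
  | lst X => simp [leaves, re]
  | leaf => rfl
  | node A B hA hB => simp [leaves, re, hA, hB]

/-- One axiom or naturality property of symmetric monoidal functors for each generator. Labels are
not affected by reindexing. -/
theorem Coh.re (w : D' ⟶ D) {l l' : List ℕ} {X X' : Tree D} {p : X.obj ⟶ X'.obj}
    (h : Coh l X l' X' p) :
    Coh l (X.re w) l' (X'.re w) ((X.reIso w).hom ≫ (Model.re w).map p ≫ (X'.reIso w).inv) := by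
  have tl := Tree.length_leaves_re w
  induction h with
  | @refl l X e => exact .of_eq (.refl (by rw [tl, e])) (map_conj_id _ _)
  | trans _ _ h h' => exact .of_eq (.trans h h') (map_conj_comp _ _ _ _ _ _)
  | whiskerRight _ e h =>
    exact .of_eq (.whiskerRight h (by rw [tl, e])) (map_conj_whiskerRight _ _ _ _ _)
  | whiskerLeft e _ h =>
    exact .of_eq (.whiskerLeft (by rw [tl, e]) h) (map_conj_whiskerLeft _ _ _ _ _)
  | assoc e => exact .of_eq (.assoc (by rw [tl, tl, tl, e])) (map_conj_associator _ _ _ _)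
  | assocInv e => exact .of_eq (.assocInv (by rw [tl, tl, tl, e])) (map_conj_associator_inv _ _ _ _)
  | leftUnitor e => exact .of_eq (.leftUnitor (by rw [tl, e])) (map_conj_leftUnitor _ _)
  | leftUnitorInv e => exact .of_eq (.leftUnitorInv (by rw [tl, e])) (map_conj_leftUnitor_inv _ _)
  | rightUnitor e => exact .of_eq (.rightUnitor (by rw [tl, e])) (map_conj_rightUnitor _ _)
  | rightUnitorInv e => exact .of_eq (.rightUnitorInv (by rw [tl, e])) (map_conj_rightUnitor_inv _ _)
  | swap i j S T => exact .of_eq (.swap i j _ _) (map_conj_braiding _ _ _)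
  | @cons l S X e =>
    exact .of_eq (.cons (S := S.re w) (X := X.map (STy.re w)) (by simpa using e))
      (map_conj_id (Model.re w) (linReIso w (S :: X)))
  | @uncons l S X e =>
    exact .of_eq (.uncons (S := S.re w) (X := X.map (STy.re w)) (by simpa using e))
      (map_conj_id (Model.re w) (linReIso w (S :: X)))

end ILDTT

namespace ILDTT
open Model

/-! ## Strictness of reindexing -/

variable {M : Model.{v₁, u₁, v, u}} {D D' D'' : M.𝒞}

namespace STy

/-- The image of a semantic type under a symmetric monoidal functor between fibres. -/
def along (F : M.L.obj (op D) ⟶ M.L.obj (op D')) : STy D → STy D'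
  | base X => base (SMHom.functor F |>.obj X)
  | unit => unit
  | tensor S T => tensor (S.along F) (T.along F)

-- The analogue of `reIso` for an arbitrary morphism between fibres. Equations such as the
-- functoriality of `L` can be substituted only when this morphism is a variable, which it is not in
-- `STy.re`.
open Functor.Monoidal in
def alongIso (F : M.L.obj (op D) ⟶ M.L.obj (op D')) :
    (S : STy D) → ((S.along F).el ≅ (SMHom.functor F).obj S.el)
  | base _ => Iso.refl _
  | unit => εIso (SMHom.functor F)
  | tensor S T => (S.alongIso F ⊗ᵢ T.alongIso F) ≪≫ μIso (SMHom.functor F) S.el T.el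

/-- Semantic types with an isomorphism from their object to `A`. -/
abbrev Pres (A : M.fib D) : Type max u v := Σ S : STy D, (S.el ≅ A)

def Pres.tensor {A B C : M.fib D} (P : Pres A) (Q : Pres B) (e : A ⊗ B ≅ C) : Pres C :=
  ⟨.tensor P.1 Q.1, (P.2 ⊗ᵢ Q.2) ≪≫ e⟩

/-- Like `Pres.tensor`, a function of whole presentations: when a presentation is replaced by an
equal one, the type and its isomorphism change together and no transport appears. -/
def Pres.conj {A B : M.fib D} (P : Pres A) (Q : Pres B) (k : A ⟶ B) :
    Σ S T : STy D, (S.el ⟶ T.el) :=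
  ⟨P.1, Q.1, P.2.hom ≫ k ≫ Q.2.inv⟩

theorem re_eq_along (w : D' ⟶ D) (S : STy D) :
    (⟨S.re w, S.reIso w⟩ : Pres ((Model.re w).obj S.el)) =
      ⟨S.along (M.L.map w.op), S.alongIso (M.L.map w.op)⟩ := by
  induction S with
  | base | unit => rfl
  | tensor S T hS hT =>
    exact congrArg₂ (fun P Q => Pres.tensor P Q (Functor.Monoidal.μIso (Model.re w) S.el T.el))
      hS hT

/-- The structure isomorphisms of a composite monoidal functor are by definition composites of those
of its factors; the tensor case also needs naturality of `μ`. -/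
theorem along_comp (F : M.L.obj (op D) ⟶ M.L.obj (op D'))
    (G : M.L.obj (op D') ⟶ M.L.obj (op D'')) (S : STy D) :
    (⟨S.along (F ≫ G), S.alongIso (F ≫ G)⟩ : Pres ((SMHom.functor (F ≫ G)).obj S.el)) =
      ⟨(S.along F).along G, (S.along F).alongIso G ≪≫ (SMHom.functor G).mapIso (S.alongIso F)⟩ := by
  induction S with
  | base => exact congrArg (Sigma.mk _) (by ext; exact ((Category.id_comp _).trans ((SMHom.functor G).map_id _)).symm)
  | unit =>
    refine congrArg (Sigma.mk _) ?_
    ext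
    rfl
  | tensor S T hS hT =>
    refine (congrArg₂ (fun P Q => Pres.tensor P Q
      (Functor.Monoidal.μIso (SMHom.functor (F ≫ G)) S.el T.el)) hS hT).trans ?_
    refine congrArg (Sigma.mk _) ?_
    ext
    have key {C E : Type u} [Category.{v} C] [MonoidalCategory C] [Category.{v} E]
      [MonoidalCategory E] (K : C ⥤ E) [K.Monoidal] {A B A' B' P : C} {A₁ B₁ : E}
      (a : A₁ ⟶ K.obj A) (b : B₁ ⟶ K.obj B)
      (a' : A ⟶ A') (b' : B ⟶ B') (m : A' ⊗ B' ⟶ P) :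
      (a ≫ K.map a' ⊗ₘ b ≫ K.map b') ≫ Functor.LaxMonoidal.μ K A' B' ≫ K.map m =
        ((a ⊗ₘ b) ≫ Functor.LaxMonoidal.μ K A B) ≫ K.map ((a' ⊗ₘ b') ≫ m) := by
      rw [K.map_comp, Category.assoc, ← Functor.LaxMonoidal.μ_natural_assoc,
        MonoidalCategory.tensorHom_comp_tensorHom_assoc]
    exact key (SMHom.functor G) _ _ _ _ _

theorem along_id (S : STy D) :
    (⟨S.along (𝟙 _), S.alongIso (𝟙 _)⟩ : Pres ((SMHom.functor (𝟙 (M.L.obj (op D)))).obj S.el)) =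
      ⟨S, Iso.refl _⟩ := by
  induction S with
  | base => rfl
  | unit =>
    refine congrArg (Sigma.mk _) ?_
    ext
    rfl
  | tensor S T hS hT =>
    refine (congrArg₂ (fun P Q => Pres.tensor P Q
      (Functor.Monoidal.μIso (SMHom.functor (𝟙 (M.L.obj (op D)))) S.el T.el)) hS hT).trans ?_
    refine congrArg (Sigma.mk _) ?_
    ext
    have key {C : Type u} [Category.{v} C] [MonoidalCategory C] (A B : C) :
      (𝟙 A ⊗ₘ 𝟙 B) ≫ 𝟙 (A ⊗ B) = 𝟙 (A ⊗ B) := by simp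
    exact key _ _

def Pres.re (w : D' ⟶ D) {A : M.fib D} (P : Pres A) : Pres ((Model.re w).obj A) :=
  ⟨P.1.re w, P.1.reIso w ≪≫ (Model.re w).mapIso P.2⟩

theorem Pres.re_re (w : D'' ⟶ D') (h : D' ⟶ D) (S : STy D) :
    Pres.re w ⟨S.re h, S.reIso h⟩ =
      ⟨(S.along (M.L.map h.op)).along (M.L.map w.op), (S.along _).alongIso (M.L.map w.op) ≪≫
        (Model.re w).mapIso (S.alongIso (M.L.map h.op))⟩ :=
  (congrArg (Pres.re w) (re_eq_along h S)).trans
    (congrArg (fun P : Pres ((Model.re w).obj (S.along (M.L.map h.op)).el) =>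
      (⟨P.1, P.2 ≪≫ (Model.re w).mapIso (S.alongIso (M.L.map h.op))⟩ :
        Pres ((Model.re w).obj ((Model.re h).obj S.el)))) (re_eq_along w _))

/-- An equality, not just an isomorphism, because `L` is a strict functor and semantic types keep
`I` and `⊗` formal. -/
theorem re_comp (w : D'' ⟶ D') (h : D' ⟶ D) (S : STy D) : S.re (w ≫ h) = (S.re h).re w := by
  have e₁ (S : STy D) := congrArg Sigma.fst (re_eq_along h S)
  have e₂ (S : STy D') := congrArg Sigma.fst (re_eq_along w S)
  have e₃ (S : STy D) := congrArg Sigma.fst (re_eq_along (w ≫ h) S)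
  dsimp only at e₁ e₂ e₃
  rw [e₁, e₂, e₃, op_comp, M.L.map_comp]
  exact congrArg Sigma.fst (along_comp _ _ S)

/-- Applied to the denotation of a base term, this shows that reindexing it along `h` and then along
`w` is reindexing it along `w ≫ h`, coherence isomorphisms included. -/
theorem re_comp_map (w : D'' ⟶ D') (h : D' ⟶ D) {S T : STy D} (g : S.el ⟶ T.el) :
    (⟨S.re (w ≫ h), T.re (w ≫ h),
      (S.reIso (w ≫ h)).hom ≫ (Model.re (w ≫ h)).map g ≫ (T.reIso (w ≫ h)).inv⟩ :
        Σ S T : STy D'', (S.el ⟶ T.el)) =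
      ⟨(S.re h).re w, (T.re h).re w, ((S.re h).reIso w).hom ≫
        (Model.re w).map ((S.reIso h).hom ≫ (Model.re h).map g ≫ (T.reIso h).inv) ≫
          ((T.re h).reIso w).inv⟩ := by
  refine (congrArg₂ (fun P Q => Pres.conj P Q ((Model.re (w ≫ h)).map g))
    (re_eq_along _ S) (re_eq_along _ T)).trans ?_
  have e := M.L.map_comp h.op w.op
  change M.L.map (w ≫ h).op = _ at e
  -- `K` stands for `M.L.map (w ≫ h).op`, generalised so that its factorisation can be substituted.
  have e' : ∀ K : M.L.obj (op D) ⟶ M.L.obj (op D''), K = M.L.map h.op ≫ M.L.map w.op →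
      Pres.conj ⟨S.along K, S.alongIso K⟩ ⟨T.along K, T.alongIso K⟩ ((SMHom.functor K).map g) =
      Pres.conj (Pres.re w ⟨S.re h, S.reIso h⟩) (Pres.re w ⟨T.re h, T.reIso h⟩)
        ((Model.re w).map ((Model.re h).map g)) := by
    rintro _ rfl
    exact (congrArg₂ (fun P Q => Pres.conj P Q _) (along_comp _ _ S) (along_comp _ _ T)).trans
      (congrArg₂ (fun P Q => Pres.conj P Q _) (Pres.re_re w h S) (Pres.re_re w h T)).symm
  have key {C E : Type u} [Category.{v} C] [Category.{v} E] (K : C ⥤ E) {A B A' B' : C} {A₁ B₁ : E}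
      (a : A₁ ≅ K.obj A) (b : B₁ ≅ K.obj B) (a' : A ≅ A') (b' : B ≅ B') (m : A' ⟶ B') :
      (a ≪≫ K.mapIso a').hom ≫ K.map m ≫ (b ≪≫ K.mapIso b').inv =
        a.hom ≫ K.map (a'.hom ≫ m ≫ b'.inv) ≫ b.inv := by simp
  exact (e' _ e).trans (congrArg (fun k => (⟨(S.re h).re w, (T.re h).re w, k⟩ :
    Σ S T : STy D'', (S.el ⟶ T.el))) (key (Model.re w) _ _ _ _ _))

end STy

def Sec.along (F : M.L.obj (op D) ⟶ M.L.obj (op D')) (s : Sec D) : Sec D' :=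
  ⟨s.1.along F, SMHom.pull F s.2 ≫ (s.1.alongIso F).inv⟩

theorem Sec.re_eq_along (w : D' ⟶ D) (s : Sec D) : s.re w = s.along (M.L.map w.op) :=
  congrArg (fun P : STy.Pres ((Model.re w).obj s.1.el) => (⟨P.1, reSec w s.2 ≫ P.2.inv⟩ : Sec D'))
    (STy.re_eq_along w s.1)

theorem Sec.along_comp (F : M.L.obj (op D) ⟶ M.L.obj (op D'))
    (G : M.L.obj (op D') ⟶ M.L.obj (op D'')) (s : Sec D) :
    s.along (F ≫ G) = (s.along F).along G := by
  refine (congrArg (fun P : STy.Pres ((SMHom.functor (F ≫ G)).obj s.1.el) =>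
    (⟨P.1, SMHom.pull (F ≫ G) s.2 ≫ P.2.inv⟩ : Sec D''))
    (STy.along_comp F G s.1)).trans (congrArg (Sigma.mk _) ?_)
  dsimp only
  rw [SMHom.pull_comp]
  have key {C E : Type u} [Category.{v} C] [MonoidalCategory C] [Category.{v} E]
      [MonoidalCategory E] (K : C ⥤ E) [K.Monoidal] {A A' : C} {A₁ : E}
      (a : A₁ ≅ K.obj A) (b : A ≅ A') (m : 𝟙_ C ⟶ A') :
      (Functor.LaxMonoidal.ε K ≫ K.map m) ≫ (a ≪≫ K.mapIso b).inv =
        (Functor.LaxMonoidal.ε K ≫ K.map (m ≫ b.inv)) ≫ a.inv := by simp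
  exact key (SMHom.functor G) _ _ _

theorem Sec.along_id (s : Sec D) : s.along (𝟙 (M.L.obj (op D))) = s := by
  refine (congrArg (fun P : STy.Pres ((SMHom.functor (𝟙 (M.L.obj (op D)))).obj s.1.el) =>
    (⟨P.1, SMHom.pull (𝟙 (M.L.obj (op D))) s.2 ≫ P.2.inv⟩ : Sec D))
    (STy.along_id s.1)).trans (congrArg (Sigma.mk _) ?_)
  dsimp only
  rw [SMHom.pull_id]
  exact Category.comp_id _

theorem Sec.re_comp (w : D'' ⟶ D') (h : D' ⟶ D) (s : Sec D) : s.re (w ≫ h) = (s.re h).re w := by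
  rw [re_eq_along, re_eq_along h, re_eq_along w, op_comp, M.L.map_comp, along_comp]

theorem Sec.re_id (s : Sec D) : s.re (𝟙 D) = s := by
  rw [re_eq_along, op_id, M.L.map_id, along_id]

end ILDTT

namespace ILDTT
open Model

/-! ## Substitution for intuitionistic variables -/

section
open Functor.Monoidal
variable {C : Type*} [Category* C] [MonoidalCategory C] [SymmetricCategory C]
  {E : Type*} [Category* E] [MonoidalCategory E] [SymmetricCategory E] (F : C ⥤ E) [F.Braided]

theorem map_conj_letU {X A B S : C} {X' A' B' S' : E} (x : X' ≅ F.obj X) (a : A' ≅ F.obj A)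
    (b : B' ≅ F.obj B) (s : S' ≅ F.obj S) (p : X ⟶ A ⊗ B) (g : A ⟶ S) (f : B ⟶ 𝟙_ C) :
    x.hom ≫ F.map (p ≫ (g ⊗ₘ f) ≫ (ρ_ S).hom) ≫ s.inv =
      (x.hom ≫ F.map p ≫ ((a ⊗ᵢ b) ≪≫ μIso F A B).inv) ≫
        ((a.hom ≫ F.map g ≫ s.inv) ⊗ₘ (b.hom ≫ F.map f ≫ (εIso F).inv)) ≫ (ρ_ S').hom := by
  rw [← map_conj_tensor, ← map_conj_rightUnitor F s, ← map_conj_comp, ← map_conj_comp]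

theorem map_conj_tens {X A B S T : C} {X' A' B' S' T' : E} (x : X' ≅ F.obj X) (a : A' ≅ F.obj A)
    (b : B' ≅ F.obj B) (s : S' ≅ F.obj S) (t : T' ≅ F.obj T) (p : X ⟶ A ⊗ B) (g : A ⟶ S)
    (f : B ⟶ T) :
    x.hom ≫ F.map (p ≫ (g ⊗ₘ f)) ≫ ((s ⊗ᵢ t) ≪≫ μIso F S T).inv =
      (x.hom ≫ F.map p ≫ ((a ⊗ᵢ b) ≪≫ μIso F A B).inv) ≫
        ((a.hom ≫ F.map g ≫ s.inv) ⊗ₘ (b.hom ≫ F.map f ≫ t.inv)) := by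
  rw [← map_conj_tensor, ← map_conj_comp]

theorem map_conj_letT {X A B S T R : C} {X' A' B' S' T' R' : E} (x : X' ≅ F.obj X)
    (a : A' ≅ F.obj A) (b : B' ≅ F.obj B) (s : S' ≅ F.obj S) (t : T' ≅ F.obj T)
    (r : R' ≅ F.obj R) (p : X ⟶ A ⊗ B) (f : B ⟶ S ⊗ T) (g : (A ⊗ S) ⊗ T ⟶ R) :
    x.hom ≫ F.map (p ≫ A ◁ f ≫ (α_ A S T).inv ≫ g) ≫ r.inv =
      (x.hom ≫ F.map p ≫ ((a ⊗ᵢ b) ≪≫ μIso F A B).inv) ≫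
        A' ◁ (b.hom ≫ F.map f ≫ ((s ⊗ᵢ t) ≪≫ μIso F S T).inv) ≫ (α_ A' S' T').inv ≫
          ((((a ⊗ᵢ s) ≪≫ μIso F A S) ⊗ᵢ t) ≪≫ μIso F (A ⊗ S) T).hom ≫ F.map g ≫ r.inv := by
  rw [← map_conj_whiskerLeft, ← map_conj_associator_inv F a s t, ← map_conj_comp, ← map_conj_comp,
    ← map_conj_comp]

theorem map_conj_ivar {X S : C} {X' S' : E} (x : X' ≅ F.obj X) (s : S' ≅ F.obj S)
    (p : X ⟶ 𝟙_ C) (g : 𝟙_ C ⟶ S) :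
    x.hom ≫ F.map (p ≫ g) ≫ s.inv =
      (x.hom ≫ F.map p ≫ (εIso F).inv) ≫ (Functor.LaxMonoidal.ε F ≫ F.map g) ≫ s.inv := by
  rw [map_conj_comp F x (εIso F) s, εIso_hom, Category.assoc (Functor.LaxMonoidal.ε F)]

end

variable {𝔽 : Symbols.{w}} {M : Model.{v₁, u₁, v, u}} {D D' : M.𝒞} {𝔡 : Denot 𝔽 M}
  {ρ : List (Sec D)} {ρ' : List (Sec D')}

/-- The two types and the morphism between them are replaced simultaneously, which avoids casts
along equalities of semantic types. -/
theorem Den.con_of_eq (c : 𝔽.TmC) {us : Fin (𝔽.tmAr c) → Tm 𝔽} {s : Fin (𝔽.tmAr c) → Sec D}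
    {l : List ℕ} {X : Tree D} {b : Tm 𝔽} {h : D ⟶ (𝔡.tmCtx c).D} {S T : STy D} {g : X.obj ⟶ S.el}
    {k : S.el ⟶ T.el} (hs : ∀ i, Den 𝔡 ρ (us i) [] (.lst []) (s i).1 (s i).2)
    (hv : (𝔡.tmCtx c).vars.map (Sec.re h) = List.ofFn s)
    (e : (⟨(𝔡.tmArg c).re h, (𝔡.tmRes c).re h, ((𝔡.tmArg c).reIso h).hom ≫
      (Model.re h).map (𝔡.tmMor c) ≫ ((𝔡.tmRes c).reIso h).inv⟩ :
        Σ S T : STy D, (S.el ⟶ T.el)) = ⟨S, T, k⟩) (hg : Den 𝔡 ρ b l X S g) :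
    Den 𝔡 ρ (.con c us b) l X T (g ≫ k) := by
  cases e
  exact .con c hs hv hg

/-- Conjugation by the coherence isomorphisms takes each rule of `Den` to an instance of the same
rule: canonical morphisms by `Coh.re`, base terms by `STy.re_comp_map`. For intuitionistic variables
the assumption on `σ` is used. -/
theorem Den.isub (w : D' ⟶ D) {σ : ℕ → Tm 𝔽}
    (hσ : ∀ i s, ρ[i]? = some s → Den 𝔡 ρ' (σ i) [] (.lst []) (s.re w).1 (s.re w).2)
    {a : Tm 𝔽} {l : List ℕ} {X : Tree D} {S : STy D} {f : X.obj ⟶ S.el} (h : Den 𝔡 ρ a l X S f) :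
    Den 𝔡 ρ' (a.isub σ) l (X.re w) (S.re w)
      ((X.reIso w).hom ≫ (Model.re w).map f ≫ (S.reIso w).inv) := by
  induction h with
  | ivar hs hq => exact .of_eq ((hσ _ _ hs).coh (hq.re w)) (map_conj_ivar _ _ _ _ _)
  | lvar hq => exact .lvar (hq.re w)
  | @con c us s l X b h g _ hv _ ihs ih =>
    have hs (i) : Den 𝔡 ρ' ((us i).isub σ) [] (.lst []) ((s i).re w).1 ((s i).re w).2 := by
      refine .of_eq (ihs i) ?_
      -- Over the empty linear context the coherence isomorphism is `ε`, so reindexing a closed term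
      -- is `Sec.re` up to associativity.
      exact (Category.assoc _ _ _).trans rfl
    refine .of_eq (con_of_eq c (h := w ≫ h) (s := fun i => (s i).re w) hs ?_
      (STy.re_comp_map w h (𝔡.tmMor c)) ih) (map_conj_comp _ _ _ _ _ _)
    have := congrArg (List.map (Sec.re w)) hv
    rw [List.map_map, List.map_ofFn] at this
    rw [show Sec.re (w ≫ h) = Sec.re w ∘ Sec.re h from funext (Sec.re_comp w h)]
    exact this
  | star hq => exact .star (hq.re w)
  | letU hq _ _ ht ha => exact .of_eq (.letU (hq.re w) ht ha) (map_conj_letU _ _ _ _ _ _ _ _)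
  | tens hq _ _ ht ha => exact .of_eq (.tens (hq.re w) ht ha) (map_conj_tens _ _ _ _ _ _ _ _ _)
  | letT hq _ _ ht hc => exact .of_eq (.letT (hq.re w) ht hc) (map_conj_letT _ _ _ _ _ _ _ _ _ _)

theorem ITm.isub (w : D' ⟶ D) {σ : ℕ → Tm 𝔽}
    (hσ : ∀ i s, ρ[i]? = some s → ITm 𝔡 ρ' [] (σ i) (s.re w).1 (s.re w).2)
    {a : Tm 𝔽} {X : List (STy D)} {S : STy D} {f : linObj X ⟶ S.el} (h : ITm 𝔡 ρ X a S f) :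
    ITm 𝔡 ρ' (X.map (STy.re w)) (a.isub σ) (S.re w) (reTm w f) := by
  have h := Den.isub w (fun i s e => (hσ i s e).den) h.den
  have := Den.itm h (Y := X.map (STy.re w)) (.refl (by simp [Tree.leaves])) id
    (by simp)
  rw [Tm.lren_id] at this
  exact this.of_eq (Category.id_comp _).symm

theorem ITy.isub (w : D' ⟶ D) {σ : ℕ → Tm 𝔽}
    (hσ : ∀ i s, ρ[i]? = some s → ITm 𝔡 ρ' [] (σ i) (s.re w).1 (s.re w).2)
    {A : Ty 𝔽} {S : STy D} (h : ITy 𝔡 ρ A S) : ITy 𝔡 ρ' (A.isub σ) (S.re w) := by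
  induction h with
  | @con T us s h hs hv =>
    have e := re_comp_obj M.L w h (𝔡.tyObj T)
    have : ITy 𝔡 ρ' (.con T (fun i => (us i).isub σ)) (.base ((Model.re (w ≫ h)).obj (𝔡.tyObj T))) := by
      refine .con T (s := fun i => (s i).re w) (fun i => ?_) ?_
      · refine ((hs i).isub w hσ).of_eq ?_
        exact (Category.assoc _ _ _).trans rfl
      · have := congrArg (List.map (Sec.re w)) hv
        rw [List.map_map, List.map_ofFn] at this
        rw [show Sec.re (w ≫ h) = Sec.re w ∘ Sec.re h from funext (Sec.re_comp w h)]
        exact this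
    rw [e] at this
    exact this
  | unit => exact .unit
  | tensor _ _ h h' => exact .tensor h h'

theorem ILin.isub (w : D' ⟶ D) {σ : ℕ → Tm 𝔽}
    (hσ : ∀ i s, ρ[i]? = some s → ITm 𝔡 ρ' [] (σ i) (s.re w).1 (s.re w).2)
    {Ξ : List (Ty 𝔽)} {X : List (STy D)} (h : ILin 𝔡 ρ Ξ X) :
    ILin 𝔡 ρ' (Ξ.map (Ty.isub σ)) (X.map (STy.re w)) := by
  induction h with
  | nil => exact .nil
  | cons h _ ih => exact .cons (h.isub w hσ) ih

end ILDTT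

namespace ILDTT
open Model

/-! ## Comprehension -/

variable {M : Model.{v₁, u₁, v, u}} {D D' D'' : M.𝒞}

namespace STy

def Pres.trans {A B : M.fib D} (P : Pres A) (e : A ≅ B) : Pres B := ⟨P.1, P.2 ≪≫ e⟩

/-- The canonical isomorphisms respect composition of reindexings as well; the two reindexed objects
are strictly equal, which accounts for the `eqToIso`. -/
theorem re_comp_pres (w : D'' ⟶ D') (h : D' ⟶ D) (S : STy D) :
    (⟨S.re (w ≫ h), S.reIso (w ≫ h)⟩ : Pres ((Model.re (w ≫ h)).obj S.el)) =
      (Pres.re w ⟨S.re h, S.reIso h⟩).trans (eqToIso (re_comp_obj M.L w h S.el).symm) := by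
  refine (re_eq_along _ S).trans ?_
  have e : M.L.map (w ≫ h).op = M.L.map h.op ≫ M.L.map w.op := M.L.map_comp h.op w.op
  have e' : ∀ (K : M.L.obj (op D) ⟶ M.L.obj (op D'')) (_ : K = M.L.map h.op ≫ M.L.map w.op)
      (e'' : (Model.re w).obj ((Model.re h).obj S.el) = (SMHom.functor K).obj S.el),
      (⟨S.along K, S.alongIso K⟩ : Pres ((SMHom.functor K).obj S.el)) =
        (Pres.re w ⟨S.re h, S.reIso h⟩).trans (eqToIso e'') := by
    rintro _ rfl e''
    refine (along_comp _ _ S).trans ((Pres.re_re w h S).symm.trans ?_)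
    exact congrArg (Sigma.mk _) (Iso.trans_refl _).symm
  exact e' _ e _

theorem re_id_pres (S : STy D) :
    (⟨S.re (𝟙 D), S.reIso (𝟙 D)⟩ : Pres ((Model.re (𝟙 D)).obj S.el)) =
      ⟨S, eqToIso (re_id_obj M.L S.el).symm⟩ := by
  refine (re_eq_along _ S).trans ?_
  have e : M.L.map (𝟙 D : D ⟶ D).op = 𝟙 _ := M.L.map_id (op D)
  have e' : ∀ (K : M.L.obj (op D) ⟶ M.L.obj (op D)) (_ : K = 𝟙 _)
      (e'' : S.el = (SMHom.functor K).obj S.el),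
      (⟨S.along K, S.alongIso K⟩ : Pres ((SMHom.functor K).obj S.el)) = ⟨S, eqToIso e''⟩ := by
    rintro _ rfl e''
    exact along_id S
  exact e' _ e _

end STy

/-- The section given by a global element of an object that `P` presents. -/
def STy.Pres.sec {A : M.fib D} (P : STy.Pres A) (a : 𝟙_ (M.fib D) ⟶ A) : Sec D :=
  ⟨P.1, a ≫ P.2.inv⟩

theorem STy.Pres.sec_re (w : D' ⟶ D) {A : M.fib D} (P : STy.Pres A) (a : 𝟙_ (M.fib D) ⟶ A) :
    (P.sec a).re w = (P.re w).sec (reSec w a) := by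
  refine congrArg (Sigma.mk _) ?_
  have key {C E : Type u} [Category.{v} C] [MonoidalCategory C] [Category.{v} E]
      [MonoidalCategory E] (K : C ⥤ E) [K.Monoidal] {A A' : C} {A₁ : E}
      (a : A₁ ≅ K.obj A) (b : A ≅ A') (m : 𝟙_ C ⟶ A') :
      (Functor.LaxMonoidal.ε K ≫ K.map (m ≫ b.inv)) ≫ a.inv =
      (Functor.LaxMonoidal.ε K ≫ K.map m) ≫ (a ≪≫ K.mapIso b).inv := by simp
  exact key (Model.re w) _ _ _

/-- The section that interprets the last variable of an extended context. -/
def genSec (S : STy D) : Sec (ext D S.el) :=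
  ⟨S.re (p D S.el), gen D S.el ≫ (S.reIso (p D S.el)).inv⟩

theorem pair_p (f : D' ⟶ D) {A : M.fib D} (a : 𝟙_ (M.fib D') ⟶ (re f).obj A) :
    pair f a ≫ p D A = f :=
  Over.w ((M.rep A).homEquiv.symm (show (sections M.L A).obj (op (Over.mk f)) from a))

/-- The global element that corresponds to a morphism to `D.A`. -/
def elem {A : M.fib D} (g : D' ⟶ ext D A) : 𝟙_ (M.fib D') ⟶ (re (g ≫ p D A)).obj A :=
  (M.rep A).homEquiv (X := Over.mk (g ≫ p D A)) (Over.homMk g rfl)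

/-- The Yoneda lemma: an element corresponding to `g` is the universal element reindexed along `g`.
-/
theorem elem_eq {A : M.fib D} (g : D' ⟶ ext D A) :
    elem g = reSec g (gen D A) ≫ eqToHom (re_comp_obj M.L _ _ _).symm := by
  have := (M.rep A).homEquiv_comp (Over.homMk g rfl : Over.mk (g ≫ p D A) ⟶ M.compr A) (𝟙 _)
  rw [Category.comp_id] at this
  exact this

theorem pair_elem {A : M.fib D} (g : D' ⟶ ext D A) : pair (g ≫ p D A) (elem g) = g :=
  congrArg CommaMorphism.left ((M.rep A).homEquiv.symm_apply_apply
    (Over.homMk g rfl : Over.mk (g ≫ p D A) ⟶ M.compr A))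

/-- The base morphism is `f` only up to an equation, so it is paired with the element that depends
on it. -/
theorem elem_pair (f : D' ⟶ D) {A : M.fib D} (a : 𝟙_ (M.fib D') ⟶ (re f).obj A) :
    (⟨pair f a ≫ p D A, elem (pair f a)⟩ : Σ f : D' ⟶ D, (𝟙_ (M.fib D') ⟶ (re f).obj A)) =
      ⟨f, a⟩ := by
  have h : ∀ (f' : D' ⟶ D) (e : f' = f) (e' : pair f a ≫ p D A = f'),
      (⟨f', (M.rep A).homEquiv (X := Over.mk f') (Over.homMk (pair f a) e')⟩ :
        Σ f : D' ⟶ D, (𝟙_ (M.fib D') ⟶ (re f).obj A)) = ⟨f, a⟩ := by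
    rintro _ rfl e'
    refine congrArg (Sigma.mk _) ?_
    refine (congrArg _ ?_).trans ((M.rep A).homEquiv.apply_symm_apply _)
    ext
    rfl
  exact h _ (pair_p f a) rfl

/-- The section given by a morphism and a global element. -/
def secOf (S : STy D) (x : Σ f : D' ⟶ D, (𝟙_ (M.fib D') ⟶ (re f).obj S.el)) : Sec D' :=
  STy.Pres.sec ⟨S.re x.1, S.reIso x.1⟩ x.2

theorem genSec_re (S : STy D) (g : D' ⟶ ext D S.el) :
    (genSec S).re g = secOf S ⟨g ≫ p D S.el, elem g⟩ := by
  refine (STy.Pres.sec_re g ⟨S.re (p D S.el), S.reIso _⟩ (gen D S.el)).trans ?_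
  unfold secOf
  rw [STy.re_comp_pres, elem_eq]
  refine congrArg (Sigma.mk _) ?_
  simp [STy.Pres.trans]

theorem genSec_re_pair (S : STy D) (f : D' ⟶ D) (a : 𝟙_ (M.fib D') ⟶ (re f).obj S.el) :
    (genSec S).re (pair f a) = secOf S ⟨f, a⟩ := by
  rw [genSec_re, elem_pair]

/-- The uniqueness half of comprehension, phrased with sections so that all comparisons are plain
equalities; `exists_pair` is the existence half. -/
theorem ext_hom_ext (S : STy D) {g g' : D' ⟶ ext D S.el} (h : g ≫ p D S.el = g' ≫ p D S.el)
    (h' : (genSec S).re g = (genSec S).re g') : g = g' := by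
  obtain ⟨f, a, rfl⟩ : ∃ f a, g = pair f a := ⟨_, _, (pair_elem g).symm⟩
  obtain ⟨f', a', rfl⟩ : ∃ f a, g' = pair f a := ⟨_, _, (pair_elem g').symm⟩
  rw [pair_p, pair_p] at h
  subst h
  rw [genSec_re_pair, genSec_re_pair] at h'
  have := eq_of_heq (Sigma.mk.inj h').2
  rw [cancel_mono] at this
  exact congrArg (pair f) this

theorem exists_pair (f : D' ⟶ D) (S : STy D) (s : Sec D') (h : s.1 = S.re f) :
    ∃ g : D' ⟶ ext D S.el, g ≫ p D S.el = f ∧ (genSec S).re g = s := by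
  obtain ⟨T, a⟩ := s
  subst h
  refine ⟨pair f (a ≫ (S.reIso f).hom), pair_p _ _, ?_⟩
  rw [genSec_re_pair]
  exact congrArg (Sigma.mk _) (by simp)

theorem qMor_p (f : D' ⟶ D) (S : STy D) : qMor f S ≫ p D S.el = p D' (S.re f).el ≫ f :=
  pair_p _ _

/-- By construction `qMor` has the new variable as its second component, so it takes last variables
to last variables. -/
theorem genSec_re_qMor (f : D' ⟶ D) (S : STy D) :
    (genSec S).re (qMor f S) = genSec (S.re f) := by
  unfold qMor
  rw [genSec_re_pair]
  unfold secOf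
  rw [STy.re_comp_pres]
  refine congrArg (Sigma.mk _) ?_
  simp [STy.Pres.trans, STy.Pres.re]

theorem secMor_p (S : STy D) (a : 𝟙_ (M.fib D) ⟶ S.el) : secMor S a ≫ p D S.el = 𝟙 D :=
  pair_p _ _

theorem genSec_re_secMor (S : STy D) (a : 𝟙_ (M.fib D) ⟶ S.el) :
    (genSec S).re (secMor S a) = ⟨S, a⟩ := by
  unfold secMor
  rw [genSec_re_pair]
  unfold secOf
  rw [STy.re_id_pres]
  refine congrArg (Sigma.mk _) ?_
  simp

end ILDTT

namespace ILDTT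
open Model

/-! ## Functionality of the interpretation -/

variable {M : Model.{v₁, u₁, v, u}} {D D' : M.𝒞}

section
variable {𝔽 : Symbols.{w}} {𝔡 : Denot 𝔽 M} {Δ : List (Ty 𝔽)} {A : Ty 𝔽} {Z Z' : SCtx M}

theorem map_re_comp (w : D' ⟶ D) {C : M.𝒞} (h : D ⟶ C) (ρ : List (Sec C)) :
    ρ.map (Sec.re (w ≫ h)) = (ρ.map (Sec.re h)).map (Sec.re w) := by
  rw [List.map_map]
  exact List.map_congr_left fun s _ => Sec.re_comp w h s

theorem SCtx.ext_vars_map (Z : SCtx M) (S : STy Z.D) (h : D ⟶ Model.ext Z.D S.el) :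
    List.map (Sec.re h) (Z.ext S).vars =
      Z.vars.map (Sec.re (h ≫ p Z.D S.el)) ++ [(genSec S).re h] := by
  rw [map_re_comp]
  exact List.map_append

theorem ICtx.nil_inv (h : ICtx 𝔡 [] Z) : Z = SCtx.empty M := by
  generalize e : ([] : List (Ty 𝔽)) = Δ at h
  cases h with
  | empty => rfl
  | ext => simp at e

theorem ICtx.append_inv (h : ICtx 𝔡 (Δ ++ [A]) Z) :
    ∃ Z₀ S, ICtx 𝔡 Δ Z₀ ∧ ITy 𝔡 Z₀.vars A S ∧ Z = Z₀.ext S := by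
  generalize e : Δ ++ [A] = Δ' at h
  cases h with
  | empty => simp at e
  | @ext Δ₀ A₀ Z₀ S₀ h h' =>
    obtain ⟨rfl, e'⟩ := List.append_inj' e rfl
    obtain rfl := (List.cons.inj e').1
    exact ⟨_, _, h, h', rfl⟩

theorem ICtx.length (h : ICtx 𝔡 Δ Z) : Z.vars.length = Δ.length := by
  induction h with
  | empty => rfl
  | ext _ _ ih =>
    refine List.length_append.trans ((congrArg (· + 1) ((List.length_map _).trans ih)).trans ?_)
    simp

/-- Induction along the context: uniqueness into the terminal object at the start, uniqueness for
comprehension at each extension. No functionality of the interpretation is needed, so `Den.unique`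
may rely on it without circularity. -/
theorem ICtx.hom_ext (hZ : ICtx 𝔡 Δ Z) {h h' : D ⟶ Z.D}
    (e : Z.vars.map (Sec.re h) = Z.vars.map (Sec.re h')) : h = h' := by
  induction hZ with
  | empty => exact M.isTerminal.hom_ext _ _
  | @ext _ _ Z S _ _ ih =>
    obtain ⟨e, e'⟩ := List.append_inj' ((Z.ext_vars_map S h).symm.trans
      (e.trans (Z.ext_vars_map S h'))) rfl
    exact ext_hom_ext S (ih e) (List.cons.inj e').1

end

variable {𝕊 : Signature.{w}} {𝔡 : Denot 𝕊.toSymbols M}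
  {ρ : List (Sec D)}

namespace Denot.IsStructure

theorem jointlyMonic (h𝔡 : 𝔡.IsStructure 𝕊) : 𝔡.JointlyMonic := fun c _ _ _ e => (h𝔡.tmCtx c).hom_ext e

theorem tm_unique (h𝔡 : 𝔡.IsStructure 𝕊)
    {X : List (STy D)} {a : Tm 𝕊.toSymbols} {S S' : STy D} {f : linObj X ⟶ S.el}
    {f' : linObj X ⟶ S'.el} (h : ITm 𝔡 ρ X a S f) (h' : ITm 𝔡 ρ X a S' f') :
    (⟨S, f⟩ : Σ S : STy D, (linObj X ⟶ S.el)) = ⟨S', f'⟩ :=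
  (h.den.unique h𝔡.jointlyMonic h'.den (.refl (by simp [Tree.leaves])) List.nodup_range).trans
    (congrArg (Sigma.mk _) (Category.id_comp _))

theorem tm_unique' (h𝔡 : 𝔡.IsStructure 𝕊)
    {X : List (STy D)} {a : Tm 𝕊.toSymbols} {S : STy D} {f f' : linObj X ⟶ S.el}
    (h : ITm 𝔡 ρ X a S f) (h' : ITm 𝔡 ρ X a S f') : f = f' :=
  eq_of_heq (Sigma.mk.inj (h𝔡.tm_unique h h')).2

/-- For a base type the arguments denote unique sections, and these determine the morphism along
which its object is reindexed. -/
theorem ty_unique (h𝔡 : 𝔡.IsStructure 𝕊)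
    {A : Ty 𝕊.toSymbols} {S S' : STy D} (h : ITy 𝔡 ρ A S) (h' : ITy 𝔡 ρ A S') :
    S = S' := by
  induction h generalizing S' with
  | con T hs hv =>
    cases h' with
    | con _ hs' hv' =>
      have e := funext fun i => h𝔡.tm_unique (hs i) (hs' i)
      obtain rfl := (h𝔡.tyCtx T).hom_ext (hv.trans ((congrArg List.ofFn e).trans hv'.symm))
      rfl
  | unit => cases h'; rfl
  | tensor _ _ ih ih' => cases h' with | tensor h h' => rw [ih h, ih' h']

theorem lin_unique (h𝔡 : 𝔡.IsStructure 𝕊)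
    {Ξ : List (Ty 𝕊.toSymbols)} {X X' : List (STy D)} (h : ILin 𝔡 ρ Ξ X)
    (h' : ILin 𝔡 ρ Ξ X') : X = X' := by
  induction h generalizing X' with
  | nil => cases h'; rfl
  | cons h _ ih => cases h' with | cons h₁ h₂ => rw [h𝔡.ty_unique h h₁, ih h₂]

theorem ctx_unique (h𝔡 : 𝔡.IsStructure 𝕊)
    {Δ : List (Ty 𝕊.toSymbols)} {Z Z' : SCtx M} (h : ICtx 𝔡 Δ Z)
    (h' : ICtx 𝔡 Δ Z') : Z = Z' := by
  induction h generalizing Z' with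
  | empty => exact h'.nil_inv.symm
  | ext _ hA ih =>
    obtain ⟨Z₀, S, h₀, hS, rfl⟩ := h'.append_inv
    obtain rfl := ih h₀
    rw [h𝔡.ty_unique hA hS]

end Denot.IsStructure

end ILDTT

namespace ILDTT
open Model

/-! ## Context morphisms -/

section
variable {𝔽 : Symbols.{w}}

theorem Tm.isub_ivar (a : Tm 𝔽) : a.isub .ivar = a := by
  induction a <;> simp_all [isub]

theorem Ty.isub_ivar (A : Ty 𝔽) : A.isub .ivar = A := by
  induction A <;> simp_all [isub, Tm.isub_ivar]

end

variable {M : Model.{v₁, u₁, v, u}} {D D' : M.𝒞}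

section
variable {𝔽 : Symbols.{w}} {𝔡 : Denot 𝔽 M}

/-- The morphism `w` interprets the substitution `σ`. -/
def CtxMor (𝔡 : Denot 𝔽 M) (σ : ℕ → Tm 𝔽) (ρ' : List (Sec D')) (ρ : List (Sec D))
    (w : D' ⟶ D) : Prop :=
  ∀ i s, ρ[i]? = some s → ITm 𝔡 ρ' [] (σ i) (s.re w).1 (s.re w).2

theorem SCtx.ext_vars_getElem? (Z : SCtx M) (S : STy Z.D) {i : ℕ} {s : Sec (Model.ext Z.D S.el)}
    (h : (Z.ext S).vars[i]? = some s) :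
    (∃ t, Z.vars[i]? = some t ∧ s = t.re (p Z.D S.el)) ∨ (i = Z.vars.length ∧ s = genSec S) := by
  have h : (Z.vars.map (Sec.re (p Z.D S.el)) ++ [genSec S])[i]? = some s := h
  rw [List.getElem?_append] at h
  split_ifs at h with hi
  · rw [List.getElem?_map, Option.map_eq_some_iff] at h
    obtain ⟨t, ht, rfl⟩ := h
    exact .inl ⟨t, ht, rfl⟩
  · rw [List.length_map] at h hi
    obtain ⟨e, e'⟩ := List.getElem?_eq_some_iff.1 h
    simp only [List.length_cons, List.length_nil] at e
    refine .inr ⟨by omega, ?_⟩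
    simpa using e'.symm

theorem SCtx.ext_vars_getElem?_old (Z : SCtx M) (S : STy Z.D) {i : ℕ} {t : Sec Z.D}
    (h : Z.vars[i]? = some t) : (Z.ext S).vars[i]? = some (t.re (p Z.D S.el)) := by
  change (Z.vars.map (Sec.re (p Z.D S.el)) ++ [genSec S])[i]? = _
  have hi := (List.getElem?_eq_some_iff.1 h).1
  rw [List.getElem?_append_left (by simpa using hi), List.getElem?_map, h]
  rfl

theorem SCtx.ext_vars_getElem?_new (Z : SCtx M) (S : STy Z.D) :
    (Z.ext S).vars[Z.vars.length]? = some (genSec S) := by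
  have : (Z.vars.map (Sec.re (p Z.D S.el)) ++ [genSec S])[Z.vars.length]? = some (genSec S) := by
    rw [List.getElem?_append_right (by simp)]
    simp
  exact this

theorem ITm.isub_closed {σ : ℕ → Tm 𝔽} {ρ' : List (Sec D')} {ρ : List (Sec D)} {w : D' ⟶ D}
    (hσ : CtxMor 𝔡 σ ρ' ρ w) {a : Tm 𝔽} {s : Sec D} (h : ITm 𝔡 ρ [] a s.1 s.2) :
    ITm 𝔡 ρ' [] (a.isub σ) (s.re w).1 (s.re w).2 :=
  (h.isub w hσ).of_eq ((Category.assoc _ _ _).trans rfl)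

/-- Variables are numbered from the left, so an extension on the right keeps their names and the
substitution is the identity. -/
theorem CtxMor.p (Z : SCtx M) (S : STy Z.D) :
    CtxMor 𝔡 .ivar (Z.ext S).vars Z.vars (p Z.D S.el) :=
  fun _ _ h => .ivar (Z.ext_vars_getElem?_old S h)

theorem ITm.weaken {Z : SCtx M} (S : STy Z.D) {a : Tm 𝔽} {s : Sec Z.D}
    (h : ITm 𝔡 Z.vars [] a s.1 s.2) :
    ITm 𝔡 (Z.ext S).vars [] a (s.re (p Z.D S.el)).1 (s.re (p Z.D S.el)).2 := by
  have := h.isub_closed (CtxMor.p Z S)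
  rwa [Tm.isub_ivar] at this

theorem ITy.weaken {Z : SCtx M} (S : STy Z.D) {A : Ty 𝔽} {T : STy Z.D} (h : ITy 𝔡 Z.vars A T) :
    ITy 𝔡 (Z.ext S).vars A (T.re (p Z.D S.el)) := by
  have := h.isub _ (CtxMor.p Z S)
  rwa [Ty.isub_ivar] at this

theorem CtxMor.ext {σ : ℕ → Tm 𝔽} {W Z : SCtx M} {w : W.D ⟶ Z.D} (hσ : CtxMor 𝔡 σ W.vars Z.vars w)
    (h : σ Z.vars.length = .ivar W.vars.length) (S : STy Z.D) :
    CtxMor 𝔡 σ (W.ext (S.re w)).vars (Z.ext S).vars (qMor w S) := by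
  intro i s hs
  obtain ⟨t, ht, rfl⟩ | ⟨rfl, rfl⟩ := Z.ext_vars_getElem? S hs
  · have e : (t.re (Model.p Z.D S.el)).re (qMor w S) = (t.re w).re (Model.p W.D (S.re w).el) := by
      rw [← Sec.re_comp, ← Sec.re_comp, qMor_p]
    have := (hσ i t ht).weaken (S.re w)
    rw [← e] at this
    exact this
  · have := W.ext_vars_getElem?_new (S.re w)
    rw [← genSec_re_qMor] at this
    rw [h]
    exact .ivar this

theorem ICtx.prefix {Δ Δ' : List (Ty 𝔽)} {Z : SCtx M} (h : ICtx 𝔡 (Δ ++ Δ') Z) :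
    ∃ Z₀, ICtx 𝔡 Δ Z₀ := by
  induction Δ' using List.reverseRecOn generalizing Z with
  | nil => exact ⟨Z, by simpa using h⟩
  | append_singleton Δ' A ih =>
    rw [← List.append_assoc] at h
    obtain ⟨Z₀, _, h₀, _⟩ := h.append_inv
    exact ih h₀

theorem ICtx.suffix {Δ : List (Ty 𝔽)} {A : Ty 𝔽} {Δ' : List (Ty 𝔽)} {Z : SCtx M}
    (h : ICtx 𝔡 (Δ ++ A :: Δ') Z) : ∃ Z₀ S, ICtx 𝔡 Δ Z₀ ∧ ITy 𝔡 Z₀.vars A S := by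
  rw [List.append_cons] at h
  obtain ⟨Z₀, h₀⟩ := h.prefix
  obtain ⟨Z₁, S, h₁, hS, -⟩ := h₀.append_inv
  exact ⟨Z₁, S, h₁, hS⟩

end

variable {𝕊 : Signature.{w}} {𝔡 : Denot 𝕊.toSymbols M}

/-- A morphism for `σ` extends along the types of `Δ'`, added one at a time on the right. The
condition `h` says that `σ` takes the variables of `Δ'` to the corresponding variables of the new
context. This covers weakening, substitution and exchange at once. -/
theorem CtxMor.extend (h𝔡 : 𝔡.IsStructure 𝕊) {σ : ℕ → Tm 𝕊.toSymbols} {W₀ Z₀ : SCtx M}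
    {w₀ : W₀.D ⟶ Z₀.D} (hσ : CtxMor 𝔡 σ W₀.vars Z₀.vars w₀) {Γ Δ : List (Ty 𝕊.toSymbols)}
    (hW : ICtx 𝔡 Γ W₀) (hZ : ICtx 𝔡 Δ Z₀) (h : ∀ k, σ (Δ.length + k) = .ivar (Γ.length + k))
    {Δ' : List (Ty 𝕊.toSymbols)} {Z : SCtx M} (hZ' : ICtx 𝔡 (Δ ++ Δ') Z) :
    ∃ (W : SCtx M) (w : W.D ⟶ Z.D), ICtx 𝔡 (Γ ++ Δ'.map (Ty.isub σ)) W ∧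
      QExt w₀ Δ'.length W Z w ∧ CtxMor 𝔡 σ W.vars Z.vars w := by
  induction Δ' using List.reverseRecOn generalizing Z with
  | nil =>
    obtain rfl := h𝔡.ctx_unique hZ (by simpa using hZ')
    exact ⟨W₀, w₀, by simpa using hW, .zero, hσ⟩
  | append_singleton Δ' A ih =>
    rw [← List.append_assoc] at hZ'
    obtain ⟨Z, S, hZ₁, hS, rfl⟩ := hZ'.append_inv
    obtain ⟨W, w, hW', hq, hw⟩ := ih hZ₁
    refine ⟨W.ext (S.re w), qMor w S, ?_, ?_, hw.ext ?_ S⟩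
    · rw [List.map_append, ← List.append_assoc]
      exact .ext hW' (hS.isub w hw)
    · rw [List.length_append]
      exact .succ S hq
    · rw [hZ₁.length, hW'.length]
      simpa using h Δ'.length

theorem CtxMor.wkAt {Z : SCtx M} (S : STy Z.D) :
    CtxMor 𝔡 (wkAt Z.vars.length) (Z.ext S).vars Z.vars (Model.p Z.D S.el) := by
  intro i s hs
  have hi := (List.getElem?_eq_some_iff.1 hs).1
  rw [ILDTT.wkAt, if_pos hi]
  exact .ivar (Z.ext_vars_getElem?_old S hs)

theorem CtxMor.subAt {Z : SCtx M} {S : STy Z.D} {a : Tm 𝕊.toSymbols} {f : 𝟙_ (M.fib Z.D) ⟶ S.el}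
    (h : ITm 𝔡 Z.vars [] a S f) :
    CtxMor 𝔡 (subAt Z.vars.length a) Z.vars (Z.ext S).vars (secMor S f) := by
  intro i s hs
  obtain ⟨t, ht, rfl⟩ | ⟨rfl, rfl⟩ := Z.ext_vars_getElem? S hs
  · have hi := (List.getElem?_eq_some_iff.1 ht).1
    have e : (t.re (Model.p Z.D S.el)).re (secMor S f) = t := by
      rw [← Sec.re_comp, secMor_p, Sec.re_id]
    rw [ILDTT.subAt, if_pos hi]
    exact .ivar (ht.trans (congrArg some e.symm))
  · rw [ILDTT.subAt, if_neg (lt_irrefl _), if_pos rfl]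
    have e := genSec_re_secMor S f
    have key : ∀ s : Sec Z.D, s = ⟨S, f⟩ → ITm 𝔡 Z.vars [] a s.1 s.2 := by
      rintro _ rfl
      exact h
    exact key _ e

/-- Both `S` and `S'` live over `Z`, so each can be reindexed along the projection from the other.
-/
theorem CtxMor.exAt {Z : SCtx M} (S S' : STy Z.D) :
    ∃ w : ((Z.ext S').ext (S.re (Model.p Z.D S'.el))).D ⟶
        ((Z.ext S).ext (S'.re (Model.p Z.D S.el))).D,
      CtxMor 𝔡 (exAt Z.vars.length) ((Z.ext S').ext (S.re (Model.p Z.D S'.el))).vars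
        ((Z.ext S).ext (S'.re (Model.p Z.D S.el))).vars w := by
  have hq := qMor_p (Model.p Z.D S'.el) S
  -- Over `Z.S` the morphism is the extension of the projection from `Z.S'`; its last component is
  -- the variable of type `S'`, weakened by `S`.
  obtain ⟨w, hw, hw'⟩ := exists_pair (qMor (Model.p Z.D S'.el) S) (S'.re (Model.p Z.D S.el))
    ((genSec S').re (Model.p _ (S.re (Model.p Z.D S'.el)).el)) (by
      change (S'.re _).re _ = (S'.re _).re _
      rw [← STy.re_comp, ← STy.re_comp, hq])
  refine ⟨w, fun i s hs => ?_⟩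
  have hn {T : STy Z.D} : (Z.ext T).vars.length = Z.vars.length + 1 :=
    List.length_append.trans (congrArg (· + 1) (List.length_map _))
  obtain ⟨t, ht, rfl⟩ | ⟨rfl, rfl⟩ := SCtx.ext_vars_getElem? _ _ hs
  · have e := Sec.re_comp w (Model.p (Z.ext S).D (S'.re (Model.p Z.D S.el)).el) t
    obtain ⟨t, ht', rfl⟩ | ⟨rfl, rfl⟩ := SCtx.ext_vars_getElem? _ _ ht
    · have hi := (List.getElem?_eq_some_iff.1 ht').1
      rw [ILDTT.exAt, swapAt, if_neg (by omega), if_neg (by omega)]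
      refine .ivar ((SCtx.ext_vars_getElem?_old _ _ (SCtx.ext_vars_getElem?_old _ _ ht')).trans
        (congrArg some ?_))
      refine Eq.trans ?_ e
      refine Eq.trans ?_ (congrArg (Sec.re · (t.re (Model.p Z.D S.el))) hw.symm)
      exact (Sec.re_comp _ _ t).symm.trans ((congrArg (Sec.re · t) hq.symm).trans
        (Sec.re_comp _ _ t))
    · rw [ILDTT.exAt, swapAt, if_pos rfl, ← hn (T := S')]
      refine .ivar ((SCtx.ext_vars_getElem?_new _ _).trans (congrArg some ?_))
      refine Eq.trans ?_ e
      refine Eq.trans ?_ (congrArg (Sec.re · (genSec S)) hw.symm)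
      exact (genSec_re_qMor _ _).symm
  · rw [hn, ILDTT.exAt, swapAt, if_neg (by omega), if_pos rfl]
    exact .ivar ((SCtx.ext_vars_getElem?_old _ _ (SCtx.ext_vars_getElem?_new _ _)).trans
      (congrArg some hw'.symm))

/-- The existence counterpart of `ICtx.hom_ext`: a well-typed list of arguments is tupled by
comprehension, one argument at a time. -/
theorem Denot.IsStructure.exists_hom (h𝔡 : 𝔡.IsStructure 𝕊) {Δ : List (Ty 𝕊.toSymbols)}
    {Z : SCtx M} (hZ : ICtx 𝔡 Δ Z) {ρ : List (Sec D)} {σ : ℕ → Tm 𝕊.toSymbols} {s : ℕ → Sec D}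
    (h : ∀ i A, Δ[i]? = some A → ITy 𝔡 ρ (A.isub σ) (s i).1 ∧ ITm 𝔡 ρ [] (σ i) (s i).1 (s i).2) :
    ∃ w : D ⟶ Z.D, ∀ i t, Z.vars[i]? = some t → t.re w = s i := by
  induction hZ with
  | empty => exact ⟨M.isTerminal.from _, fun i t h => by cases h⟩
  | @ext Δ A Z S hZ hS ih =>
    have hn := hZ.length
    obtain ⟨w, hw⟩ := ih fun i B hB => h i B (by
      rwa [List.getElem?_append_left (List.getElem?_eq_some_iff.1 hB).1])
    have hσ : CtxMor 𝔡 σ ρ Z.vars w := by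
      intro i t ht
      rw [hw i t ht]
      have hi := (List.getElem?_eq_some_iff.1 ht).1
      exact (h i Δ[i] (by
        rw [List.getElem?_append_left (by omega), List.getElem?_eq_getElem (by omega)])).2
    -- The declared type of the argument also denotes the reindexing of `S` along the part of the
    -- tuple already built; by uniqueness this is the type of the given section.
    have e := h𝔡.ty_unique (h Δ.length A (by simp)).1 (hS.isub w hσ)
    obtain ⟨g, hg, hg'⟩ := exists_pair w S (s Δ.length) e
    refine ⟨g, fun i t ht => ?_⟩
    obtain ⟨t, ht', rfl⟩ | ⟨rfl, rfl⟩ := Z.ext_vars_getElem? S ht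
    · exact (Sec.re_comp _ _ _).symm.trans ((congrArg (Sec.re · t) hg).trans (hw i t ht'))
    · rw [hn]
      exact hg'

end ILDTT

namespace ILDTT
open Model

/-! ## Substitution for linear variables -/

variable {𝔽 : Symbols.{w}} {M : Model.{v₁, u₁, v, u}} {D : M.𝒞}

theorem itm_iff_den {𝔡 : Denot 𝔽 M} {ρ : List (Sec D)} {X : List (STy D)} {a : Tm 𝔽} {S : STy D}
    {f : linObj X ⟶ S.el} :
    ITm 𝔡 ρ X a S f ↔ Den 𝔡 ρ a (List.range X.length) (.lst X) S f := by
  refine ⟨ITm.den, fun h => ?_⟩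
  have := h.itm (Y := X) (.refl (by simp [Tree.leaves])) id (by simp)
  rw [Tm.lren_id] at this
  exact this.of_eq (Category.id_comp _).symm

/-- `SubM 𝔡 ρ τ l' X' l X s`: the morphism `s` interprets the substitution `τ` for the linear
variables `l` of `X` by terms over `X'`. -/
inductive SubM (𝔡 : Denot 𝔽 M) (ρ : List (Sec D)) (τ : ℕ → Tm 𝔽) :
    (l' : List ℕ) → (X' : Tree D) → (l : List ℕ) → (X : Tree D) → (X'.obj ⟶ X.obj) → Prop
  | leaf {l' X' j S} {f : X'.obj ⟶ S.el} : Den 𝔡 ρ (τ j) l' X' S f →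
      SubM 𝔡 ρ τ l' X' [j] (.leaf S) f
  | node {l' l₁' l₂' l₁ l₂ X' X₁' X₂' A B} {p : X'.obj ⟶ X₁'.obj ⊗ X₂'.obj}
      {s₁ : X₁'.obj ⟶ A.obj} {s₂ : X₂'.obj ⟶ B.obj} : Coh l' X' (l₂' ++ l₁') (.node X₁' X₂') p →
      SubM 𝔡 ρ τ l₁' X₁' l₁ A s₁ → SubM 𝔡 ρ τ l₂' X₂' l₂ B s₂ →
      SubM 𝔡 ρ τ l' X' (l₂ ++ l₁) (.node A B) (p ≫ (s₁ ⊗ₘ s₂))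
  | nil {l' X'} {p : X'.obj ⟶ 𝟙_ _} : Coh l' X' [] (.lst []) p →
      SubM 𝔡 ρ τ l' X' [] (.lst []) p
  | cons {l' l X' S X} {s : X'.obj ⟶ linObj X ⊗ S.el} :
      SubM 𝔡 ρ τ l' X' l (.node (.lst X) (.leaf S)) s → SubM 𝔡 ρ τ l' X' l (.lst (S :: X)) s

namespace SubM
variable {𝔡 : Denot 𝔽 M} {ρ : List (Sec D)} {τ : ℕ → Tm 𝔽} {l l' m m' : List ℕ}
  {X X' Y Y' : Tree D}

theorem of_eq {s t : X'.obj ⟶ X.obj} (h : SubM 𝔡 ρ τ l' X' l X s) (e : t = s) :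
    SubM 𝔡 ρ τ l' X' l X t :=
  e ▸ h

theorem length {s : X'.obj ⟶ X.obj} (h : SubM 𝔡 ρ τ l' X' l X s) :
    l.length = X.leaves.length := by
  induction h with
  | leaf | nil => rfl
  | node _ _ _ h₁ h₂ => simp [Tree.leaves, h₁, h₂]
  | cons _ h => simpa [Tree.leaves] using h

theorem length' {s : X'.obj ⟶ X.obj} (h : SubM 𝔡 ρ τ l' X' l X s) :
    l'.length = X'.leaves.length := by
  induction h with
  | leaf h => exact h.length
  | node h _ _ | nil h => exact h.length.1
  | cons _ h => exact h

theorem coh {s : X'.obj ⟶ X.obj} (h : SubM 𝔡 ρ τ l' X' l X s) {p : Y'.obj ⟶ X'.obj}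
    (hp : Coh m' Y' l' X' p) : SubM 𝔡 ρ τ m' Y' l X (p ≫ s) := by
  induction h with
  | leaf h => exact .leaf (h.coh hp)
  | node hq h₁ h₂ => exact of_eq (.node (hp.trans hq) h₁ h₂) (Category.assoc _ _ _).symm
  | nil hq => exact .nil (hp.trans hq)
  | cons _ h => exact .cons (h hp)

theorem node_inv {A B : Tree D} {l₁ l₂ : List ℕ} {s : X'.obj ⟶ A.obj ⊗ B.obj}
    (h : SubM 𝔡 ρ τ l' X' (l₂ ++ l₁) (.node A B) s) (e : l₂.length = B.leaves.length) :
    ∃ (l₁' l₂' : List ℕ) (X₁' X₂' : Tree D) (p : X'.obj ⟶ X₁'.obj ⊗ X₂'.obj)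
      (s₁ : X₁'.obj ⟶ A.obj) (s₂ : X₂'.obj ⟶ B.obj),
      Coh l' X' (l₂' ++ l₁') (.node X₁' X₂') p ∧ SubM 𝔡 ρ τ l₁' X₁' l₁ A s₁ ∧
        SubM 𝔡 ρ τ l₂' X₂' l₂ B s₂ ∧ s = p ≫ (s₁ ⊗ₘ s₂) := by
  generalize e' : l₂ ++ l₁ = l at h
  cases h with
  | node hp h₁ h₂ =>
    obtain ⟨rfl, rfl⟩ := List.append_inj e' (e.trans h₂.length.symm)
    exact ⟨_, _, _, _, _, _, _, hp, h₁, h₂, rfl⟩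

theorem nil_inv {s : X'.obj ⟶ 𝟙_ _} (h : SubM 𝔡 ρ τ l' X' l (.lst []) s) :
    Coh l' X' [] (.lst []) s := by
  cases h with
  | nil h => exact h

theorem leaf_inv {S : STy D} {j : ℕ} {s : X'.obj ⟶ S.el}
    (h : SubM 𝔡 ρ τ l' X' [j] (.leaf S) s) : Den 𝔡 ρ (τ j) l' X' S s := by
  generalize e : [j] = l at h
  cases h with
  | leaf h =>
    obtain rfl := (List.cons.inj e).1
    exact h

/-- A substitution can be pushed through every canonical morphism by naturality of the generators.
Whenever entries are regrouped, the contexts of the substituted terms are regrouped in the same way.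
-/
theorem comp {s : X'.obj ⟶ X.obj} (h : SubM 𝔡 ρ τ l' X' l X s) {p : X.obj ⟶ Y.obj}
    (hp : Coh l X m Y p) : SubM 𝔡 ρ τ l' X' m Y (s ≫ p) := by
  induction hp generalizing l' X' with
  | refl => exact h.of_eq (Category.comp_id _)
  | trans _ _ ih ih' => exact (ih' (ih h)).of_eq (Category.assoc _ _ _).symm
  | whiskerRight _ e ih =>
    obtain ⟨_, _, _, _, p, s₁, s₂, hp, h₁, h₂, rfl⟩ := h.node_inv e
    refine of_eq (.node hp (ih h₁) h₂) ?_
    have key {C : Type u} [Category.{v} C] [MonoidalCategory C] {P A₁ B₁ A B A' : C}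
      (p : P ⟶ A₁ ⊗ B₁) (s₁ : A₁ ⟶ A) (s₂ : B₁ ⟶ B) (q : A ⟶ A') :
      (p ≫ (s₁ ⊗ₘ s₂)) ≫ q ▷ B = p ≫ (s₁ ≫ q ⊗ₘ s₂) := by
      rw [Category.assoc, ← tensorHom_id, MonoidalCategory.tensorHom_comp_tensorHom,
        Category.comp_id]
    exact key _ _ _ _
  | whiskerLeft e hq ih =>
    obtain ⟨_, _, _, _, p, s₁, s₂, hp, h₁, h₂, rfl⟩ := h.node_inv hq.length.1
    refine of_eq (.node hp h₁ (ih h₂)) ?_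
    have key {C : Type u} [Category.{v} C] [MonoidalCategory C] {P A₁ B₁ A B B' : C}
      (p : P ⟶ A₁ ⊗ B₁) (s₁ : A₁ ⟶ A) (s₂ : B₁ ⟶ B) (q : B ⟶ B') :
      (p ≫ (s₁ ⊗ₘ s₂)) ≫ A ◁ q = p ≫ (s₁ ⊗ₘ s₂ ≫ q) := by
      rw [Category.assoc, ← id_tensorHom, MonoidalCategory.tensorHom_comp_tensorHom,
        Category.comp_id]
    exact key _ _ _ _
  | @assoc l A₁ A₂ A₃ e =>
    obtain ⟨l₃, l, rfl, e₃⟩ : ∃ l₃ l', l = l₃ ++ l' ∧ l₃.length = A₃.leaves.length :=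
      ⟨l.take A₃.leaves.length, l.drop A₃.leaves.length, by simp, by simp; omega⟩
    obtain ⟨l₂, l₁, rfl, e₂⟩ : ∃ l₂ l₁, l = l₂ ++ l₁ ∧ l₂.length = A₂.leaves.length :=
      ⟨l.take A₂.leaves.length, l.drop A₂.leaves.length, by simp, by simp at e ⊢; omega⟩
    obtain ⟨_, _, _, _, p, s₁₂, s₃, hp, h₁₂, h₃, rfl⟩ := h.node_inv e₃
    obtain ⟨_, _, _, _, q, s₁, s₂, hq, h₁, h₂, rfl⟩ := h₁₂.node_inv e₂
    rw [← List.append_assoc]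
    have hr := hp.trans (.trans (.whiskerRight hq h₃.length')
      (.assoc (by simp [h₁.length', h₂.length', h₃.length']; omega)))
    rw [← List.append_assoc] at hr
    refine of_eq (.node hr h₁ (.node (.refl (by
      simp [Tree.leaves, h₂.length', h₃.length'])) h₂ h₃)) ?_
    have key {C : Type u} [Category.{v} C] [MonoidalCategory C] {P Q B₁ B₂ B₃ A₁ A₂ A₃ : C}
      (p : P ⟶ Q ⊗ B₃) (q : Q ⟶ B₁ ⊗ B₂) (s₁ : B₁ ⟶ A₁) (s₂ : B₂ ⟶ A₂) (s₃ : B₃ ⟶ A₃) :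
      (p ≫ (q ≫ (s₁ ⊗ₘ s₂) ⊗ₘ s₃)) ≫ (α_ A₁ A₂ A₃).hom =
        (p ≫ q ▷ B₃ ≫ (α_ _ _ _).hom) ≫ (s₁ ⊗ₘ 𝟙 _ ≫ (s₂ ⊗ₘ s₃)) := by
      have : q ≫ (s₁ ⊗ₘ s₂) ⊗ₘ s₃ = q ▷ B₃ ≫ ((s₁ ⊗ₘ s₂) ⊗ₘ s₃) := by
        rw [← tensorHom_id, MonoidalCategory.tensorHom_comp_tensorHom, Category.id_comp]
      rw [this, Category.assoc, Category.assoc, associator_naturality, Category.id_comp,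
        Category.assoc, Category.assoc]
    exact key _ _ _ _ _
  | @assocInv l A₁ A₂ A₃ e =>
    obtain ⟨l₃, l, rfl, e₃⟩ : ∃ l₃ l', l = l₃ ++ l' ∧ l₃.length = A₃.leaves.length :=
      ⟨l.take A₃.leaves.length, l.drop A₃.leaves.length, by simp, by simp; omega⟩
    obtain ⟨l₂, l₁, rfl, e₂⟩ : ∃ l₂ l₁, l = l₂ ++ l₁ ∧ l₂.length = A₂.leaves.length :=
      ⟨l.take A₂.leaves.length, l.drop A₂.leaves.length, by simp, by simp at e ⊢; omega⟩
    rw [← List.append_assoc] at h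
    obtain ⟨_, _, _, _, p, s₁, s₂₃, hp, h₁, h₂₃, rfl⟩ :=
      h.node_inv (by simp [Tree.leaves, e₂, e₃])
    obtain ⟨_, _, _, _, q, s₂, s₃, hq, h₂, h₃, rfl⟩ := h₂₃.node_inv e₃
    have hr := hp.trans (.trans (.whiskerLeft h₁.length' hq)
      (.assocInv (by simp [h₁.length', h₂.length', h₃.length', add_assoc])))
    rw [List.append_assoc] at hr
    refine of_eq (.node hr (.node (.refl (by
      simp [Tree.leaves, h₁.length', h₂.length'])) h₁ h₂) h₃) ?_
    have key {C : Type u} [Category.{v} C] [MonoidalCategory C] {P Q B₁ B₂ B₃ A₁ A₂ A₃ : C}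
      (p : P ⟶ B₁ ⊗ Q) (q : Q ⟶ B₂ ⊗ B₃) (s₁ : B₁ ⟶ A₁) (s₂ : B₂ ⟶ A₂) (s₃ : B₃ ⟶ A₃) :
      (p ≫ (s₁ ⊗ₘ q ≫ (s₂ ⊗ₘ s₃))) ≫ (α_ A₁ A₂ A₃).inv =
        (p ≫ B₁ ◁ q ≫ (α_ _ _ _).inv) ≫ (𝟙 _ ≫ (s₁ ⊗ₘ s₂) ⊗ₘ s₃) := by
      have : s₁ ⊗ₘ q ≫ (s₂ ⊗ₘ s₃) = B₁ ◁ q ≫ (s₁ ⊗ₘ (s₂ ⊗ₘ s₃)) := by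
        rw [← id_tensorHom, MonoidalCategory.tensorHom_comp_tensorHom, Category.id_comp]
      rw [this, Category.assoc, Category.assoc, associator_inv_naturality, Category.id_comp,
        Category.assoc, Category.assoc]
    exact key _ _ _ _ _
  | @leftUnitor l A e =>
    rw [← l.append_nil] at h
    obtain ⟨_, _, _, _, p, s₁, s₂, hp, h₁, h₂, rfl⟩ := h.node_inv e
    have hr := hp.trans (.trans (.whiskerRight h₁.nil_inv h₂.length') (by
      rw [List.append_nil]; exact .leftUnitor h₂.length'))
    refine (h₂.coh hr).of_eq ?_
    have key {C : Type u} [Category.{v} C] [MonoidalCategory C] {P Q B A : C}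
      (p : P ⟶ Q ⊗ B) (q : Q ⟶ 𝟙_ C) (s : B ⟶ A) :
      (p ≫ (q ⊗ₘ s)) ≫ (λ_ A).hom = (p ≫ q ▷ B ≫ (λ_ B).hom) ≫ s := by
      simp [MonoidalCategory.tensorHom_def]
    exact key _ _ _
  | @leftUnitorInv l A e =>
    rw [← l.append_nil]
    refine of_eq (.node (l₁' := []) (l₂' := l') (X₁' := .lst []) (X₂' := X') (by
      rw [List.append_nil]; exact .leftUnitorInv h.length') (.nil (.refl rfl)) h) ?_
    have key {C : Type u} [Category.{v} C] [MonoidalCategory C] {B A : C} (s : B ⟶ A) :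
      s ≫ (λ_ A).inv = (λ_ B).inv ≫ (𝟙 _ ⊗ₘ s) := by simp
    exact key _
  | @rightUnitor l A e =>
    obtain ⟨_, _, _, _, p, s₁, s₂, hp, h₁, h₂, rfl⟩ := node_inv (l₂ := []) h rfl
    have hr := hp.trans (.trans (.whiskerLeft h₁.length' h₂.nil_inv) (.rightUnitor h₁.length'))
    refine (h₁.coh hr).of_eq ?_
    have key {C : Type u} [Category.{v} C] [MonoidalCategory C] {P Q B A : C}
      (p : P ⟶ B ⊗ Q) (q : Q ⟶ 𝟙_ C) (s : B ⟶ A) :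
      (p ≫ (s ⊗ₘ q)) ≫ (ρ_ A).hom = (p ≫ B ◁ q ≫ (ρ_ B).hom) ≫ s := by
      simp [MonoidalCategory.tensorHom_def']
    exact key _ _ _
  | @rightUnitorInv l A e =>
    refine of_eq (.node (l₁' := l') (l₂' := []) (l₂ := []) (X₁' := X') (X₂' := .lst [])
      (.rightUnitorInv h.length') h (.nil (.refl rfl))) ?_
    have key {C : Type u} [Category.{v} C] [MonoidalCategory C] {B A : C} (s : B ⟶ A) :
      s ≫ (ρ_ A).inv = (ρ_ B).inv ≫ (s ⊗ₘ 𝟙 _) := by simp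
    exact key _
  | swap i j S T =>
    obtain ⟨_, _, _, _, p, s₁, s₂, hp, h₁, h₂, rfl⟩ := node_inv (l₂ := [j]) (l₁ := [i]) h rfl
    refine of_eq (.node (l₁ := [j]) (l₂ := [i]) (hp.trans (.braid h₁.length' h₂.length')) h₂ h₁) ?_
    have key {C : Type u} [Category.{v} C] [MonoidalCategory C] [BraidedCategory C] {P Q B A A' : C}
      (p : P ⟶ B ⊗ Q) (s₁ : B ⟶ A) (s₂ : Q ⟶ A') :
      (p ≫ (s₁ ⊗ₘ s₂)) ≫ (β_ A A').hom = (p ≫ (β_ B Q).hom) ≫ (s₂ ⊗ₘ s₁) := by simp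
    exact key _ _ _
  | cons e =>
    cases h with
    | cons h => exact h.of_eq (Category.comp_id _)
  | uncons e => exact .cons (h.of_eq (Category.comp_id _))

theorem lift {s : X'.obj ⟶ X.obj} (h : SubM 𝔡 ρ τ l' X' l X s) :
    SubM 𝔡 ρ (Tm.liftSub₂ τ) (l'.map (· + 2)) X' (l.map (· + 2)) X s := by
  induction h with
  | leaf h => exact .leaf (h.lren _)
  | node hq _ _ h₁ h₂ =>
    rw [List.map_append]
    exact .node (by simpa using hq.map (· + 2)) h₁ h₂
  | nil hq => exact .nil (hq.map _)
  | cons _ h => exact .cons h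

/-- Replacing variables by variables merely relabels the context. It supplies the part of a context
that a substitution leaves alone. -/
theorem id_of_lvar (r : ℕ → ℕ) (h : l.length = X.leaves.length)
    (hr : ∀ j ∈ l, τ j = .lvar (r j)) : SubM 𝔡 ρ τ (l.map r) X l X (𝟙 _) := by
  have key {C : Type u} [Category.{v} C] [MonoidalCategory C] (A B : C) :
      𝟙 (A ⊗ B) = 𝟙 (A ⊗ B) ≫ (𝟙 A ⊗ₘ 𝟙 B) := by simp
  have leaf (j : ℕ) (S : STy D) (hj : τ j = .lvar (r j)) :
      SubM 𝔡 ρ τ [r j] (.leaf S) [j] (.leaf S) (𝟙 _) := by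
    refine .leaf ?_
    rw [hj]
    exact .lvar (.refl rfl)
  induction X generalizing l with
  | lst X =>
    induction X generalizing l with
    | nil =>
      obtain rfl : l = [] := List.length_eq_zero_iff.1 h
      exact .nil (.refl rfl)
    | cons S X ih =>
      obtain _ | ⟨j, l⟩ := l
      · simp [Tree.leaves] at h
      have h : l.length = X.length := by simpa [Tree.leaves] using h
      refine .cons (.of_eq (.node (l₂ := [j]) (l₂' := [r j]) (l₁ := l) (l₁' := l.map r)
        (.cons (by simpa using h)) (ih h fun j hj => hr j (by simp [hj]))
        (leaf j S (hr j (by simp)))) ?_)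
      exact key _ _
  | leaf S =>
    obtain ⟨j, rfl⟩ := List.length_eq_one_iff.1 h
    exact leaf j S (hr j (by simp))
  | node A B hA hB =>
    obtain ⟨l₂, l₁, rfl, e₂⟩ : ∃ l₂ l₁, l = l₂ ++ l₁ ∧ l₂.length = B.leaves.length :=
      ⟨l.take B.leaves.length, l.drop B.leaves.length, by simp, by simp [Tree.leaves] at h ⊢; omega⟩
    have e₁ : l₁.length = A.leaves.length := by simpa [Tree.leaves, e₂] using h
    rw [List.map_append]
    refine .of_eq (.node (.refl (by simp [Tree.leaves, e₁, e₂]))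
      (hA e₁ fun j hj => hr j (by simp [hj])) (hB e₂ fun j hj => hr j (by simp [hj]))) ?_
    exact key _ _

end SubM

/-- By `SubM.comp` the substitution passes through the canonical morphism of each node and is then
split along the blocks by `SubM.node_inv`, so the induction hypotheses apply to the subterms. -/
theorem Den.lsub {𝔡 : Denot 𝔽 M} {ρ : List (Sec D)} {τ : ℕ → Tm 𝔽} {l l' : List ℕ} {X X' : Tree D}
    {c : Tm 𝔽} {S : STy D} {g : X.obj ⟶ S.el} (h : Den 𝔡 ρ c l X S g) {s : X'.obj ⟶ X.obj}
    (hs : SubM 𝔡 ρ τ l' X' l X s) : Den 𝔡 ρ (c.lsub τ) l' X' S (s ≫ g) := by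
  induction h generalizing τ l' X' with
  | ivar hv hq => exact .of_eq (.ivar hv (hs.comp hq).nil_inv) (Category.assoc _ _ _).symm
  | lvar hq => exact (hs.comp hq).leaf_inv
  | con c hu hv _ _ ih => exact .of_eq (.con c hu hv (ih hs)) (Category.assoc _ _ _).symm
  | star hq => exact .star (hs.comp hq).nil_inv
  | letU hq ht _ iht iha =>
    obtain ⟨_, _, _, _, p, s₁, s₂, hp, h₁, h₂, e⟩ := (hs.comp hq).node_inv ht.length
    exact .of_eq (.letU hp (iht h₂) (iha h₁)) (letU_congr e _ _).symm
  | tens hq _ ht iha iht =>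
    obtain ⟨_, _, _, _, p, s₁, s₂, hp, h₁, h₂, e⟩ := (hs.comp hq).node_inv ht.length
    exact .of_eq (.tens hp (iha h₁) (iht h₂)) (tens_congr e _ _).symm
  | @letT _ _ _ _ _ _ _ _ S T _ _ _ _ hq ht _ iht ihc =>
    obtain ⟨_, _, X₁', _, p, s₁, s₂, hp, h₁, h₂, e⟩ := (hs.comp hq).node_inv ht.length
    have leaf (j : ℕ) (S : STy D) (hj : Tm.liftSub₂ τ j = .lvar j) :
        SubM 𝔡 ρ (Tm.liftSub₂ τ) [j] (.leaf S) [j] (.leaf S) (𝟙 _) := by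
      refine .leaf ?_
      rw [hj]
      exact .lvar (.refl rfl)
    have e₁ := h₁.length'
    -- Under the binders the lifted substitution is extended by the identity on the two bound
    -- variables, labelled 1 and 0.
    have hc := ihc (.node (l₂ := [0]) (l₂' := [0]) (.refl (by simp [Tree.leaves, e₁]))
      (.node (l₂ := [1]) (l₂' := [1]) (.refl (by simp [Tree.leaves, e₁])) h₁.lift (leaf 1 S rfl))
      (leaf 0 T rfl))
    refine .of_eq (.letT hp (iht h₂) hc) ?_
    refine (letT_congr e _ _).symm.trans ?_
    have key {C : Type u} [Category.{v} C] [MonoidalCategory C] {P A A' B S T R : C}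
      (p : P ⟶ A' ⊗ B) (f : B ⟶ S ⊗ T) (r : A' ⟶ A) (g : (A ⊗ S) ⊗ T ⟶ R) :
      p ≫ A' ◁ f ≫ (α_ A' S T).inv ≫ r ▷ S ▷ T ≫ g = p ≫ A' ◁ f ≫ (α_ A' S T).inv ≫
        (𝟙 _ ≫ (𝟙 _ ≫ (r ⊗ₘ 𝟙 S) ⊗ₘ 𝟙 T)) ≫ g := by simp
    exact key _ _ _ _

theorem split_range (X X' : List (STy D)) :
    Coh (List.range (X' ++ X).length) (.lst (X' ++ X))
      (List.range X'.length ++ (List.range X.length).map (· + X'.length))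
      (.node (.lst X) (.lst X')) (split X X').hom := by
  have := Coh.split (l := (List.range X.length).map (· + X'.length)) (X := X)
    (l₂ := List.range X'.length) (X₂ := X') (by simp) (by simp)
  rw [List.length_append, List.range_add]
  simpa [add_comm] using this

/-- The substitution is the identity on `X` and `f` on the last entry. Variables of `X` have indices
`j + 1` before and `j + X'.length` after it, which gives the renaming used below. -/
theorem ITm.lsub_linSub {𝔡 : Denot 𝔽 M} {ρ : List (Sec D)} {a b : Tm 𝔽} {X X' : List (STy D)}
    {S T : STy D} {f : linObj X' ⟶ S.el} {g : linObj (S :: X) ⟶ T.el} (ha : ITm 𝔡 ρ X' a S f)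
    (hb : ITm 𝔡 ρ (S :: X) b T g) :
    ITm 𝔡 ρ (X' ++ X) (b.lsub (linSub X'.length a)) T ((split X X').hom ≫ linObj X ◁ f ≫ g) := by
  rw [itm_iff_den] at ha hb ⊢
  have hX : SubM 𝔡 ρ (linSub X'.length a) ((List.range X.length).map (· + X'.length)) (.lst X)
      ((List.range X.length).map (· + 1)) (.lst X) (𝟙 _) := by
    have := SubM.id_of_lvar (𝔡 := 𝔡) (ρ := ρ) (τ := linSub X'.length a) (X := .lst X)
      (l := (List.range X.length).map (· + 1)) (fun j => j - 1 + X'.length)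
      (by simp [Tree.leaves]) (by simp [linSub])
    simpa [Function.comp_def] using this
  have hs := SubM.cons (.node (l₂ := [0]) (split_range X X') hX (.leaf (j := 0) ha))
  rw [List.length_cons, List.range_succ_eq_map] at hb
  refine .of_eq (hb.lsub hs) ?_
  have key {C : Type u} [Category.{v} C] [MonoidalCategory C] {P A B S R : C}
      (p : P ⟶ A ⊗ B) (f : B ⟶ S) (g : A ⊗ S ⟶ R) :
      p ≫ A ◁ f ≫ g = (p ≫ (𝟙 _ ⊗ₘ f)) ≫ g := by simp
  exact key _ _ _

/-- Composing the two splittings and reassociating gives exactly a substitution of `a` and `b` for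
the two bound variables, so the claim reduces to `Den.lsub`. -/
theorem Den.letT_tens {𝔡 : Denot 𝔽 M} {ρ : List (Sec D)} {a b c : Tm 𝔽} {l : List ℕ} {X : Tree D}
    {R : STy D} {f : X.obj ⟶ R.el} (h : Den 𝔡 ρ (.letT (.tens a b) c) l X R f) :
    Den 𝔡 ρ (c.lsub (linSub₂ a b)) l X R f := by
  cases h with
  | @letT _ l₁ _ _ X₁ _ _ _ S T _ p _ _ hp ht hc =>
    cases ht with
    | @tens _ m₁ m₂ _ Y₁ Y₂ _ _ _ _ q fa fb hq ha hb =>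
      have e₁ : l₁.length = X₁.leaves.length := by
        have := hp.length.2
        have := hq.length
        simp only [Tree.leaves, List.length_append] at *
        omega
      have hr := hp.trans (.trans (.whiskerLeft e₁ hq)
        (.assocInv (by simp [e₁, ha.length, hb.length]; omega)))
      rw [List.append_assoc] at hr
      have hX : SubM 𝔡 ρ (linSub₂ a b) l₁ X₁ (l₁.map (· + 2)) X₁ (𝟙 _) := by
        have := SubM.id_of_lvar (𝔡 := 𝔡) (ρ := ρ) (τ := linSub₂ a b) (X := X₁)
          (l := l₁.map (· + 2)) (fun j => j - 2) (by simpa using e₁) (by simp [linSub₂])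
        simpa [Function.comp_def] using this
      have hs : SubM 𝔡 ρ (linSub₂ a b) _ _ ([0] ++ ([1] ++ l₁.map (· + 2))) _ _ :=
        .node hr (.node (.refl (by simp [Tree.leaves, e₁, ha.length])) hX (.leaf ha)) (.leaf hb)
      refine .of_eq (hc.lsub hs) ?_
      have key {C : Type u} [Category.{v} C] [MonoidalCategory C] {P A B B₁ B₂ S T R : C}
          (p : P ⟶ A ⊗ B) (q : B ⟶ B₁ ⊗ B₂) (fa : B₁ ⟶ S) (fb : B₂ ⟶ T) (g : (A ⊗ S) ⊗ T ⟶ R) :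
          p ≫ A ◁ (q ≫ (fa ⊗ₘ fb)) ≫ (α_ A S T).inv ≫ g =
            ((p ≫ A ◁ q ≫ (α_ _ _ _).inv) ≫ (𝟙 _ ≫ (𝟙 A ⊗ₘ fa) ⊗ₘ fb)) ≫ g := by
        simp only [Category.assoc, Category.id_comp, MonoidalCategory.whiskerLeft_comp]
        rw [← associator_inv_naturality_assoc, id_tensorHom]
      exact key _ _ _ _ _

end ILDTT

namespace ILDTT
open Model

/-! ## Computation and uniqueness rules -/

section
variable {C : Type u} [Category.{v} C] [MonoidalCategory C]

theorem comp_tensor {A A' A'' B B' : C} (f : A ⟶ A') (g : A' ⟶ A'') (h : B ⟶ B') :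
    (f ≫ g ⊗ₘ h) = f ▷ B ≫ (g ⊗ₘ h) := by
  rw [← tensorHom_id, MonoidalCategory.tensorHom_comp_tensorHom, Category.id_comp]

theorem tensor_comp_left {A A' B B' B'' : C} (h : A ⟶ A') (f : B ⟶ B') (g : B' ⟶ B'') :
    (h ⊗ₘ f ≫ g) = A ◁ f ≫ (h ⊗ₘ g) := by
  rw [← id_tensorHom, MonoidalCategory.tensorHom_comp_tensorHom, Category.id_comp]

theorem tensor_comp_whiskerRight {A A' A'' B B' : C} (f : A ⟶ A') (g : A' ⟶ A'') (h : B ⟶ B') :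
    (f ≫ g ⊗ₘ h) = (f ⊗ₘ h) ≫ g ▷ B' := by
  rw [← tensorHom_id, MonoidalCategory.tensorHom_comp_tensorHom, Category.comp_id]

theorem tensor_comp_whiskerLeft {A A' B B' B'' : C} (h : A ⟶ A') (f : B ⟶ B') (g : B' ⟶ B'') :
    (h ⊗ₘ f ≫ g) = (h ⊗ₘ f) ≫ A' ◁ g := by
  rw [← id_tensorHom, MonoidalCategory.tensorHom_comp_tensorHom, Category.comp_id]

/-- The commuting conversion for a hole in the second block: reassociating frees the context of `t`.
The morphism `k` stands for the surrounding construct. -/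
theorem letU_right {P X Y₁ Y₂ A B Q : C} {X₂ : C} (p : P ⟶ X ⊗ X₂) (q : X₂ ⟶ Y₁ ⊗ Y₂) (g : X ⟶ A)
    (e : Y₁ ⟶ B) (t : Y₂ ⟶ 𝟙_ C) (k : A ⊗ B ⟶ Q) :
    (p ≫ X ◁ q ≫ (α_ X Y₁ Y₂).inv) ≫ ((g ⊗ₘ e) ≫ k ⊗ₘ t) ≫ (ρ_ Q).hom =
      p ≫ (g ⊗ₘ q ≫ (e ⊗ₘ t) ≫ (ρ_ B).hom) ≫ k := by
  rw [tensor_comp_whiskerRight, tensor_comp_left, tensor_comp_whiskerLeft]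
  simp only [Category.assoc]
  rw [← associator_inv_naturality_assoc, rightUnitor_naturality, rightUnitor_tensor_hom,
    Category.assoc, Iso.inv_hom_id_assoc]

theorem letT_right {P X Y₁ Y₂ A B Q S T : C} {X₂ : C} (p : P ⟶ X ⊗ X₂) (q : X₂ ⟶ Y₁ ⊗ Y₂)
    (g : X ⟶ A) (t : Y₂ ⟶ S ⊗ T) (e : (Y₁ ⊗ S) ⊗ T ⟶ B) (k : A ⊗ B ⟶ Q) :
    (p ≫ X ◁ q ≫ (α_ X Y₁ Y₂).inv) ≫ (X ⊗ Y₁) ◁ t ≫ (α_ (X ⊗ Y₁) S T).inv ≫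
      ((α_ X Y₁ S).hom ▷ T ≫ (α_ X (Y₁ ⊗ S) T).hom) ≫ (g ⊗ₘ e) ≫ k =
      p ≫ (g ⊗ₘ q ≫ Y₁ ◁ t ≫ (α_ Y₁ S T).inv ≫ e) ≫ k := by
  rw [tensor_comp_left, tensor_comp_left, tensor_comp_left]
  simp

end

section
variable {C : Type u} [Category.{v} C] [MonoidalCategory C] [SymmetricCategory C]

/-- The symmetry of the last two factors. -/
def midSwap (Z Y X : C) : (Z ⊗ Y) ⊗ X ⟶ (Z ⊗ X) ⊗ Y :=
  (α_ Z Y X).hom ≫ Z ◁ (β_ Y X).hom ≫ (α_ Z X Y).inv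

/-- The second factor of four is moved to the end. -/
def binderSwap (Z Y S T : C) : ((Z ⊗ Y) ⊗ S) ⊗ T ⟶ ((Z ⊗ S) ⊗ T) ⊗ Y :=
  (α_ (Z ⊗ Y) S T).hom ≫ midSwap Z Y (S ⊗ T) ≫ (α_ Z S T).inv ▷ Y

theorem midSwap_naturality_right (Z Y : C) {X X' : C} (f : X ⟶ X') :
    (Z ⊗ Y) ◁ f ≫ midSwap Z Y X' = midSwap Z Y X ≫ (Z ◁ f) ▷ Y := by
  simp only [midSwap, Category.assoc]
  rw [associator_naturality_right_assoc, ← MonoidalCategory.whiskerLeft_comp_assoc,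
    BraidedCategory.braiding_naturality_right, MonoidalCategory.whiskerLeft_comp_assoc,
    associator_inv_naturality_middle]

theorem midSwap_naturality_middle (Z : C) {Y Y' : C} (X : C) (f : Y ⟶ Y') :
    (Z ◁ f) ▷ X ≫ midSwap Z Y' X = midSwap Z Y X ≫ (Z ⊗ X) ◁ f := by
  simp only [midSwap, Category.assoc]
  rw [associator_naturality_middle_assoc, ← MonoidalCategory.whiskerLeft_comp_assoc,
    BraidedCategory.braiding_naturality_left, MonoidalCategory.whiskerLeft_comp_assoc,
    associator_inv_naturality_right]

theorem midSwap_midSwap (Z Y X : C) : midSwap Z Y X ≫ midSwap Z X Y = 𝟙 _ := by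
  simp [midSwap, ← MonoidalCategory.whiskerLeft_comp_assoc]

theorem binderSwap_eq (Z Y S T : C) :
    (α_ (Z ⊗ Y) S T).inv ≫ binderSwap Z Y S T = midSwap Z Y (S ⊗ T) ≫ (α_ Z S T).inv ▷ Y := by
  simp [binderSwap]

theorem midSwap_tensor (Z Y X : C) {Z' Y' X' : C} (f : Z ⟶ Z') (g : Y ⟶ Y') (h : X ⟶ X') :
    ((f ⊗ₘ g) ⊗ₘ h) ≫ midSwap Z' Y' X' = midSwap Z Y X ≫ ((f ⊗ₘ h) ⊗ₘ g) := by
  simp only [midSwap, Category.assoc]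
  rw [associator_naturality_assoc, ← associator_inv_naturality]
  simp only [← id_tensorHom, MonoidalCategory.tensorHom_comp_tensorHom_assoc,
    BraidedCategory.braiding_naturality, Category.comp_id, Category.id_comp]

theorem midSwap_unit (B A : C) :
    midSwap B (𝟙_ C) A ≫ (ρ_ (B ⊗ A)).hom = (ρ_ B).hom ▷ A := by
  rw [midSwap, braiding_tensorUnit_left]
  simp

/-- The commuting conversion for a hole in the first block: the context of `t` has to move past the
second block, whence `midSwap`. -/
theorem letU_left {P X Y₁ Y₂ A B Q : C} {X₁ : C} (p : P ⟶ X₁ ⊗ X) (q : X₁ ⟶ Y₁ ⊗ Y₂) (g : X ⟶ A)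
    (e : Y₁ ⟶ B) (t : Y₂ ⟶ 𝟙_ C) (k : B ⊗ A ⟶ Q) :
    (p ≫ q ▷ X ≫ midSwap Y₁ Y₂ X) ≫ ((e ⊗ₘ g) ≫ k ⊗ₘ t) ≫ (ρ_ Q).hom =
      p ≫ (q ≫ (e ⊗ₘ t) ≫ (ρ_ B).hom ⊗ₘ g) ≫ k := by
  rw [tensor_comp_whiskerRight, comp_tensor, tensor_comp_whiskerRight]
  simp only [Category.assoc]
  rw [← reassoc_of% midSwap_tensor, rightUnitor_naturality, reassoc_of% midSwap_unit]

theorem letT_left {P X Y₁ Y₂ A B Q S T : C} {X₁ : C} (p : P ⟶ X₁ ⊗ X) (q : X₁ ⟶ Y₁ ⊗ Y₂)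
    (g : X ⟶ A) (t : Y₂ ⟶ S ⊗ T) (e : (Y₁ ⊗ S) ⊗ T ⟶ B) (k : B ⊗ A ⟶ Q) :
    (p ≫ q ▷ X ≫ midSwap Y₁ Y₂ X) ≫ (Y₁ ⊗ X) ◁ t ≫ (α_ (Y₁ ⊗ X) S T).inv ≫
      binderSwap Y₁ X S T ≫ (e ⊗ₘ g) ≫ k =
      p ≫ (q ≫ Y₁ ◁ t ≫ (α_ Y₁ S T).inv ≫ e ⊗ₘ g) ≫ k := by
  rw [comp_tensor, comp_tensor, comp_tensor, reassoc_of% binderSwap_eq]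
  simp only [Category.assoc]
  rw [← reassoc_of% midSwap_naturality_middle, reassoc_of% midSwap_midSwap]

/-- The commuting conversion for a hole under a binder. The morphism `r` splits off the context `Y`
of `t` before the variables of types `S` and `T` are bound. -/
theorem letU_bind {P X₁ X₂ Z Y Y₁ S T Q : C} (p : P ⟶ X₁ ⊗ X₂) (r : X₁ ⟶ Z ⊗ Y) (f : X₂ ⟶ S ⊗ T)
    (u : (Z ⊗ S) ⊗ T ⟶ Y₁) (e : Y₁ ⟶ Q) (t : Y ⟶ 𝟙_ C) :
    (p ≫ r ▷ X₂ ≫ midSwap Z Y X₂) ≫ (𝟙 _ ≫ Z ◁ f ≫ (α_ Z S T).inv ≫ u ≫ e ⊗ₘ t) ≫ (ρ_ Q).hom =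
      p ≫ X₁ ◁ f ≫ (α_ X₁ S T).inv ≫ (r ▷ S ▷ T ≫ binderSwap Z Y S T ≫ u ▷ Y) ≫
        (e ⊗ₘ t) ≫ (ρ_ Q).hom := by
  rw [Category.id_comp, comp_tensor, comp_tensor, comp_tensor]
  simp only [Category.assoc]
  rw [← reassoc_of% midSwap_naturality_right, ← associator_inv_naturality_left_assoc,
    reassoc_of% binderSwap_eq, whisker_exchange_assoc]

/-- Here the inner `let` binds variables too, so besides splitting off `Y` early the two pairs of
bound variables are interchanged. -/
theorem letT_bind {P X₁ X₂ Z Y Y₁ S T S' T' Q : C} (p : P ⟶ X₁ ⊗ X₂) (r : X₁ ⟶ Z ⊗ Y)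
    (f : X₂ ⟶ S ⊗ T) (u : (Z ⊗ S) ⊗ T ⟶ Y₁) (t : Y ⟶ S' ⊗ T') (e : (Y₁ ⊗ S') ⊗ T' ⟶ Q) :
    (p ≫ r ▷ X₂ ≫ midSwap Z Y X₂) ≫ (Z ⊗ X₂) ◁ t ≫ (α_ (Z ⊗ X₂) S' T').inv ≫
      binderSwap Z X₂ S' T' ≫ ((Z ⊗ S') ⊗ T') ◁ f ≫ (α_ ((Z ⊗ S') ⊗ T') S T).inv ≫
        ((α_ Z S' T').hom ▷ S ▷ T ≫ binderSwap Z (S' ⊗ T') S T ≫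
          (α_ ((Z ⊗ S) ⊗ T) S' T').inv) ≫ u ▷ S' ▷ T' ≫ e =
      p ≫ X₁ ◁ f ≫ (α_ X₁ S T).inv ≫ (r ▷ S ▷ T ≫ binderSwap Z Y S T ≫ u ▷ Y) ≫
        Y₁ ◁ t ≫ (α_ Y₁ S' T').inv ≫ e := by
  simp only [Category.assoc]
  rw [← associator_inv_naturality_left_assoc (α_ Z S' T').hom, reassoc_of% binderSwap_eq,
    ← associator_inv_naturality_left_assoc r, reassoc_of% binderSwap_eq,
    reassoc_of% binderSwap_eq, ← whisker_exchange_assoc _ f, inv_hom_whiskerRight_assoc,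
    ← reassoc_of% midSwap_naturality_middle, reassoc_of% midSwap_midSwap,
    whisker_exchange_assoc r f, reassoc_of% midSwap_naturality_right,
    ← associator_inv_naturality_left_assoc u, ← whisker_exchange_assoc u t,
    ← whisker_exchange_assoc (α_ Z S T).inv t, ← reassoc_of% midSwap_naturality_middle,
    whisker_exchange_assoc (Z ◁ t) f, reassoc_of% midSwap_naturality_right]

end

variable {𝔽 : Symbols.{w}} {M : Model.{v₁, u₁, v, u}} {D : M.𝒞}

namespace Den
variable {𝔡 : Denot 𝔽 M} {ρ : List (Sec D)} {a t c : Tm 𝔽} {l : List ℕ} {X : Tree D} {S : STy D}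
  {f : X.obj ⟶ S.el}

theorem letU_star (h : Den 𝔡 ρ (.letU .star a) l X S f) : Den 𝔡 ρ a l X S f := by
  cases h with
  | letU hp ht ha =>
    cases ht with
    | star hq =>
      refine of_eq (ha.coh (hp.trans (.trans (.whiskerLeft ha.length hq)
        (.rightUnitor ha.length)))) ?_
      have key {C : Type u} [Category.{v} C] [MonoidalCategory C] {P A B S : C}
        (p : P ⟶ A ⊗ B) (q : B ⟶ 𝟙_ C) (g : A ⟶ S) :
        p ≫ (g ⊗ₘ q) ≫ (ρ_ S).hom = (p ≫ A ◁ q ≫ (ρ_ A).hom) ≫ g := by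
        simp [MonoidalCategory.tensorHom_def']
      exact key _ _ _

theorem letU_eta (h : Den 𝔡 ρ (.letU t .star) l X S f) : Den 𝔡 ρ t l X S f := by
  cases h with
  | letU hp ht ha =>
    cases ha with
    | star hq =>
      refine of_eq (ht.coh (hp.trans (.trans (.whiskerRight hq ht.length) (by
        rw [List.append_nil]; exact .leftUnitor ht.length)))) ?_
      have key {C : Type u} [Category.{v} C] [MonoidalCategory C] {P A B : C}
        (p : P ⟶ A ⊗ B) (q : A ⟶ 𝟙_ C) (f : B ⟶ 𝟙_ C) :
        p ≫ (q ⊗ₘ f) ≫ (ρ_ (𝟙_ C)).hom = (p ≫ q ▷ B ≫ (λ_ B).hom) ≫ f := by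
        rw [← unitors_equal]
        simp [MonoidalCategory.tensorHom_def]
      exact key _ _ _

/-- The body uses its two bound variables and nothing else, so the rest `X₁` of its context has no
entries. By coherence the body is then the canonical isomorphism that discards this unit. -/
theorem letT_eta (h : Den 𝔡 ρ (.letT t (.tens (.lvar 1) (.lvar 0))) l X S f) :
    Den 𝔡 ρ t l X S f := by
  cases h with
  | @letT _ l₁ l₂ _ X₁ X₂ _ _ S T _ p ft _ hp ht hc =>
    cases hc with
    | @tens _ m₁ m₂ _ Y₁ Y₂ _ _ S' T' q f₁ f₂ hq h₁ h₂ =>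
      cases h₁ with
      | lvar h₁ =>
        cases h₂ with
        | lvar h₂ =>
          have hr := hq.trans (h₁.tensor h₂)
          have hz := hr.perm_zip
          have e₁ := hr.length.1
          simp only [Tree.leaves, List.cons_append, List.nil_append, List.zip_cons_cons,
            List.length_cons, List.length_map] at hz e₁
          have hn := hz.length_eq
          simp only [List.length_cons, List.length_zip, List.length_map, List.length_nil,
            List.zip_nil_left] at hn
          -- Counting entries: the body splits its context into two single variables.
          obtain rfl : l₁ = [] := List.length_eq_zero_iff.1 (by omega)
          have e₂ : X₁.leaves = [] := List.length_eq_zero_iff.1 (by simpa using e₁.symm)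
          rw [e₂] at hz
          -- Labels 0 and 1 occur once on each side, so the types `S'` and `T'` of the body are `S`
          -- and `T`.
          have hz₀ := hz.subset (List.mem_cons_self)
          have hz₁ := hz.subset (List.mem_cons_of_mem _ (List.mem_cons_self))
          simp at hz₀ hz₁
          subst hz₀ hz₁
          obtain ⟨u, hu⟩ : ∃ u, Coh [] X₁ [] (.lst []) u := by
            have := Coh.exists_lst X₁ (l := []) (by simp [e₂])
            rwa [e₂] at this
          have hs : Coh [0, 1] (.node (.node X₁ (.leaf S)) (.leaf T)) [0, 1]
              (.node (.leaf S) (.leaf T)) _ :=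
            (Coh.whiskerRight (l₂ := [0]) (.whiskerRight (l₂ := [1]) hu rfl) rfl).trans
              (.whiskerRight (l₂ := [0]) (.leftUnitor (l := [1]) rfl) rfl)
          have e := hr.unique hs (by simp)
          refine of_eq (ht.coh (hp.trans (.trans (.whiskerRight hu ht.length) (by
            rw [List.append_nil]; exact .leftUnitor ht.length)))) ?_
          have key {C : Type u} [Category.{v} C] [MonoidalCategory C] {P A B S T : C}
            (p : P ⟶ A ⊗ B) (f : B ⟶ S ⊗ T) (u : A ⟶ 𝟙_ C) {r : (A ⊗ S) ⊗ T ⟶ S ⊗ T}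
            (e : r = u ▷ S ▷ T ≫ (λ_ S).hom ▷ T) :
            p ≫ A ◁ f ≫ (α_ A S T).inv ≫ r = (p ≫ u ▷ B ≫ (λ_ B).hom) ≫ f := by
            rw [e, ← associator_inv_naturality_left_assoc, whisker_exchange_assoc]
            simp
          exact key _ _ _ e

end Den

end ILDTT

namespace ILDTT
open Model

/-! ## Commuting conversions -/

variable {𝔽 : Symbols.{w}} {M : Model.{v₁, u₁, v, u}} {D : M.𝒞}

namespace Coh
variable {l l₁ l₂ : List ℕ}

theorem assoc' {l₃ : List ℕ} {A₁ A₂ A₃ : Tree D} (h₁ : l₁.length = A₁.leaves.length)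
    (h₂ : l₂.length = A₂.leaves.length) (h₃ : l₃.length = A₃.leaves.length) :
    Coh (l₃ ++ (l₂ ++ l₁)) (.node (.node A₁ A₂) A₃) ((l₃ ++ l₂) ++ l₁) (.node A₁ (.node A₂ A₃))
      (α_ A₁.obj A₂.obj A₃.obj).hom := by
  rw [List.append_assoc]
  exact .assoc (by simp [h₁, h₂, h₃, add_assoc])

theorem assocInv' {l₃ : List ℕ} {A₁ A₂ A₃ : Tree D} (h₁ : l₁.length = A₁.leaves.length)
    (h₂ : l₂.length = A₂.leaves.length) (h₃ : l₃.length = A₃.leaves.length) :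
    Coh ((l₃ ++ l₂) ++ l₁) (.node A₁ (.node A₂ A₃)) (l₃ ++ (l₂ ++ l₁)) (.node (.node A₁ A₂) A₃)
      (α_ A₁.obj A₂.obj A₃.obj).inv := by
  rw [List.append_assoc]
  exact .assocInv (by simp [h₁, h₂, h₃, add_assoc])

theorem midSwap {l₃ : List ℕ} {A₁ A₂ A₃ : Tree D} (h₁ : l₁.length = A₁.leaves.length)
    (h₂ : l₂.length = A₂.leaves.length) (h₃ : l₃.length = A₃.leaves.length) :
    Coh (l₃ ++ (l₂ ++ l₁)) (.node (.node A₁ A₂) A₃) (l₂ ++ (l₃ ++ l₁)) (.node (.node A₁ A₃) A₂)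
      (midSwap A₁.obj A₂.obj A₃.obj) :=
  .trans (.assoc' h₁ h₂ h₃) (.trans (.whiskerLeft h₁ (.braid h₂ h₃)) (.assocInv' h₁ h₃ h₂))

theorem binderSwap {lZ lY lS lT : List ℕ} {Z Y S T : Tree D} (hZ : lZ.length = Z.leaves.length)
    (hY : lY.length = Y.leaves.length) (hS : lS.length = S.leaves.length)
    (hT : lT.length = T.leaves.length) :
    Coh (lT ++ (lS ++ (lY ++ lZ))) (.node (.node (.node Z Y) S) T) (lY ++ (lT ++ (lS ++ lZ)))
      (.node (.node (.node Z S) T) Y) (binderSwap Z.obj Y.obj S.obj T.obj) :=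
  .trans (.assoc' (A₁ := .node Z Y) (by simp [Tree.leaves, hZ, hY]) hS hT)
    (.trans (.midSwap (A₃ := .node S T) hZ hY (by simp [Tree.leaves, hS, hT]))
      (.whiskerRight (.assocInv' hZ hS hT) hY))

/-- All labels of `Y₂` are at least 2, so none of its entries is bound here and `Y₂` can be split
off beforehand; `Z` collects what is left of `X`. It suffices to find `r` and `u` by counting
labels, as coherence gives the factorisation. -/
theorem exists_bind {l m₁ m₂ : List ℕ} {X Y₁ Y₂ : Tree D} {S T : STy D}
    {q : (X.obj ⊗ S.el) ⊗ T.el ⟶ Y₁.obj ⊗ Y₂.obj} (hl : l.Nodup)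
    (h : Coh (0 :: 1 :: l.map (· + 2)) (.node (.node X (.leaf S)) (.leaf T))
      (m₂.map (· + 2) ++ m₁) (.node Y₁ Y₂) q) (e₂ : m₂.length = Y₂.leaves.length) :
    ∃ (k : List ℕ) (Z : Tree D) (r : X.obj ⟶ Z.obj ⊗ Y₂.obj)
      (u : (Z.obj ⊗ S.el) ⊗ T.el ⟶ Y₁.obj), Coh l X (m₂ ++ k) (.node Z Y₂) r ∧
      Coh (0 :: 1 :: k.map (· + 2)) (.node (.node Z (.leaf S)) (.leaf T)) m₁ Y₁ u ∧
      k.length = Z.leaves.length ∧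
      q = r ▷ S.el ▷ T.el ≫ ILDTT.binderSwap Z.obj Y₂.obj S.el T.el ≫ u ▷ Y₂.obj := by
  have e := h.length
  simp only [Tree.leaves, List.length_append, List.length_map, List.length_cons,
    List.length_nil] at e
  have e₀ : l.length = X.leaves.length := by omega
  have e₁ : m₁.length = Y₁.leaves.length := by omega
  have hz := h.perm_zip
  simp only [Tree.leaves, List.cons_append, List.nil_append, List.zip_cons_cons] at hz
  rw [List.zip_append (by simpa using e₂), List.zip_map_left, List.zip_map_left] at hz
  -- The labels of the second block are shifted by 2, so both bound variables occur in the first;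
  -- `L` lists its other entries.
  obtain ⟨L, hL⟩ : ∃ L, (m₁.zip Y₁.leaves).Perm ((0, T) :: (1, S) :: L) := by
    have h₀ : (0, T) ∈ m₁.zip Y₁.leaves := by
      have := hz.subset (List.mem_cons_self)
      simpa using this
    have h₁ : (1, S) ∈ m₁.zip Y₁.leaves := by
      have := hz.subset (List.mem_cons_of_mem _ (List.mem_cons_self))
      simpa using this
    have key {κ : Type u} {x : κ} {K : List κ} (h : x ∈ K) : ∃ K', K.Perm (x :: K') := by
      obtain ⟨s, t, rfl⟩ := List.append_of_mem h
      exact ⟨s ++ t, List.perm_middle⟩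
    obtain ⟨L, hL⟩ := key h₀
    have h₁ : (1, S) ∈ L := by
      have := hL.subset h₁
      simpa using this
    obtain ⟨L', hL'⟩ := key h₁
    exact ⟨L', hL.trans (hL'.cons _)⟩
  have hz' := hz.trans ((hL.append_left _).trans
    (List.perm_middle.trans ((List.perm_middle).cons _)))
  have hz' := hz'.cons_inv.cons_inv
  -- After cancelling the bound variables, every label left comes from the shifted list, so the
  -- shift can be undone.
  obtain ⟨L, rfl⟩ : ∃ L₀ : List (ℕ × STy D), L = L₀.map (Prod.map (· + 2) id) := by
    refine ⟨L.map (Prod.map (· - 2) id), ?_⟩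
    rw [List.map_map]
    refine (List.map_id _).symm.trans (List.map_congr_left fun x hx => ?_)
    have := hz'.symm.subset (List.mem_append_right _ hx)
    obtain ⟨y, -, rfl⟩ := List.mem_map.1 this
    rfl
  rw [← List.map_append] at hz'
  have hz₀ : (l.zip X.leaves).Perm (m₂.zip Y₂.leaves ++ L) := by
    have := hz'.map (Prod.map (· - 2) id)
    have e : (Prod.map (· - 2) id ∘ Prod.map (· + 2) id : ℕ × STy D → ℕ × STy D) = id := by
      funext x
      rfl
    rwa [List.map_map, List.map_map, e, List.map_id, List.map_id] at this
  have hL₀ : (L.map Prod.fst).zip (L.map Prod.snd) = L := by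
    rw [List.zip_map', List.map_id'']
    exact fun _ => rfl
  obtain ⟨r, hr⟩ := exists_of_perm (l := l) (X := X) (l' := m₂ ++ L.map Prod.fst)
    (X' := .node (.lst (L.map Prod.snd)) Y₂) (by
      rw [Tree.leaves, List.zip_append e₂]
      rwa [Tree.leaves, hL₀]) e₀ (by
      simp [Tree.leaves, e₂])
  obtain ⟨u, hu⟩ := exists_of_perm (l := 0 :: 1 :: (L.map Prod.fst).map (· + 2))
    (X := .node (.node (.lst (L.map Prod.snd)) (.leaf S)) (.leaf T)) (l' := m₁) (X' := Y₁) (by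
      simp only [Tree.leaves, List.cons_append, List.nil_append, List.zip_cons_cons]
      rw [List.zip_map_left, hL₀]
      exact hL.symm) (by simp [Tree.leaves]) e₁
  refine ⟨_, _, r, u, hr, hu, by simp [Tree.leaves], ?_⟩
  have hq := (Coh.whiskerRight (l₂ := [0]) (B := .leaf T) (.whiskerRight (l₂ := [1])
    (B := .leaf S) (hr.map (· + 2)) rfl) rfl).trans ((by
      rw [List.map_append]
      exact .binderSwap (lS := [1]) (lT := [0]) (by simp [Tree.leaves]) (by simpa using e₂)
        rfl rfl : Coh _ _ _ _ _).trans (.whiskerRight hu (by simpa using e₂)))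
  exact h.unique hq (by simpa [List.nodup_map_iff (add_left_injective 2)] using hl)

end Coh

end ILDTT

namespace ILDTT
open Model

/-! ### Renaming of linear variables in program contexts -/

section
variable {𝔽 : Symbols.{w}}

/-- A renaming of linear variables, under `d` more binders. -/
def liftBy (d : ℕ) (r : ℕ → ℕ) : ℕ → ℕ := fun j => if j < d then j else r (j - d) + d

theorem liftBy_zero (r : ℕ → ℕ) : liftBy 0 r = r := by
  funext j
  simp [liftBy]

theorem liftBy_lift₂ (d : ℕ) (r : ℕ → ℕ) : liftBy d (Tm.lift₂ r) = liftBy (d + 2) r := by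
  funext j
  unfold liftBy
  obtain h | h | h | ⟨i, rfl⟩ : j < d ∨ j = d ∨ j = d + 1 ∨ ∃ i, j = d + (i + 2) := by
    by_cases h : j < d + 2
    · omega
    · exact .inr (.inr (.inr ⟨j - d - 2, by omega⟩))
  · rw [if_pos h, if_pos (by omega)]
  · subst h
    simp [Tm.lift₂]
  · subst h
    simp [Tm.lift₂]
    omega
  · rw [if_neg (by omega), if_neg (by omega), show d + (i + 2) - d = i + 2 by omega,
      show d + (i + 2) - (d + 2) = i by omega, Tm.lift₂]
    omega

theorem PCtx.lren_plug (C : PCtx 𝔽) (e : Tm 𝔽) (r : ℕ → ℕ) :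
    (C.plug e).lren r = (C.lren r).plug (e.lren (liftBy C.depth r)) := by
  induction C generalizing r <;> simp_all [plug, lren, Tm.lren, depth, liftBy_zero, liftBy_lift₂]

theorem PCtx.lren_lren (C : PCtx 𝔽) (r r' : ℕ → ℕ) : (C.lren r).lren r' = C.lren (r' ∘ r) := by
  induction C generalizing r r' <;> simp_all [lren, Tm.lren_lren, Tm.lift₂_comp]

theorem PCtx.depth_lren (C : PCtx 𝔽) (r : ℕ → ℕ) : (C.lren r).depth = C.depth := by
  induction C generalizing r <;> simp_all [lren, depth]

theorem moveOut_zero : moveOut 0 = id := by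
  funext j
  simp only [moveOut, id]
  split_ifs <;> omega

/-- Moving two variables out of `d + 2` binders: first out of the inner `d`, then past the two
binders of the enclosing `let`. -/
theorem liftBy_comp_moveOut (d : ℕ) : liftBy d (moveOut 2) ∘ moveOut d = moveOut (d + 2) := by
  funext j
  simp only [liftBy, moveOut, Function.comp_apply]
  split_ifs <;> omega

theorem moveOut_two_comp : moveOut 2 ∘ (· + 2) = Tm.lift₂ (· + 2) := by
  funext j
  match j with
  | 0 => rfl
  | 1 => rfl
  | j + 2 => simp [moveOut, Tm.lift₂]

theorem Tm.lshift_zero (t : Tm 𝔽) : t.lshift 0 = t := t.lren_id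

theorem Tm.lshift_add_two (t : Tm 𝔽) (d : ℕ) : t.lshift (d + 2) = (t.lshift 2).lshift d := by
  unfold lshift
  rw [lren_lren]
  congr 1
  funext j
  simp only [Function.comp_apply]
  omega

end

section
variable {C : Type u} [Category.{v} C] [MonoidalCategory C]

/-- This and the following identities specialise the conversions to the constructs that can surround
the hole. -/
theorem letU_right_tens {P X Y₁ Y₂ A B : C} {X₂ : C} (p : P ⟶ X ⊗ X₂) (q : X₂ ⟶ Y₁ ⊗ Y₂)
    (g : X ⟶ A) (e : Y₁ ⟶ B) (t : Y₂ ⟶ 𝟙_ C) :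
    p ≫ (g ⊗ₘ q ≫ (e ⊗ₘ t) ≫ (ρ_ B).hom) =
      (p ≫ X ◁ q ≫ (α_ X Y₁ Y₂).inv) ≫ (𝟙 _ ≫ (g ⊗ₘ e) ⊗ₘ t) ≫ (ρ_ (A ⊗ B)).hom := by
  simpa only [Category.comp_id, Category.id_comp] using (letU_right p q g e t (𝟙 _)).symm

theorem letU_right_letT {P X Y₁ Y₂ S T R : C} {X₂ : C} (p : P ⟶ X ⊗ X₂) (q : X₂ ⟶ Y₁ ⊗ Y₂)
    (e : Y₁ ⟶ S ⊗ T) (t : Y₂ ⟶ 𝟙_ C) (k : (X ⊗ S) ⊗ T ⟶ R) :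
    p ≫ X ◁ (q ≫ (e ⊗ₘ t) ≫ (ρ_ (S ⊗ T)).hom) ≫ (α_ X S T).inv ≫ k =
      (p ≫ X ◁ q ≫ (α_ X Y₁ Y₂).inv) ≫
        (𝟙 _ ≫ X ◁ e ≫ (α_ X S T).inv ≫ k ⊗ₘ t) ≫ (ρ_ R).hom := by
  simpa only [id_tensorHom, Category.id_comp] using
    (letU_right p q (𝟙 X) e t ((α_ X S T).inv ≫ k)).symm

theorem letT_right_tens {P X Y₁ Y₂ A B S T : C} {X₂ : C} (p : P ⟶ X ⊗ X₂) (q : X₂ ⟶ Y₁ ⊗ Y₂)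
    (g : X ⟶ A) (t : Y₂ ⟶ S ⊗ T) (e : (Y₁ ⊗ S) ⊗ T ⟶ B) :
    p ≫ (g ⊗ₘ q ≫ Y₁ ◁ t ≫ (α_ Y₁ S T).inv ≫ e) =
      (p ≫ X ◁ q ≫ (α_ X Y₁ Y₂).inv) ≫ (X ⊗ Y₁) ◁ t ≫ (α_ (X ⊗ Y₁) S T).inv ≫
        ((α_ X Y₁ S).hom ▷ T ≫ (α_ X (Y₁ ⊗ S) T).hom) ≫ (g ⊗ₘ e) := by
  simpa only [Category.comp_id] using (letT_right p q g t e (𝟙 _)).symm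

theorem letT_right_letT {P X Y₁ Y₂ S T S' T' R : C} {X₂ : C} (p : P ⟶ X ⊗ X₂) (q : X₂ ⟶ Y₁ ⊗ Y₂)
    (t : Y₂ ⟶ S ⊗ T) (e : (Y₁ ⊗ S) ⊗ T ⟶ S' ⊗ T') (k : (X ⊗ S') ⊗ T' ⟶ R) :
    p ≫ X ◁ (q ≫ Y₁ ◁ t ≫ (α_ Y₁ S T).inv ≫ e) ≫ (α_ X S' T').inv ≫ k =
      (p ≫ X ◁ q ≫ (α_ X Y₁ Y₂).inv) ≫ (X ⊗ Y₁) ◁ t ≫ (α_ (X ⊗ Y₁) S T).inv ≫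
        ((α_ X Y₁ S).hom ▷ T ≫ (α_ X (Y₁ ⊗ S) T).hom) ≫ X ◁ e ≫ (α_ X S' T').inv ≫ k := by
  simpa only [id_tensorHom] using (letT_right p q (𝟙 X) t e ((α_ X S' T').inv ≫ k)).symm

theorem letU_con {P Y₁ Y₂ A Q : C} (p : P ⟶ Y₁ ⊗ Y₂) (e : Y₁ ⟶ A) (t : Y₂ ⟶ 𝟙_ C) (k : A ⟶ Q) :
    (p ≫ (e ⊗ₘ t) ≫ (ρ_ A).hom) ≫ k = p ≫ (e ≫ k ⊗ₘ t) ≫ (ρ_ Q).hom := by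
  rw [tensor_comp_whiskerRight, Category.assoc, Category.assoc, Category.assoc,
    rightUnitor_naturality]

theorem letT_con {P Y₁ Y₂ S T A Q : C} (p : P ⟶ Y₁ ⊗ Y₂) (t : Y₂ ⟶ S ⊗ T)
    (e : (Y₁ ⊗ S) ⊗ T ⟶ A) (k : A ⟶ Q) :
    (p ≫ Y₁ ◁ t ≫ (α_ Y₁ S T).inv ≫ e) ≫ k = p ≫ Y₁ ◁ t ≫ (α_ Y₁ S T).inv ≫ e ≫ k := by
  simp only [Category.assoc]

variable [SymmetricCategory C]

theorem letU_left_tens {P X Y₁ Y₂ A B : C} {X₁ : C} (p : P ⟶ X₁ ⊗ X) (q : X₁ ⟶ Y₁ ⊗ Y₂)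
    (g : X ⟶ A) (e : Y₁ ⟶ B) (t : Y₂ ⟶ 𝟙_ C) :
    p ≫ (q ≫ (e ⊗ₘ t) ≫ (ρ_ B).hom ⊗ₘ g) =
      (p ≫ q ▷ X ≫ midSwap Y₁ Y₂ X) ≫ (𝟙 _ ≫ (e ⊗ₘ g) ⊗ₘ t) ≫ (ρ_ (B ⊗ A)).hom := by
  simpa only [Category.comp_id, Category.id_comp] using (letU_left p q g e t (𝟙 _)).symm

theorem letT_left_tens {P X Y₁ Y₂ A B S T : C} {X₁ : C} (p : P ⟶ X₁ ⊗ X) (q : X₁ ⟶ Y₁ ⊗ Y₂)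
    (g : X ⟶ A) (t : Y₂ ⟶ S ⊗ T) (e : (Y₁ ⊗ S) ⊗ T ⟶ B) :
    p ≫ (q ≫ Y₁ ◁ t ≫ (α_ Y₁ S T).inv ≫ e ⊗ₘ g) =
      (p ≫ q ▷ X ≫ midSwap Y₁ Y₂ X) ≫ (Y₁ ⊗ X) ◁ t ≫ (α_ (Y₁ ⊗ X) S T).inv ≫
        binderSwap Y₁ X S T ≫ (e ⊗ₘ g) := by
  simpa only [Category.comp_id] using (letT_left p q g t e (𝟙 _)).symm

end

variable {𝔽 : Symbols.{w}} {M : Model.{v₁, u₁, v, u}} {D : M.𝒞}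

theorem Coh.binderLeft {lZ lY : List ℕ} {Z Y : Tree D} (S T : STy D)
    (hZ : lZ.length = Z.leaves.length) (hY : lY.length = Y.leaves.length) :
    Coh (0 :: 1 :: (lY ++ lZ).map (· + 2)) (.node (.node (.node Z Y) (.leaf S)) (.leaf T))
      (lY.map (· + 2) ++ 0 :: 1 :: lZ.map (· + 2)) (.node (.node (.node Z (.leaf S)) (.leaf T)) Y)
      (ILDTT.binderSwap Z.obj Y.obj S.el T.el) := by
  rw [List.map_append]
  exact .binderSwap (lT := [0]) (lS := [1]) (S := .leaf S) (T := .leaf T) (by simpa using hZ)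
    (by simpa using hY) rfl rfl

theorem Coh.binderRight {lZ lY : List ℕ} {Z Y : Tree D} (S T : STy D)
    (hZ : lZ.length = Z.leaves.length) (hY : lY.length = Y.leaves.length) :
    Coh (0 :: 1 :: (lY ++ lZ).map (· + 2)) (.node (.node (.node Z Y) (.leaf S)) (.leaf T))
      ((0 :: 1 :: lY.map (· + 2)) ++ lZ.map (· + 2))
      (.node Z (.node (.node Y (.leaf S)) (.leaf T)))
      ((α_ Z.obj Y.obj S.el).hom ▷ T.el ≫ (α_ Z.obj (Y.obj ⊗ S.el) T.el).hom) := by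
  rw [List.map_append]
  exact .trans (.whiskerRight (l₂ := [0]) (B := .leaf T) (.assoc' (l₃ := [1]) (A₃ := .leaf S)
    (by simpa using hZ) (by simpa using hY) rfl) rfl)
    (.assoc' (A₂ := .node Y (.leaf S)) (l₃ := [0]) (A₃ := .leaf T) (by simpa using hZ)
      (by simpa [Tree.leaves] using hY) rfl)

namespace Den
variable {𝔡 : Denot 𝔽 M} {ρ : List (Sec D)} {c : Tm 𝔽}

/-- Induction on the program context: the induction hypothesis brings the `let` to the top of the
subterm, and one more step moves it past the outermost construct. This step is an associator,
`midSwap` or `Coh.exists_bind`, depending on where the hole lies. -/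
theorem plug_letU {C : PCtx 𝔽} {t : Tm 𝔽} {l : List ℕ} {X : Tree D} {R : STy D}
    {f : X.obj ⟶ R.el} (hl : l.Nodup)
    (h : Den 𝔡 ρ (C.plug (.letU (t.lshift C.depth) c)) l X R f) :
    Den 𝔡 ρ (.letU t (C.plug c)) l X R f := by
  induction C generalizing t l X R with
  | hole =>
    rw [PCtx.depth, Tm.lshift_zero] at h
    exact h
  | con b us C ih =>
    cases h with
    | con _ hs hv h =>
      cases ih hl h with
      | letU hq ht he => exact of_eq (.letU hq ht (.con b hs hv he)) (letU_con _ _ _ _)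
  | letU₁ C a ih =>
    cases h with
    | letU hp h ha =>
      cases ih (List.nodup_append.1 (hp.perm.nodup hl)).1 h with
      | letU hq ht he =>
        refine of_eq (.letU (hp.trans (.trans (.whiskerLeft ha.length hq)
          (.assocInv' ha.length he.length ht.length))) ht (of_eq (.letU
            (.refl (by simp [Tree.leaves, ha.length, he.length])) he ha)
              (Category.id_comp _).symm)) (letU_right _ _ _ _ _ _).symm
  | letU₂ s C ih =>
    cases h with
    | letU hp hs h =>
      cases ih (List.nodup_append.1 (hp.perm.nodup hl)).2.1 h with
      | letU hq ht he =>
        refine of_eq (.letU (hp.trans (.trans (.whiskerRight hq hs.length)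
          (.midSwap he.length ht.length hs.length))) ht (of_eq (.letU
            (.refl (by simp [Tree.leaves, hs.length, he.length])) hs he)
              (Category.id_comp _).symm)) (letU_left _ _ _ _ _ _).symm
  | tens₁ C b ih =>
    cases h with
    | tens hp h hb =>
      cases ih (List.nodup_append.1 (hp.perm.nodup hl)).2.1 h with
      | letU hq ht he =>
        exact of_eq (.letU (hp.trans (.trans (.whiskerRight hq hb.length)
          (.midSwap he.length ht.length hb.length))) ht (.tens
            (.refl (by simp [Tree.leaves, hb.length, he.length])) he hb))
              (letU_left_tens _ _ _ _ _)
  | tens₂ a C ih =>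
    cases h with
    | tens hp ha h =>
      cases ih (List.nodup_append.1 (hp.perm.nodup hl)).1 h with
      | letU hq ht he =>
        exact of_eq (.letU (hp.trans (.trans (.whiskerLeft ha.length hq)
          (.assocInv' ha.length he.length ht.length))) ht (.tens
            (.refl (by simp [Tree.leaves, ha.length, he.length])) ha he))
              (letU_right_tens _ _ _ _ _)
  | letT₁ C a ih =>
    cases h with
    | @letT _ l₁ _ _ X₁ _ _ _ _ _ _ _ _ _ hp h ha =>
      have e₁ : l₁.length = X₁.leaves.length := by simpa [Tree.leaves, h.length] using hp.length.2
      cases ih (List.nodup_append.1 (hp.perm.nodup hl)).1 h with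
      | letU hq ht he =>
        exact of_eq (.letU (hp.trans (.trans (.whiskerLeft e₁ hq)
          (.assocInv' e₁ he.length ht.length))) ht (.letT
            (.refl (by simp [Tree.leaves, e₁, he.length])) he ha))
              (letU_right_letT _ _ _ _ _)
  | letT₂ s C ih =>
    cases h with
    | letT hp hs h =>
      rw [PCtx.depth, Tm.lshift_add_two] at h
      have hn := (List.nodup_append.1 (hp.perm.nodup hl)).2.1
      cases ih (by simpa [List.nodup_map_iff (add_left_injective 2)] using hn) h with
      | letU hq ht he =>
        -- Being shifted by 2, `t` uses neither variable bound around the hole; this is the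
        -- condition of `Coh.exists_bind`.
        obtain ⟨m₂, rfl, ht₀⟩ := lren_inv (add_left_injective 2) ht
        obtain ⟨k, Z, r, u, hr, hu, hk, rfl⟩ := Coh.exists_bind hn hq ht₀.length
        exact of_eq (.letU (hp.trans (.trans (.whiskerRight hr hs.length)
          (.midSwap hk ht₀.length hs.length))) ht₀ (.letT
            (.refl (by simp [Tree.leaves, hk, hs.length])) hs (he.coh hu)))
              (letU_bind _ _ _ _ _ _).symm

/-- As for `plug_letU`, but the `let` also carries its two bound variables outward, so the other
subterms are shifted and the context of the new body is reordered by `binderLeft` or `binderRight`.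
-/
theorem plug_letT {C : PCtx 𝔽} {t : Tm 𝔽} {l : List ℕ} {X : Tree D} {R : STy D}
    {f : X.obj ⟶ R.el} (hl : l.Nodup)
    (h : Den 𝔡 ρ (C.plug (.letT (t.lshift C.depth) c)) l X R f) :
    Den 𝔡 ρ (.letT t ((C.lren (· + 2)).plug (c.lren (moveOut C.depth)))) l X R f := by
  have len {t : Tm 𝔽} {l l₁ l₂ : List ℕ} {X X₁ X₂ : Tree D} {S : STy D} {f : X₂.obj ⟶ S.el} {p}
      (hp : Coh l X (l₂ ++ l₁) (.node X₁ X₂) p) (ht : Den 𝔡 ρ t l₂ X₂ S f) :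
      l₁.length = X₁.leaves.length := by
    simpa [Tree.leaves, ht.length] using hp.length.2
  induction C generalizing t l X R with
  | hole =>
    rw [PCtx.depth, Tm.lshift_zero] at h
    rw [PCtx.depth, moveOut_zero, Tm.lren_id]
    exact h
  | con b us C ih =>
    cases h with
    | con _ hs hv h =>
      cases ih hl h with
      | letT hq ht he => exact of_eq (.letT hq ht (.con b hs hv he)) (letT_con _ _ _ _)
  | letU₁ C a ih =>
    cases h with
    | letU hp h ha =>
      cases ih (List.nodup_append.1 (hp.perm.nodup hl)).1 h with
      | letT hq ht he =>
        have e₁ := len hq ht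
        exact of_eq (.letT (hp.trans (.trans (.whiskerLeft ha.length hq)
          (.assocInv' ha.length e₁ ht.length))) ht (.letU
            (.binderRight _ _ ha.length e₁) he (ha.lren _))) (letT_right _ _ _ _ _ _).symm
  | letU₂ s C ih =>
    cases h with
    | letU hp hs h =>
      cases ih (List.nodup_append.1 (hp.perm.nodup hl)).2.1 h with
      | letT hq ht he =>
        have e₁ := len hq ht
        exact of_eq (.letT (hp.trans (.trans (.whiskerRight hq hs.length)
          (.midSwap e₁ ht.length hs.length))) ht (.letU
            (.binderLeft _ _ e₁ hs.length) (hs.lren _) he)) (letT_left _ _ _ _ _ _).symm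
  | tens₁ C b ih =>
    cases h with
    | tens hp h hb =>
      cases ih (List.nodup_append.1 (hp.perm.nodup hl)).2.1 h with
      | letT hq ht he =>
        have e₁ := len hq ht
        exact of_eq (.letT (hp.trans (.trans (.whiskerRight hq hb.length)
          (.midSwap e₁ ht.length hb.length))) ht (.tens
            (.binderLeft _ _ e₁ hb.length) he (hb.lren _))) (letT_left_tens _ _ _ _ _)
  | tens₂ a C ih =>
    cases h with
    | tens hp ha h =>
      cases ih (List.nodup_append.1 (hp.perm.nodup hl)).1 h with
      | letT hq ht he =>
        have e₁ := len hq ht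
        exact of_eq (.letT (hp.trans (.trans (.whiskerLeft ha.length hq)
          (.assocInv' ha.length e₁ ht.length))) ht (.tens
            (.binderRight _ _ ha.length e₁) (ha.lren _) he)) (letT_right_tens _ _ _ _ _)
  | letT₁ C a ih =>
    cases h with
    | letT hp h ha =>
      have e₀ := len hp h
      cases ih (List.nodup_append.1 (hp.perm.nodup hl)).1 h with
      | letT hq ht he =>
        have e₁ := len hq ht
        have ha' := ha.lren (Tm.lift₂ (· + 2))
        simp only [List.map_cons, List.map_map, Tm.lift₂] at ha'
        refine of_eq (.letT (hp.trans (.trans (.whiskerLeft e₀ hq)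
          (.assocInv' e₀ e₁ ht.length))) ht (.letT
            (.binderRight _ _ e₀ e₁) he ?_)) (letT_right_letT _ _ _ _ _)
        rw [List.map_map]
        exact ha'
  | letT₂ s C ih =>
    cases h with
    | @letT _ _ _ _ _ _ _ _ S T _ _ _ _ hp hs h =>
      rw [PCtx.depth, Tm.lshift_add_two] at h
      have hn := (List.nodup_append.1 (hp.perm.nodup hl)).2.1
      cases ih (by simpa [List.nodup_map_iff (add_left_injective 2)] using hn) h with
      | @letT _ _ _ _ _ _ _ _ S' T' _ _ _ _ hq ht he =>
        obtain ⟨m₂, rfl, ht₀⟩ := lren_inv (add_left_injective 2) ht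
        obtain ⟨k, Z, r, u, hr, hu, hk, rfl⟩ := Coh.exists_bind hn hq ht₀.length
        -- The body provided by the induction hypothesis has the variables of `t` innermost;
        -- `moveOut 2` puts them outside those bound by the `let` of `s`.
        have he' := (he.coh (.whiskerRight (l₂ := [0]) (B := .leaf T') (.whiskerRight (l₂ := [1])
          (B := .leaf S') (hu.map (· + 2)) rfl) rfl)).lren (moveOut 2)
        rw [PCtx.lren_plug, PCtx.lren_lren, moveOut_two_comp, PCtx.depth_lren, Tm.lren_lren,
          liftBy_comp_moveOut] at he'
        have hk' : (k.map (· + 4)).length = Z.leaves.length := by simpa using hk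
        have hsw := Coh.trans (Coh.whiskerRight (l₂ := [0]) (B := .leaf T)
          (.whiskerRight (l₂ := [1]) (B := .leaf S) (.assoc' (l₂ := [3]) (l₃ := [2])
            (A₂ := .leaf S') (A₃ := .leaf T') hk' rfl rfl) rfl) rfl)
          (.trans (.binderSwap (lS := [1]) (lT := [0]) (lY := [2, 3])
            (Y := .node (.leaf S') (.leaf T')) hk' rfl rfl rfl) (.assocInv' (l₂ := [3]) (l₃ := [2])
              (A₂ := .leaf S') (A₃ := .leaf T') (by simpa [Tree.leaves] using hk) rfl rfl))
        refine of_eq (.letT (hp.trans (.trans (.whiskerRight hr hs.length)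
          (.midSwap hk ht₀.length hs.length))) ht₀ (.letT
            (.binderLeft _ _ hk hs.length) (hs.lren _) (Den.coh he' ?_)))
              (letT_bind _ _ _ _ _ _).symm
        have h₄ (x : ℕ) : (if x + 2 + 2 < 4 then x + 2 else x + 2 + 2) = x + 4 :=
          if_neg (by omega)
        -- In the new body the variables bound by `s` have indices 0 and 1 and those bound by `t`
        -- have 2 and 3, while the outer ones begin at 4.
        have e₄ : List.map (moveOut 2) ([0] ++ ([1] ++ (0 + 2) :: (1 + 2) ::
            List.map (fun x => x + 2 + 2) k)) = 2 :: 3 :: 0 :: 1 :: k.map (· + 4) := by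
          simp [moveOut, h₄]
        simp only [List.map_cons, List.map_map, Function.comp_def]
        rw [e₄]
        exact hsw

end Den

end ILDTT

namespace ILDTT
open Model

/-! ## Soundness -/

section
variable {𝔽 : Symbols.{w}} {M : Model.{v₁, u₁, v, u}} {D : M.𝒞} {𝔡 : Denot 𝔽 M}

theorem ILin.nil_inv {ρ : List (Sec D)} {X : List (STy D)} (h : ILin 𝔡 ρ [] X) : X = [] := by
  cases h
  rfl

theorem ILin.cons_inv {ρ : List (Sec D)} {A : Ty 𝔽} {Ξ : List (Ty 𝔽)} {X : List (STy D)}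
    (h : ILin 𝔡 ρ (A :: Ξ) X) : ∃ S X', ITy 𝔡 ρ A S ∧ ILin 𝔡 ρ Ξ X' ∧ X = S :: X' := by
  cases h with
  | cons h h' => exact ⟨_, _, h, h', rfl⟩

theorem ILin.append {ρ : List (Sec D)} {Ξ Ξ' : List (Ty 𝔽)} {X X' : List (STy D)}
    (h' : ILin 𝔡 ρ Ξ' X') (h : ILin 𝔡 ρ Ξ X) : ILin 𝔡 ρ (Ξ' ++ Ξ) (X' ++ X) :=
  List.rel_append h' h

theorem ILin.append_inv {ρ : List (Sec D)} {Ξ Ξ' : List (Ty 𝔽)} {X : List (STy D)}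
    (h : ILin 𝔡 ρ (Ξ' ++ Ξ) X) :
    ∃ X₁ X₂, ILin 𝔡 ρ Ξ' X₁ ∧ ILin 𝔡 ρ Ξ X₂ ∧ X = X₁ ++ X₂ := by
  induction Ξ' generalizing X with
  | nil => exact ⟨[], X, .nil, h, rfl⟩
  | cons A Ξ' ih =>
    obtain ⟨S, X', hS, hX', rfl⟩ := ILin.cons_inv h
    obtain ⟨X₁, X₂, h₁, h₂, rfl⟩ := ih hX'
    exact ⟨S :: X₁, X₂, .cons hS h₁, h₂, rfl⟩

theorem ILin.length {ρ : List (Sec D)} {Ξ : List (Ty 𝔽)} {X : List (STy D)} (h : ILin 𝔡 ρ Ξ X) :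
    Ξ.length = X.length :=
  List.Forall₂.length_eq h

theorem ILin.weaken {Z : SCtx M} (S : STy Z.D) {Ξ : List (Ty 𝔽)} {X : List (STy Z.D)}
    (h : ILin 𝔡 Z.vars Ξ X) : ILin 𝔡 (Z.ext S).vars Ξ (X.map (STy.re (p Z.D S.el))) := by
  have := ILin.isub _ (CtxMor.p (𝔡 := 𝔡) Z S) h
  rwa [show Ty.isub (𝔽 := 𝔽) .ivar = id from funext Ty.isub_ivar, List.map_id] at this

theorem ICtx.exists_var {Δ Δ' : List (Ty 𝔽)} {A : Ty 𝔽} {Z : SCtx M}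
    (h : ICtx 𝔡 (Δ ++ A :: Δ') Z) :
    ∃ s, Z.vars[Δ.length]? = some s ∧ ITy 𝔡 Z.vars A s.1 := by
  rw [List.append_cons] at h
  induction Δ' using List.reverseRecOn generalizing Z with
  | nil =>
    rw [List.append_nil] at h
    obtain ⟨Z, S, hZ, hS, rfl⟩ := h.append_inv
    rw [← hZ.length]
    exact ⟨_, Z.ext_vars_getElem?_new S, hS.weaken S⟩
  | append_singleton Δ' B ih =>
    rw [← List.append_assoc] at h
    obtain ⟨Z, S, hZ, hS, rfl⟩ := h.append_inv
    obtain ⟨s, hs, hs'⟩ := ih hZ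
    exact ⟨_, Z.ext_vars_getElem?_old S hs, hs'.weaken S⟩

/-- The parts of a judgement have an interpretation, the same for the two sides of an equality. -/
def Denot.Interprets (𝔡 : Denot 𝔽 M) : Judgement 𝔽 → Prop
  | .ctx Δ Ξ => ∃ Z X, ICtx 𝔡 Δ Z ∧ ILin 𝔡 Z.vars Ξ X
  | .ty Δ A => ∃ Z S, ICtx 𝔡 Δ Z ∧ ITy 𝔡 Z.vars A S
  | .tm Δ Ξ a A => ∃ Z X S f, ICtx 𝔡 Δ Z ∧ ILin 𝔡 Z.vars Ξ X ∧ ITy 𝔡 Z.vars A S ∧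
      ITm 𝔡 Z.vars X a S f
  | .ctxEq Δ Ξ Δ' Ξ' => ∃ Z X, ICtx 𝔡 Δ Z ∧ ILin 𝔡 Z.vars Ξ X ∧ ICtx 𝔡 Δ' Z ∧ ILin 𝔡 Z.vars Ξ' X
  | .tyEq Δ A A' => ∃ Z S, ICtx 𝔡 Δ Z ∧ ITy 𝔡 Z.vars A S ∧ ITy 𝔡 Z.vars A' S
  | .tmEq Δ Ξ a a' A => ∃ Z X S f, ICtx 𝔡 Δ Z ∧ ILin 𝔡 Z.vars Ξ X ∧ ITy 𝔡 Z.vars A S ∧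
      ITm 𝔡 Z.vars X a S f ∧ ITm 𝔡 Z.vars X a' S f

/-- For computation, uniqueness and commuting conversions only the left side is assumed typed. It is
enough that every value of it under `Den` is a value of the right side, which then also provides the
latter's interpretation. -/
theorem Denot.Interprets.tmEq_of_tm {Δ Ξ : List (Ty 𝔽)} {a a' : Tm 𝔽} {A : Ty 𝔽}
    (h : 𝔡.Interprets (.tm Δ Ξ a A))
    (h' : ∀ (D : M.𝒞) (ρ : List (Sec D)) (l : List ℕ) (X : Tree D) S (f : X.obj ⟶ S.el), l.Nodup →
      Den 𝔡 ρ a l X S f → Den 𝔡 ρ a' l X S f) :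
    𝔡.Interprets (.tmEq Δ Ξ a a' A) := by
  obtain ⟨Z, X, S, f, hZ, hX, hS, hf⟩ := h
  exact ⟨Z, X, S, f, hZ, hX, hS, hf,
    itm_iff_den.2 (h' _ _ _ _ _ _ List.nodup_range (itm_iff_den.1 hf))⟩

end

variable {𝕊 : Signature.{w}} {M : Model.{v₁, u₁, v, u}} {𝔡 : Denot 𝕊.toSymbols M}

namespace Denot.IsStructure

theorem exists_wk (h𝔡 : 𝔡.IsStructure 𝕊) {Δ Δ' : List (Ty 𝕊.toSymbols)} {A : Ty 𝕊.toSymbols}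
    {Z Z₁ : SCtx M} {S : STy Z.D} (hZ : ICtx 𝔡 Δ Z) (hS : ITy 𝔡 Z.vars A S)
    (hZ₁ : ICtx 𝔡 (Δ ++ Δ') Z₁) :
    ∃ (Z₂ : SCtx M) (w : Z₂.D ⟶ Z₁.D), ICtx 𝔡 (wkCtx Δ A Δ') Z₂ ∧
      QExt (W₀ := Z.ext S) (Z₀ := Z) (Model.p Z.D S.el) Δ'.length Z₂ Z₁ w ∧
      CtxMor 𝔡 (wkAt Δ.length) Z₂.vars Z₁.vars w := by
  have h := CtxMor.wkAt (𝔡 := 𝔡) S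
  rw [hZ.length] at h
  rw [wkCtx, List.append_cons]
  exact h.extend h𝔡 (.ext hZ hS) hZ (fun k => by simp [wkAt]; omega) hZ₁

theorem exists_sub (h𝔡 : 𝔡.IsStructure 𝕊) {Δ Δ' : List (Ty 𝕊.toSymbols)} {A : Ty 𝕊.toSymbols}
    {a : Tm 𝕊.toSymbols} {Z Z₁ : SCtx M} {S : STy Z.D} {f : 𝟙_ (M.fib Z.D) ⟶ S.el}
    (hZ : ICtx 𝔡 Δ Z) (hS : ITy 𝔡 Z.vars A S) (hf : ITm 𝔡 Z.vars [] a S f)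
    (hZ₁ : ICtx 𝔡 (Δ ++ A :: Δ') Z₁) :
    ∃ (Z₂ : SCtx M) (w : Z₂.D ⟶ Z₁.D), ICtx 𝔡 (subCtx Δ a Δ') Z₂ ∧
      QExt (W₀ := Z) (Z₀ := Z.ext S) (secMor S f) Δ'.length Z₂ Z₁ w ∧
      CtxMor 𝔡 (subAt Δ.length a) Z₂.vars Z₁.vars w := by
  have h := CtxMor.subAt hf
  rw [hZ.length] at h
  rw [List.append_cons] at hZ₁
  refine h.extend h𝔡 hZ (.ext hZ hS) (fun k => ?_) hZ₁
  rw [subAt, List.length_append, List.length_singleton, if_neg (by omega), if_neg (by omega)]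
  congr 1
  omega

theorem exists_ex (h𝔡 : 𝔡.IsStructure 𝕊) {Δ Δ' : List (Ty 𝕊.toSymbols)} {A A' : Ty 𝕊.toSymbols}
    {Z₁ : SCtx M} (hZ₁ : ICtx 𝔡 (Δ ++ A :: A' :: Δ') Z₁) (hA' : 𝔡.Interprets (.ty Δ A')) :
    ∃ (Z₂ : SCtx M) (w : Z₂.D ⟶ Z₁.D), ICtx 𝔡 (exCtx Δ A A' Δ') Z₂ ∧
      CtxMor 𝔡 (exAt Δ.length) Z₂.vars Z₁.vars w := by
  obtain ⟨Z, S, hZ, hS⟩ := hZ₁.suffix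
  obtain ⟨Z', S', hZ', hS'⟩ := hA'
  obtain rfl := h𝔡.ctx_unique hZ hZ'
  obtain ⟨w₀, h⟩ := CtxMor.exAt (𝔡 := 𝔡) S S'
  rw [hZ.length] at h
  rw [List.append_cons, List.append_cons] at hZ₁
  rw [exCtx, List.append_cons, List.append_cons]
  obtain ⟨Z₂, w, h₁, _, h₂⟩ := h.extend h𝔡 (.ext (.ext hZ hS') (hS.weaken S'))
    (.ext (.ext hZ hS) (hS'.weaken S)) (fun k => by
      rw [exAt, swapAt]
      simp only [List.length_append, List.length_singleton]
      rw [if_neg (by omega), if_neg (by omega)]) hZ₁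
  exact ⟨Z₂, w, h₁, h₂⟩

/-- The resulting morphism both reindexes the variables to the arguments, as the `con` rules demand,
and interprets the instantiating substitution, which identifies the types. -/
theorem exists_inst (h𝔡 : 𝔡.IsStructure 𝕊) {n : ℕ} {A : Fin n → Ty 𝕊.toSymbols}
    {us : Fin n → Tm 𝕊.toSymbols} {Z : SCtx M} (hZ : ICtx 𝔡 (List.ofFn A) Z) {D : M.𝒞}
    {ρ : List (Sec D)} {s : Fin n → Sec D} (h : ∀ i, ITy 𝔡 ρ ((A i).isub (inst us)) (s i).1)
    (h' : ∀ i, ITm 𝔡 ρ [] (us i) (s i).1 (s i).2) :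
    ∃ w : D ⟶ Z.D, Z.vars.map (Sec.re w) = List.ofFn s ∧ CtxMor 𝔡 (inst us) ρ Z.vars w := by
  have hn : Z.vars.length = n := by simpa using hZ.length
  -- The finite family is extended to all of `ℕ` by an arbitrary section, to fit `exists_hom`.
  obtain ⟨s', hs'⟩ : ∃ s' : ℕ → Sec D, ∀ i : Fin n, s' i = s i :=
    ⟨fun i => if hi : i < n then s ⟨i, hi⟩ else ⟨.unit, 𝟙 _⟩, fun i => dif_pos i.2⟩
  obtain ⟨w, hw⟩ := h𝔡.exists_hom hZ (ρ := ρ) (σ := inst us) (s := s') (fun i B hB => by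
    obtain ⟨hi, rfl⟩ := List.getElem?_eq_some_iff.1 hB
    have hi' : i < n := by simpa using hi
    rw [inst, dif_pos hi', List.getElem_ofFn, hs' ⟨i, hi'⟩]
    exact ⟨h ⟨i, hi'⟩, h' ⟨i, hi'⟩⟩)
  refine ⟨w, ?_, fun i t ht => ?_⟩
  · refine List.ext_getElem (by simpa using hn) fun i hi hi' => ?_
    have hi₁ : i < n := by simpa using hi'
    rw [List.getElem_map, List.getElem_ofFn, ← hs' ⟨i, hi₁⟩]
    exact hw i _ (List.getElem?_eq_getElem (by omega))
  · have hi : i < n := hn ▸ (List.getElem?_eq_some_iff.1 ht).1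
    rw [hw i t ht, inst, dif_pos hi, hs' ⟨i, hi⟩]
    exact h' ⟨i, hi⟩

theorem exists_sec (h𝔡 : 𝔡.IsStructure 𝕊) {Δ : List (Ty 𝕊.toSymbols)} {Z : SCtx M}
    (hZ : ICtx 𝔡 Δ Z) {a a' : Tm 𝕊.toSymbols} {A : Ty 𝕊.toSymbols}
    (h : 𝔡.Interprets (.tmEq Δ [] a a' A)) :
    ∃ s : Sec Z.D, ITy 𝔡 Z.vars A s.1 ∧ ITm 𝔡 Z.vars [] a s.1 s.2 ∧
      ITm 𝔡 Z.vars [] a' s.1 s.2 := by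
  obtain ⟨Z', X, S, f, hZ', hX, hS, hf, hf'⟩ := h
  obtain rfl := h𝔡.ctx_unique hZ hZ'
  obtain rfl := ILin.nil_inv hX
  exact ⟨⟨S, f⟩, hS, hf, hf'⟩

theorem con_ty_eq (h𝔡 : 𝔡.IsStructure 𝕊) {Δ : List (Ty 𝕊.toSymbols)} (T : 𝕊.TyC)
    {us us' : Fin (𝕊.tyAr T) → Tm 𝕊.toSymbols} (hΔ : 𝔡.Interprets (.ctx Δ []))
    (h : ∀ i, 𝔡.Interprets (.tmEq Δ [] (us i) (us' i) ((𝕊.tyCtx T i).isub (inst us)))) :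
    𝔡.Interprets (.tyEq Δ (.con T us) (.con T us')) := by
  obtain ⟨Z, _, hZ, _⟩ := hΔ
  choose s hs h₁ h₂ using fun i => h𝔡.exists_sec hZ (h i)
  obtain ⟨w, hw, _⟩ := h𝔡.exists_inst (h𝔡.tyCtx T) hs h₁
  exact ⟨Z, _, hZ, .con T h₁ hw, .con T h₂ hw⟩

theorem con_tm_eq (h𝔡 : 𝔡.IsStructure 𝕊) {Δ Ξ : List (Ty 𝕊.toSymbols)} (c : 𝕊.TmC)
    {us us' : Fin (𝕊.tmAr c) → Tm 𝕊.toSymbols} {b b' : Tm 𝕊.toSymbols}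
    (h : ∀ i, 𝔡.Interprets (.tmEq Δ [] (us i) (us' i) ((𝕊.tmCtx c i).isub (inst us))))
    (hb : 𝔡.Interprets (.tmEq Δ Ξ b b' ((𝕊.tmArg c).isub (inst us)))) :
    𝔡.Interprets (.tmEq Δ Ξ (.con c us b) (.con c us' b') ((𝕊.tmRes c).isub (inst us))) := by
  obtain ⟨Z, X, S, g, hZ, hX, hS, hg, hg'⟩ := hb
  choose s hs h₁ h₂ using fun i => h𝔡.exists_sec hZ (h i)
  obtain ⟨w, hw, hσ⟩ := h𝔡.exists_inst (h𝔡.tmCtx c) hs h₁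
  -- The type of the linear argument is syntactically an instance of the declared one; by uniqueness
  -- it denotes the reindexed type that `ITm.con` asks for.
  obtain rfl := h𝔡.ty_unique hS ((h𝔡.tmArg c).isub w hσ)
  exact ⟨Z, X, _, _, hZ, hX, (h𝔡.tmRes c).isub w hσ, .con c h₁ hw hg, .con c h₂ hw hg'⟩

theorem I_E_eq (h𝔡 : 𝔡.IsStructure 𝕊) {Δ Ξ Ξ' : List (Ty 𝕊.toSymbols)}
    {t t' a a' : Tm 𝕊.toSymbols} {A : Ty 𝕊.toSymbols}
    (ht : 𝔡.Interprets (.tmEq Δ Ξ' t t' .unit)) (ha : 𝔡.Interprets (.tmEq Δ Ξ a a' A)) :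
    𝔡.Interprets (.tmEq Δ (Ξ' ++ Ξ) (.letU t (a.lshift Ξ'.length))
      (.letU t' (a'.lshift Ξ'.length)) A) := by
  obtain ⟨Z, X', _, f, hZ, hX', hS', hf, hf'⟩ := ht
  obtain ⟨Z', X, S, g, hZ', hX, hS, hg, hg'⟩ := ha
  obtain rfl := h𝔡.ctx_unique hZ hZ'
  cases hS'
  rw [hX'.length]
  exact ⟨Z, _, S, _, hZ, hX'.append hX, hS, .letU hf hg, .letU hf' hg'⟩

theorem T_I_eq (h𝔡 : 𝔡.IsStructure 𝕊) {Δ Ξ Ξ' : List (Ty 𝕊.toSymbols)}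
    {a a' b b' : Tm 𝕊.toSymbols} {A B : Ty 𝕊.toSymbols}
    (ha : 𝔡.Interprets (.tmEq Δ Ξ a a' A)) (hb : 𝔡.Interprets (.tmEq Δ Ξ' b b' B)) :
    𝔡.Interprets (.tmEq Δ (Ξ' ++ Ξ) (.tens (a.lshift Ξ'.length) b) (.tens (a'.lshift Ξ'.length) b')
      (.tensor A B)) := by
  obtain ⟨Z, X, S, f, hZ, hX, hS, hf, hf'⟩ := ha
  obtain ⟨Z', X', T, g, hZ', hX', hT, hg, hg'⟩ := hb
  obtain rfl := h𝔡.ctx_unique hZ hZ'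
  rw [hX'.length]
  exact ⟨Z, _, _, _, hZ, hX'.append hX, .tensor hS hT, .tens hf hg, .tens hf' hg'⟩

theorem T_E_eq (h𝔡 : 𝔡.IsStructure 𝕊) {Δ Ξ Ξ' : List (Ty 𝕊.toSymbols)}
    {t t' c c' : Tm 𝕊.toSymbols} {A B C : Ty 𝕊.toSymbols}
    (ht : 𝔡.Interprets (.tmEq Δ Ξ t t' (.tensor A B)))
    (hc : 𝔡.Interprets (.tmEq Δ (B :: A :: Ξ') c c' C)) :
    𝔡.Interprets (.tmEq Δ (Ξ' ++ Ξ) (.letT (t.lshift Ξ'.length) c)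
      (.letT (t'.lshift Ξ'.length) c') C) := by
  obtain ⟨Z, X, _, f, hZ, hX, hS, hf, hf'⟩ := ht
  obtain ⟨Z', X₁, R, g, hZ', hX₁, hR, hg, hg'⟩ := hc
  obtain rfl := h𝔡.ctx_unique hZ hZ'
  cases hS with
  | tensor hS hT =>
    obtain ⟨_, _, hT', hX₂, rfl⟩ := hX₁.cons_inv
    obtain ⟨_, _, hS', hX', rfl⟩ := hX₂.cons_inv
    obtain rfl := h𝔡.ty_unique hS hS'
    obtain rfl := h𝔡.ty_unique hT hT'
    rw [hX'.length]
    exact ⟨Z, _, _, _, hZ, hX'.append hX, hR, .letT hf hg, .letT hf' hg'⟩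

theorem lin_tm_subst_eq (h𝔡 : 𝔡.IsStructure 𝕊) {Δ Ξ Ξ' : List (Ty 𝕊.toSymbols)}
    {a b b' : Tm 𝕊.toSymbols} {A B : Ty 𝕊.toSymbols}
    (hb : 𝔡.Interprets (.tmEq Δ (A :: Ξ) b b' B)) (ha : 𝔡.Interprets (.tm Δ Ξ' a A)) :
    𝔡.Interprets (.tmEq Δ (Ξ' ++ Ξ) (b.lsub (linSub Ξ'.length a)) (b'.lsub (linSub Ξ'.length a))
      B) := by
  obtain ⟨Z, X₁, T, g, hZ, hX₁, hT, hg, hg'⟩ := hb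
  obtain ⟨Z', X', S, f, hZ', hX', hS, hf⟩ := ha
  obtain rfl := h𝔡.ctx_unique hZ hZ'
  obtain ⟨_, X, hS', hX, rfl⟩ := hX₁.cons_inv
  obtain rfl := h𝔡.ty_unique hS hS'
  rw [hX'.length]
  exact ⟨Z, _, _, _, hZ, hX'.append hX, hT, hf.lsub_linSub hg, hf.lsub_linSub hg'⟩

theorem lin_exch_tm_eq {Δ Ξ Ξ' : List (Ty 𝕊.toSymbols)}
    {b b' : Tm 𝕊.toSymbols} {A A' B : Ty 𝕊.toSymbols}
    (h : 𝔡.Interprets (.tmEq Δ (Ξ' ++ A' :: A :: Ξ) b b' B)) :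
    𝔡.Interprets (.tmEq Δ (Ξ' ++ A :: A' :: Ξ) (b.lren (swapAt Ξ'.length))
      (b'.lren (swapAt Ξ'.length)) B) := by
  obtain ⟨Z, _, T, g, hZ, hX, hT, hg, hg'⟩ := h
  obtain ⟨X', _, hX', hX₁, rfl⟩ := hX.append_inv
  obtain ⟨S', _, hS', hX₂, rfl⟩ := hX₁.cons_inv
  obtain ⟨S, X, hS, hX₀, rfl⟩ := hX₂.cons_inv
  rw [hX'.length]
  exact ⟨Z, _, _, _, hZ, hX'.append (.cons hS (.cons hS' hX₀)), hT, hg.exch, hg'.exch⟩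

end Denot.IsStructure

theorem Denot.Interprets.tm_of_tmEq {Δ Ξ : List (Ty 𝕊.toSymbols)} {a a' : Tm 𝕊.toSymbols}
    {A : Ty 𝕊.toSymbols} (h : 𝔡.Interprets (.tmEq Δ Ξ a a' A)) : 𝔡.Interprets (.tm Δ Ξ a A) := by
  obtain ⟨Z, X, S, f, hZ, hX, hS, hf, _⟩ := h
  exact ⟨Z, X, S, f, hZ, hX, hS, hf⟩

/-- With `tm_of_tmEq` this makes a typing rule the diagonal case of the corresponding congruence
rule, so only the latter has to be proved. -/
theorem Denot.Interprets.tmEq_refl {Δ Ξ : List (Ty 𝕊.toSymbols)} {a : Tm 𝕊.toSymbols}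
    {A : Ty 𝕊.toSymbols} (h : 𝔡.Interprets (.tm Δ Ξ a A)) : 𝔡.Interprets (.tmEq Δ Ξ a a A) := by
  obtain ⟨Z, X, S, f, hZ, hX, hS, hf⟩ := h
  exact ⟨Z, X, S, f, hZ, hX, hS, hf, hf⟩

theorem Denot.Interprets.ty_of_tyEq {Δ : List (Ty 𝕊.toSymbols)} {A A' : Ty 𝕊.toSymbols}
    (h : 𝔡.Interprets (.tyEq Δ A A')) : 𝔡.Interprets (.ty Δ A) := by
  obtain ⟨Z, S, hZ, hS, _⟩ := h
  exact ⟨Z, S, hZ, hS⟩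

theorem Denot.Interprets.tyEq_refl {Δ : List (Ty 𝕊.toSymbols)} {A : Ty 𝕊.toSymbols}
    (h : 𝔡.Interprets (.ty Δ A)) : 𝔡.Interprets (.tyEq Δ A A) := by
  obtain ⟨Z, S, hZ, hS⟩ := h
  exact ⟨Z, S, hZ, hS, hS⟩

namespace Denot.IsStructure

theorem int_weak_ty_eq (h𝔡 : 𝔡.IsStructure 𝕊) {Δ Δ' : List (Ty 𝕊.toSymbols)}
    {A B B' : Ty 𝕊.toSymbols} (h : 𝔡.Interprets (.tyEq (Δ ++ Δ') B B'))
    (hA : 𝔡.Interprets (.ty Δ A)) :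
    𝔡.Interprets (.tyEq (wkCtx Δ A Δ') (B.isub (wkAt Δ.length)) (B'.isub (wkAt Δ.length))) := by
  obtain ⟨Z, S, hZ, hS⟩ := hA
  obtain ⟨Z₁, T, hZ₁, hT, hT'⟩ := h
  obtain ⟨Z₂, w, hZ₂, _, hσ⟩ := h𝔡.exists_wk hZ hS hZ₁
  exact ⟨Z₂, _, hZ₂, hT.isub w hσ, hT'.isub w hσ⟩

theorem int_weak_tm_eq (h𝔡 : 𝔡.IsStructure 𝕊) {Δ Δ' Ξ : List (Ty 𝕊.toSymbols)}
    {b b' : Tm 𝕊.toSymbols} {A B : Ty 𝕊.toSymbols} (h : 𝔡.Interprets (.tmEq (Δ ++ Δ') Ξ b b' B))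
    (hA : 𝔡.Interprets (.ty Δ A)) :
    𝔡.Interprets (.tmEq (wkCtx Δ A Δ') (Ξ.map (Ty.isub (wkAt Δ.length)))
      (b.isub (wkAt Δ.length)) (b'.isub (wkAt Δ.length)) (B.isub (wkAt Δ.length))) := by
  obtain ⟨Z, S, hZ, hS⟩ := hA
  obtain ⟨Z₁, X, T, g, hZ₁, hX, hT, hg, hg'⟩ := h
  obtain ⟨Z₂, w, hZ₂, _, hσ⟩ := h𝔡.exists_wk hZ hS hZ₁
  exact ⟨Z₂, _, _, _, hZ₂, hX.isub w hσ, hT.isub w hσ, hg.isub w hσ, hg'.isub w hσ⟩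

theorem int_exch_ty_eq (h𝔡 : 𝔡.IsStructure 𝕊) {Δ Δ' : List (Ty 𝕊.toSymbols)}
    {A A' B B' : Ty 𝕊.toSymbols} (h : 𝔡.Interprets (.tyEq (Δ ++ A :: A' :: Δ') B B'))
    (hA : 𝔡.Interprets (.ty Δ A')) :
    𝔡.Interprets (.tyEq (exCtx Δ A A' Δ') (B.isub (exAt Δ.length)) (B'.isub (exAt Δ.length))) := by
  obtain ⟨Z₁, T, hZ₁, hT, hT'⟩ := h
  obtain ⟨Z₂, w, hZ₂, hσ⟩ := h𝔡.exists_ex hZ₁ hA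
  exact ⟨Z₂, _, hZ₂, hT.isub w hσ, hT'.isub w hσ⟩

theorem int_exch_tm_eq (h𝔡 : 𝔡.IsStructure 𝕊) {Δ Δ' Ξ : List (Ty 𝕊.toSymbols)}
    {b b' : Tm 𝕊.toSymbols} {A A' B : Ty 𝕊.toSymbols}
    (h : 𝔡.Interprets (.tmEq (Δ ++ A :: A' :: Δ') Ξ b b' B)) (hA : 𝔡.Interprets (.ty Δ A')) :
    𝔡.Interprets (.tmEq (exCtx Δ A A' Δ') (Ξ.map (Ty.isub (exAt Δ.length)))
      (b.isub (exAt Δ.length)) (b'.isub (exAt Δ.length)) (B.isub (exAt Δ.length))) := by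
  obtain ⟨Z₁, X, T, g, hZ₁, hX, hT, hg, hg'⟩ := h
  obtain ⟨Z₂, w, hZ₂, hσ⟩ := h𝔡.exists_ex hZ₁ hA
  exact ⟨Z₂, _, _, _, hZ₂, hX.isub w hσ, hT.isub w hσ, hg.isub w hσ, hg'.isub w hσ⟩

theorem int_ty_subst_eq (h𝔡 : 𝔡.IsStructure 𝕊) {Δ Δ' : List (Ty 𝕊.toSymbols)}
    {a : Tm 𝕊.toSymbols} {A B B' : Ty 𝕊.toSymbols}
    (h : 𝔡.Interprets (.tyEq (Δ ++ A :: Δ') B B')) (ha : 𝔡.Interprets (.tm Δ [] a A)) :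
    𝔡.Interprets (.tyEq (subCtx Δ a Δ') (B.isub (subAt Δ.length a))
      (B'.isub (subAt Δ.length a))) := by
  obtain ⟨Z, _, S, f, hZ, hX, hS, hf⟩ := ha
  obtain rfl := ILin.nil_inv hX
  obtain ⟨Z₁, T, hZ₁, hT, hT'⟩ := h
  obtain ⟨Z₂, w, hZ₂, _, hσ⟩ := h𝔡.exists_sub hZ hS hf hZ₁
  exact ⟨Z₂, _, hZ₂, hT.isub w hσ, hT'.isub w hσ⟩

theorem int_tm_subst_eq (h𝔡 : 𝔡.IsStructure 𝕊) {Δ Δ' Ξ : List (Ty 𝕊.toSymbols)}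
    {a b b' : Tm 𝕊.toSymbols} {A B : Ty 𝕊.toSymbols}
    (h : 𝔡.Interprets (.tmEq (Δ ++ A :: Δ') Ξ b b' B)) (ha : 𝔡.Interprets (.tm Δ [] a A)) :
    𝔡.Interprets (.tmEq (subCtx Δ a Δ') (Ξ.map (Ty.isub (subAt Δ.length a)))
      (b.isub (subAt Δ.length a)) (b'.isub (subAt Δ.length a)) (B.isub (subAt Δ.length a))) := by
  obtain ⟨Z, _, S, f, hZ, hX, hS, hf⟩ := ha
  obtain rfl := ILin.nil_inv hX
  obtain ⟨Z₁, X, T, g, hZ₁, hX, hT, hg, hg'⟩ := h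
  obtain ⟨Z₂, w, hZ₂, _, hσ⟩ := h𝔡.exists_sub hZ hS hf hZ₁
  exact ⟨Z₂, _, _, _, hZ₂, hX.isub w hσ, hT.isub w hσ, hg.isub w hσ, hg'.isub w hσ⟩

-- Only existence is carried through the induction. Functionality of the interpretation serves to
-- match the contexts and types that different premises produce.
open Denot.Interprets in
theorem interprets (h𝔡 : 𝔡.IsStructure 𝕊) {J : Judgement 𝕊.toSymbols} (h : Der 𝕊 J) :
    𝔡.Interprets J := by
  induction h with
  | c_emp => exact ⟨_, [], .empty, .nil⟩
  | int_c_ext _ _ ih ih' =>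
    obtain ⟨Z, X, hZ, hX⟩ := ih
    obtain ⟨Z', S, hZ', hS⟩ := ih'
    obtain rfl := h𝔡.ctx_unique hZ hZ'
    exact ⟨_, _, .ext hZ hS, hX.weaken S⟩
  | int_c_ext_eq _ _ ih ih' =>
    obtain ⟨Z, X, hZ, hX, hZ₁, hX₁⟩ := ih
    obtain ⟨Z', S, hZ', hS, hS₁⟩ := ih'
    obtain rfl := h𝔡.ctx_unique hZ hZ'
    exact ⟨_, _, .ext hZ hS, hX.weaken S, .ext hZ₁ hS₁, hX₁.weaken S⟩
  | lin_c_ext _ _ ih ih' =>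
    obtain ⟨Z, X, hZ, hX⟩ := ih
    obtain ⟨Z', S, hZ', hS⟩ := ih'
    obtain rfl := h𝔡.ctx_unique hZ hZ'
    exact ⟨Z, S :: X, hZ, .cons hS hX⟩
  | lin_c_ext_eq _ _ ih ih' =>
    obtain ⟨Z, X, hZ, hX, hZ₁, hX₁⟩ := ih
    obtain ⟨Z', S, hZ', hS, hS₁⟩ := ih'
    obtain rfl := h𝔡.ctx_unique hZ hZ'
    exact ⟨Z, S :: X, hZ, .cons hS hX, hZ₁, .cons hS₁ hX₁⟩
  | int_var _ ih =>
    obtain ⟨Z, _, hZ, _⟩ := ih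
    obtain ⟨s, hs, hs'⟩ := hZ.exists_var
    exact ⟨Z, [], s.1, s.2, hZ, .nil, hs', .ivar hs⟩
  | lin_var _ ih =>
    obtain ⟨Z, _, hZ, hX⟩ := ih
    obtain ⟨S, _, hS, hX', rfl⟩ := hX.cons_inv
    obtain rfl := ILin.nil_inv hX'
    exact ⟨Z, [S], S, _, hZ, hX, hS, .lvar⟩
  | c_eq_r _ ih =>
    obtain ⟨Z, X, hZ, hX⟩ := ih
    exact ⟨Z, X, hZ, hX, hZ, hX⟩
  | c_eq_s _ ih =>
    obtain ⟨Z, X, hZ, hX, hZ', hX'⟩ := ih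
    exact ⟨Z, X, hZ', hX', hZ, hX⟩
  | c_eq_t _ _ ih ih' =>
    obtain ⟨Z, X, hZ, hX, hZ', hX'⟩ := ih
    obtain ⟨Z₁, X₁, hZ₁, hX₁, hZ₁', hX₁'⟩ := ih'
    obtain rfl := h𝔡.ctx_unique hZ' hZ₁
    obtain rfl := h𝔡.lin_unique hX' hX₁
    exact ⟨Z, X, hZ, hX, hZ₁', hX₁'⟩
  | ty_eq_r _ ih => exact ih.tyEq_refl
  | ty_eq_s _ ih =>
    obtain ⟨Z, S, hZ, hS, hS'⟩ := ih
    exact ⟨Z, S, hZ, hS', hS⟩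
  | ty_eq_t _ _ ih ih' =>
    obtain ⟨Z, S, hZ, hS, hS'⟩ := ih
    obtain ⟨Z₁, S₁, hZ₁, hS₁, hS₁'⟩ := ih'
    obtain rfl := h𝔡.ctx_unique hZ hZ₁
    obtain rfl := h𝔡.ty_unique hS' hS₁
    exact ⟨Z, S, hZ, hS, hS₁'⟩
  | tm_eq_r _ ih => exact ih.tmEq_refl
  | tm_eq_s _ ih =>
    obtain ⟨Z, X, S, f, hZ, hX, hS, hf, hf'⟩ := ih
    exact ⟨Z, X, S, f, hZ, hX, hS, hf', hf⟩
  | tm_eq_t _ _ ih ih' =>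
    obtain ⟨Z, X, S, f, hZ, hX, hS, hf, hf'⟩ := ih
    obtain ⟨Z₁, X₁, S₁, f₁, hZ₁, hX₁, hS₁, hf₁, hf₁'⟩ := ih'
    obtain rfl := h𝔡.ctx_unique hZ hZ₁
    obtain rfl := h𝔡.lin_unique hX hX₁
    obtain rfl := h𝔡.ty_unique hS hS₁
    obtain rfl := h𝔡.tm_unique' hf' hf₁
    exact ⟨Z, X, S, f, hZ, hX, hS, hf, hf₁'⟩
  | tm_conv _ _ _ ih ih₁ ih₂ =>
    obtain ⟨Z, X, S, f, hZ, hX, hS, hf⟩ := ih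
    obtain ⟨Z₁, X₁, hZ₁, hX₁, hZ₁', hX₁'⟩ := ih₁
    obtain ⟨Z₂, S₂, hZ₂, hS₂, hS₂'⟩ := ih₂
    obtain rfl := h𝔡.ctx_unique hZ hZ₁
    obtain rfl := h𝔡.ctx_unique hZ hZ₂
    obtain rfl := h𝔡.lin_unique hX hX₁
    obtain rfl := h𝔡.ty_unique hS hS₂
    exact ⟨Z, X, S, f, hZ₁', hX₁', hS₂', hf⟩
  | ty_conv _ _ ih ih₁ =>
    obtain ⟨Z, S, hZ, hS⟩ := ih
    obtain ⟨Z₁, X₁, hZ₁, _, hZ₁', _⟩ := ih₁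
    obtain rfl := h𝔡.ctx_unique hZ hZ₁
    exact ⟨Z, S, hZ₁', hS⟩
  | tm_eq_conv _ _ _ ih ih₁ ih₂ =>
    obtain ⟨Z, X, S, f, hZ, hX, hS, hf, hf'⟩ := ih
    obtain ⟨Z₁, X₁, hZ₁, hX₁, hZ₁', hX₁'⟩ := ih₁
    obtain ⟨Z₂, S₂, hZ₂, hS₂, hS₂'⟩ := ih₂
    obtain rfl := h𝔡.ctx_unique hZ hZ₁
    obtain rfl := h𝔡.ctx_unique hZ hZ₂
    obtain rfl := h𝔡.lin_unique hX hX₁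
    obtain rfl := h𝔡.ty_unique hS hS₂
    exact ⟨Z, X, S, f, hZ₁', hX₁', hS₂', hf, hf'⟩
  | ty_eq_conv _ _ ih ih₁ =>
    obtain ⟨Z, S, hZ, hS, hS'⟩ := ih
    obtain ⟨Z₁, X₁, hZ₁, _, hZ₁', _⟩ := ih₁
    obtain rfl := h𝔡.ctx_unique hZ hZ₁
    exact ⟨Z, S, hZ₁', hS, hS'⟩
  | int_weak_ty _ _ ih ih' => exact (h𝔡.int_weak_ty_eq ih.tyEq_refl ih').ty_of_tyEq
  | int_weak_ty_eq _ _ ih ih' => exact h𝔡.int_weak_ty_eq ih ih'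
  | int_weak_tm _ _ ih ih' => exact (h𝔡.int_weak_tm_eq ih.tmEq_refl ih').tm_of_tmEq
  | int_weak_tm_eq _ _ ih ih' => exact h𝔡.int_weak_tm_eq ih ih'
  | int_exch_ty _ _ ih ih' => exact (h𝔡.int_exch_ty_eq ih.tyEq_refl ih').ty_of_tyEq
  | int_exch_ty_eq _ _ ih ih' => exact h𝔡.int_exch_ty_eq ih ih'
  | int_exch_tm _ _ ih ih' => exact (h𝔡.int_exch_tm_eq ih.tmEq_refl ih').tm_of_tmEq
  | int_exch_tm_eq _ _ ih ih' => exact h𝔡.int_exch_tm_eq ih ih'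
  | lin_exch_tm _ ih => exact (lin_exch_tm_eq ih.tmEq_refl).tm_of_tmEq
  | lin_exch_tm_eq _ ih => exact lin_exch_tm_eq ih
  | int_ty_subst _ _ ih ih' => exact (h𝔡.int_ty_subst_eq ih.tyEq_refl ih').ty_of_tyEq
  | int_ty_subst_eq _ _ ih ih' => exact h𝔡.int_ty_subst_eq ih ih'
  | int_tm_subst _ _ ih ih' => exact (h𝔡.int_tm_subst_eq ih.tmEq_refl ih').tm_of_tmEq
  | int_tm_subst_eq _ _ ih ih' => exact h𝔡.int_tm_subst_eq ih ih'
  | lin_tm_subst _ _ ih ih' => exact (h𝔡.lin_tm_subst_eq ih.tmEq_refl ih').tm_of_tmEq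
  | lin_tm_subst_eq _ _ ih ih' => exact h𝔡.lin_tm_subst_eq ih ih'
  | con_ty T _ _ _ ih _ ih' =>
    exact (h𝔡.con_ty_eq T ih fun i => (ih' i).tmEq_refl).ty_of_tyEq
  | con_ty_eq T _ _ _ ih _ ih' => exact h𝔡.con_ty_eq T ih ih'
  | con_tm c _ _ _ _ _ _ ih ih' =>
    exact (h𝔡.con_tm_eq c (fun i => (ih i).tmEq_refl) ih'.tmEq_refl).tm_of_tmEq
  | con_tm_eq c _ _ _ _ _ _ ih ih' => exact h𝔡.con_tm_eq c ih ih'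
  | I_F _ ih =>
    obtain ⟨Z, _, hZ, _⟩ := ih
    exact ⟨Z, .unit, hZ, .unit⟩
  | I_I _ ih =>
    obtain ⟨Z, _, hZ, _⟩ := ih
    exact ⟨Z, [], .unit, _, hZ, .nil, .unit, .star⟩
  | I_E _ _ ih ih' => exact (h𝔡.I_E_eq ih.tmEq_refl ih'.tmEq_refl).tm_of_tmEq
  | I_E_eq _ _ ih ih' => exact h𝔡.I_E_eq ih ih'
  | I_C _ ih => exact ih.tmEq_of_tm fun _ _ _ _ _ _ _ h => h.letU_star
  | I_U _ ih => exact ih.tmEq_of_tm fun _ _ _ _ _ _ _ h => h.letU_eta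
  | T_F _ _ ih ih' =>
    obtain ⟨Z, S, hZ, hS⟩ := ih
    obtain ⟨Z', T, hZ', hT⟩ := ih'
    obtain rfl := h𝔡.ctx_unique hZ hZ'
    exact ⟨Z, _, hZ, .tensor hS hT⟩
  | T_F_eq _ _ ih ih' =>
    obtain ⟨Z, S, hZ, hS, hS₁⟩ := ih
    obtain ⟨Z', T, hZ', hT, hT₁⟩ := ih'
    obtain rfl := h𝔡.ctx_unique hZ hZ'
    exact ⟨Z, _, hZ, .tensor hS hT, .tensor hS₁ hT₁⟩
  | T_I _ _ ih ih' => exact (h𝔡.T_I_eq ih.tmEq_refl ih'.tmEq_refl).tm_of_tmEq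
  | T_I_eq _ _ ih ih' => exact h𝔡.T_I_eq ih ih'
  | T_E _ _ ih ih' => exact (h𝔡.T_E_eq ih.tmEq_refl ih'.tmEq_refl).tm_of_tmEq
  | T_E_eq _ _ ih ih' => exact h𝔡.T_E_eq ih ih'
  | T_C _ ih => exact ih.tmEq_of_tm fun _ _ _ _ _ _ _ h => h.letT_tens
  | T_U _ ih => exact ih.tmEq_of_tm fun _ _ _ _ _ _ _ h => h.letT_eta
  | comm_I C _ ih => exact ih.tmEq_of_tm fun _ _ _ _ _ _ hl h => h.plug_letU hl
  | comm_T C _ ih => exact ih.tmEq_of_tm fun _ _ _ _ _ _ hl h => h.plug_letT hl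

theorem ctxDef (h𝔡 : 𝔡.IsStructure 𝕊) {Δ Ξ : List (Ty 𝕊.toSymbols)}
    (h : 𝔡.Interprets (.ctx Δ Ξ)) : CtxDef 𝔡 Δ Ξ := by
  obtain ⟨Z, X, hZ, hX⟩ := h
  refine ⟨⟨Z, hZ, fun _ h => h𝔡.ctx_unique h hZ⟩, fun Z' hZ' => ?_⟩
  obtain rfl := h𝔡.ctx_unique hZ hZ'
  exact ⟨X, hX, fun _ h => h𝔡.lin_unique h hX⟩

theorem tyDef (h𝔡 : 𝔡.IsStructure 𝕊) {Δ : List (Ty 𝕊.toSymbols)} {A : Ty 𝕊.toSymbols}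
    (h : 𝔡.Interprets (.ty Δ A)) : TyDef 𝔡 Δ A := by
  obtain ⟨Z, S, hZ, hS⟩ := h
  refine ⟨⟨Z, hZ, fun _ h => h𝔡.ctx_unique h hZ⟩, fun Z' hZ' => ?_⟩
  obtain rfl := h𝔡.ctx_unique hZ hZ'
  exact ⟨S, hS, fun _ h => h𝔡.ty_unique h hS⟩

theorem tmDef (h𝔡 : 𝔡.IsStructure 𝕊) {Δ Ξ : List (Ty 𝕊.toSymbols)} {a : Tm 𝕊.toSymbols}
    {A : Ty 𝕊.toSymbols} (h : 𝔡.Interprets (.tm Δ Ξ a A)) : TmDef 𝔡 Δ Ξ a A := by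
  obtain ⟨Z, X, S, f, hZ, hX, hS, hf⟩ := h
  refine ⟨h𝔡.ctxDef ⟨Z, X, hZ, hX⟩, h𝔡.tyDef ⟨Z, S, hZ, hS⟩, fun Z' X' S' hZ' hX' hS' => ?_⟩
  obtain rfl := h𝔡.ctx_unique hZ hZ'
  obtain rfl := h𝔡.lin_unique hX hX'
  obtain rfl := h𝔡.ty_unique hS hS'
  exact ⟨f, hf, fun _ h => h𝔡.tm_unique' h hf⟩

/-- Any interpretation coincides with the one that exists, so uniqueness and agreement of the two
sides of an equality are immediate. -/
theorem valid (h𝔡 : 𝔡.IsStructure 𝕊) {J : Judgement 𝕊.toSymbols} (h : 𝔡.Interprets J) :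
    Valid 𝔡 J := by
  cases J with
  | ctx => exact h𝔡.ctxDef h
  | ty => exact h𝔡.tyDef h
  | tm => exact h𝔡.tmDef h
  | ctxEq =>
    obtain ⟨Z, X, hZ, hX, hZ', hX'⟩ := h
    refine ⟨h𝔡.ctxDef ⟨Z, X, hZ, hX⟩, h𝔡.ctxDef ⟨Z, X, hZ', hX'⟩, fun Z₁ X₁ hZ₁ hX₁ => ?_⟩
    obtain rfl := h𝔡.ctx_unique hZ hZ₁
    obtain rfl := h𝔡.lin_unique hX hX₁
    exact ⟨hZ', hX'⟩
  | tyEq =>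
    obtain ⟨Z, S, hZ, hS, hS'⟩ := h
    refine ⟨h𝔡.tyDef ⟨Z, S, hZ, hS⟩, h𝔡.tyDef ⟨Z, S, hZ, hS'⟩, fun Z₁ S₁ hZ₁ hS₁ => ?_⟩
    obtain rfl := h𝔡.ctx_unique hZ hZ₁
    obtain rfl := h𝔡.ty_unique hS hS₁
    exact hS'
  | tmEq =>
    obtain ⟨Z, X, S, f, hZ, hX, hS, hf, hf'⟩ := h
    refine ⟨h𝔡.tmDef ⟨Z, X, S, f, hZ, hX, hS, hf⟩, h𝔡.tmDef ⟨Z, X, S, f, hZ, hX, hS, hf'⟩,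
      fun Z₁ X₁ S₁ f₁ hZ₁ hX₁ hS₁ hf₁ => ?_⟩
    obtain rfl := h𝔡.ctx_unique hZ hZ₁
    obtain rfl := h𝔡.lin_unique hX hX₁
    obtain rfl := h𝔡.ty_unique hS hS₁
    obtain rfl := h𝔡.tm_unique' hf hf₁
    exact hf'

end Denot.IsStructure

end ILDTT

/-! ### The soundness theorem -/

open ILDTT in
theorem mainTheorem2 {𝕊 : Signature.{w}} {M : Model.{v₁, u₁, v, u}}
    (𝔡 : Denot 𝕊.toSymbols M) (h𝔡 : 𝔡.IsStructure 𝕊) :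
    -- every derivable judgement is valid
    (∀ J, Der 𝕊 J → Valid 𝔡 J) ∧
    -- intuitionistic weakening
    (∀ Δ Δ' A Z S Z₁, Der 𝕊 (.ctx (Δ ++ Δ') []) → Der 𝕊 (.ty Δ A) →
      ICtx 𝔡 Δ Z → ITy 𝔡 Z.vars A S → ICtx 𝔡 (Δ ++ Δ') Z₁ →
      ∃ (Z₂ : SCtx M) (w : Z₂.D ⟶ Z₁.D), ICtx 𝔡 (wkCtx Δ A Δ') Z₂ ∧
        QExt (W₀ := Z.ext S) (Z₀ := Z) (Model.p Z.D S.el) Δ'.length Z₂ Z₁ w ∧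
        (∀ B T, Der 𝕊 (.ty (Δ ++ Δ') B) → ITy 𝔡 Z₁.vars B T →
          ITy 𝔡 Z₂.vars (B.isub (wkAt Δ.length)) (T.re w)) ∧
        (∀ Ξ b B X T g, Der 𝕊 (.tm (Δ ++ Δ') Ξ b B) → ILin 𝔡 Z₁.vars Ξ X →
          ITy 𝔡 Z₁.vars B T → ITm 𝔡 Z₁.vars X b T g →
          ILin 𝔡 Z₂.vars (Ξ.map (Ty.isub (wkAt Δ.length))) (X.map (STy.re w)) ∧
          ITy 𝔡 Z₂.vars (B.isub (wkAt Δ.length)) (T.re w) ∧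
          ITm 𝔡 Z₂.vars (X.map (STy.re w)) (b.isub (wkAt Δ.length)) (T.re w) (reTm w g))) ∧
    -- intuitionistic substitution
    (∀ Δ Δ' A a Z S f Z₁, Der 𝕊 (.ctx (Δ ++ A :: Δ') []) → Der 𝕊 (.tm Δ [] a A) →
      ICtx 𝔡 Δ Z → ITy 𝔡 Z.vars A S → ITm 𝔡 Z.vars [] a S f → ICtx 𝔡 (Δ ++ A :: Δ') Z₁ →
      ∃ (Z₂ : SCtx M) (w : Z₂.D ⟶ Z₁.D), ICtx 𝔡 (subCtx Δ a Δ') Z₂ ∧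
        QExt (W₀ := Z) (Z₀ := Z.ext S) (secMor S f) Δ'.length Z₂ Z₁ w ∧
        (∀ B T, Der 𝕊 (.ty (Δ ++ A :: Δ') B) → ITy 𝔡 Z₁.vars B T →
          ITy 𝔡 Z₂.vars (B.isub (subAt Δ.length a)) (T.re w)) ∧
        (∀ Ξ b B X T g, Der 𝕊 (.tm (Δ ++ A :: Δ') Ξ b B) → ILin 𝔡 Z₁.vars Ξ X →
          ITy 𝔡 Z₁.vars B T → ITm 𝔡 Z₁.vars X b T g →
          ILin 𝔡 Z₂.vars (Ξ.map (Ty.isub (subAt Δ.length a))) (X.map (STy.re w)) ∧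
          ITy 𝔡 Z₂.vars (B.isub (subAt Δ.length a)) (T.re w) ∧
          ITm 𝔡 Z₂.vars (X.map (STy.re w)) (b.isub (subAt Δ.length a)) (T.re w)
            (reTm w g))) ∧
    -- linear substitution
    (∀ Δ Ξ Ξ' A a b B Z X X' S T f g, Der 𝕊 (.tm Δ (A :: Ξ) b B) → Der 𝕊 (.tm Δ Ξ' a A) →
      ICtx 𝔡 Δ Z → ILin 𝔡 Z.vars Ξ X → ILin 𝔡 Z.vars Ξ' X' → ITy 𝔡 Z.vars A S →
      ITy 𝔡 Z.vars B T → ITm 𝔡 Z.vars X' a S f → ITm 𝔡 Z.vars (S :: X) b T g →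
      ITm 𝔡 Z.vars (X' ++ X) (b.lsub (linSub Ξ'.length a)) T
        ((split X X').hom ≫ linObj X ◁ f ≫ g)) := by
  refine ⟨fun J h => h𝔡.valid (h𝔡.interprets h), ?_, ?_, ?_⟩
  · intro Δ Δ' A Z S Z₁ _ _ hZ hS hZ₁
    obtain ⟨Z₂, w, hZ₂, hq, hσ⟩ := h𝔡.exists_wk hZ hS hZ₁
    exact ⟨Z₂, w, hZ₂, hq, fun B T _ hT => hT.isub w hσ,
      fun Ξ b B X T g _ hX hT hg => ⟨hX.isub w hσ, hT.isub w hσ, hg.isub w hσ⟩⟩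
  · intro Δ Δ' A a Z S f Z₁ _ _ hZ hS hf hZ₁
    obtain ⟨Z₂, w, hZ₂, hq, hσ⟩ := h𝔡.exists_sub hZ hS hf hZ₁
    exact ⟨Z₂, w, hZ₂, hq, fun B T _ hT => hT.isub w hσ,
      fun Ξ b B X T g _ hX hT hg => ⟨hX.isub w hσ, hT.isub w hσ, hg.isub w hσ⟩⟩
  · intro Δ Ξ Ξ' A a b B Z X X' S T f g _ _ _ _ hX' _ _ hf hg
    rw [hX'.length]
    exact hf.lsub_linSub hg
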